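/- **Setting.** Let $\mathcal X,\mathcal Z\subset\mathbb R^d$ be finite, let $\Theta\subset\mathbb R^d$ be closed and bounded with non-empty interior, and let $\theta_*\in\Theta$. Assume $\operatorname{span}(\mathcal Z)\subset\operatorname{span}(\mathcal X)$ and that $z_*=\arg\max_{z\in\mathcal Z}z^\top\theta_*$ is unique. For $z\in\mathcal Z$ put $\Theta_z^c=\{\theta\in\Theta:\exists z'\in\mathcal Z,\ z'\neq z,\ z'^\top\theta\ge z^\top\theta\}$. Assume the following non-degeneracy: $\theta_*$ lies in the closure of the interior of $\Theta$, and $\Theta_{z_*}^c$ is non-empty and contained in the closure of its interior. Write $\|v\|_A^2=v^\top Av$, $A(\lambda)=\sum_{x\in\mathcal X}\lambda_x xx^\top$, $\triangle_{\mathcal X}$ for the simplex, and $$\tau^*=\max_{\lambda\in\triangle_{\mathcal X}}\ \min_{\theta\in\Theta_{z_*}^c}\tfrac12\|\theta-\theta_*\|_{A(\lambda)}^2 .$$ Let $\lambda^G$ be a minimiser over $\triangle_{\mathcal X}$ of $\max_{x\in\mathcal X}\|x\|_{A(\lambda)^{-1}}^2$ (where $\|x\|^2_{A^{-1}}=x^\top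 u$ if $Au=x$, and $\infty$ if $x$ is not in the range of $A$). Let $L\ge\max_{x}\|x\|_2$, $B\ge\|\theta_*\|_2$, $T_\ell=2^\ell$, $\beta(t,q)=B+\sqrt{2\log q+d\log\frac{d+tL^2}{d}}$ and $$C_{3,\ell}=\max_{x\in\mathcal X,\theta\in\Theta}x^\top\theta+\max_{x\in\mathcal X,\theta,\theta'\in\Theta}|x^\top(\theta-\theta')|+L^2\beta(T_\ell,\ell^2),\qquad \eta_\lambda=\sqrt{\tfrac{\log|\mathcal X|}{C_{3,\ell}^2T_\ell}},\qquad \eta_p=\sqrt{\tfrac{d\log(T_\ell C_{3,\ell})}{C_{3,\ell}^2T_\ell}} .$$ **Algorithm.** For each $\ell=0,1,2,\dots$ start afresh the following procedure (PEPS). Put $V_0=I$, $S_0=0$, $\lambda_1=\frac1{|\mathcal X|}\mathbf 1$, and let $\hat\theta_1\in\mathbb R^d$ be an arbitrary fixed vector (the same for all $\ell$). For $t=1,\dots,T_\ell$: let $\hat z_t\in\arg\max_{z\in\mathcal Z}z^\top\hat\theta_t$; given the past of the epoch, draw independently $\theta_t$ from the distribution with density proportional to $\exp(-\frac{\eta_p}2\|\theta-\hat\theta_t\|_{V_{t-1}}^2)$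 on $\Theta_{\hat z_t}^c$ (the normal distribution $N(\hat\theta_t,\eta_p^{-1}V_{t-1}^{-1})$ truncated to $\Theta^c_{\hat z_t}$), the arm $x_t$ from $(1-t^{-1/4})\lambda_t+t^{-1/4}\lambda^G$, and $\epsilon_t\sim N(0,1)$; observe $y_t=x_t^\top\theta_*+\epsilon_t$; put $V_t=V_{t-1}+x_tx_t^\top$, $S_t=S_{t-1}+y_tx_t$, $\hat\theta_{t+1}=V_t^{-1}S_t$, and $\lambda_{t+1,x}\propto\lambda_{t,x}\exp(\eta_\lambda(x^\top(\theta_t-\hat\theta_t))^2)$ for $x\in\mathcal X$. **Theorem.** Let $\pi_\ell$ be the normal distribution $N(\hat\theta_{T_\ell},V_{T_\ell-1}^{-1})$ restricted to $\Theta$ and normalised, all quantities being those of epoch $\ell$. Then, with probability $1$, $$\lim_{\ell\to\infty}-\frac1{T_\ell}\log\pi_\ell(\Theta_{z_*}^c)=\tau^*\qquad\text{and}\qquad \lim_{\ell\to\infty}-\frac1{T_\ell}\log\mathbb P_{\theta\sim\pi_\ell}\Big(\arg\max_{z\in\mathcal Z}z^\top\theta\neq z_*\Big)=\tau^* .$$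 The same holds if $\pi_\ell$ is instead $N(\hat\theta_{T_\ell+1},V_{T_\ell}^{-1})$ restricted to $\Theta$ and normalised. -/

import Mathlib

open MeasureTheory ProbabilityTheory Filter Topology Matrix

noncomputable section

namespace PEPS

/-- Data of a linear bandit in `ℝ^d` (vectors are `Fin d → ℝ`, the inner product is `⬝ᵥ`):
measurement arms `X`, answers `Z`, parameter space `Θ`, true parameter `θs`, best answer `zs`. -/
structure Bandit (d : ℕ) where
  X : Finset (Fin d → ℝ)
  Z : Finset (Fin d → ℝ)
  Θ : Set (Fin d → ℝ)
  θs : Fin d → ℝ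
  zs : Fin d → ℝ

/-- Euclidean norm on `Fin d → ℝ`. -/
def norm2 {d : ℕ} (v : Fin d → ℝ) : ℝ := Real.sqrt (v ⬝ᵥ v)

/-- `‖v‖²_A = vᵀ A v`. -/
def sqNorm {d : ℕ} (A : Matrix (Fin d) (Fin d) ℝ) (v : Fin d → ℝ) : ℝ := v ⬝ᵥ (A *ᵥ v)

/-- `‖v‖²_{A⁻¹}` for symmetric positive semidefinite `A`, with value `∞` if `v` is not in the range
of `A`. If `A u = v` then `v ⬝ᵥ u` does not depend on the choice of `u`; for invertible `A` this is
`vᵀ A⁻¹ v`. -/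
def sqNormInv {d : ℕ} (A : Matrix (Fin d) (Fin d) ℝ) (v : Fin d → ℝ) : ENNReal :=
  ⨅ (u : Fin d → ℝ) (_ : A *ᵥ u = v), ENNReal.ofReal (v ⬝ᵥ u)

/-- The normal distribution with mean `m` and precision (inverse covariance) matrix `Q`, restricted
to `S` and normalised: density proportional to `exp (-‖θ - m‖²_Q / 2)` on `S`. -/
def truncNormal {d : ℕ} (m : Fin d → ℝ) (Q : Matrix (Fin d) (Fin d) ℝ) (S : Set (Fin d → ℝ)) :
    Measure (Fin d → ℝ) :=
  let ν := (volume.restrict S).withDensity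
    fun θ => ENNReal.ofReal (Real.exp (-(1 / 2) * sqNorm Q (θ - m)))
  (ν Set.univ)⁻¹ • ν

namespace Bandit

variable {d : ℕ} (M : Bandit d)

/-- `A(w) = ∑ₓ wₓ x xᵀ`. -/
def design (w : M.X → ℝ) : Matrix (Fin d) (Fin d) ℝ :=
  ∑ a : M.X, w a • vecMulVec (a : Fin d → ℝ) (a : Fin d → ℝ)

/-- `Θ_z^c`: the parameters for which some answer other than `z` is at least as good as `z`. -/
def alt (z : Fin d → ℝ) : Set (Fin d → ℝ) :=
  {θ | θ ∈ M.Θ ∧ ∃ z' ∈ M.Z, z' ≠ z ∧ z ⬝ᵥ θ ≤ z' ⬝ᵥ θ}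

/-- `τ* = max_w min_θ ½ ‖θ - θ*‖²_{A(w)}`, over `w` in the simplex and `θ` in the alternative. -/
def tauStar : ℝ :=
  ⨆ w : stdSimplex ℝ M.X, ⨅ θ : M.alt M.zs,
    (1 / 2) * sqNorm (M.design (w : M.X → ℝ)) ((θ : Fin d → ℝ) - M.θs)

/-- `w` minimises `maxₓ ‖x‖²_{A(w)⁻¹}` over the simplex. -/
def IsGOptimal (w : M.X → ℝ) : Prop :=
  w ∈ stdSimplex ℝ M.X ∧ ∀ w' ∈ stdSimplex ℝ M.X,
    (⨆ a : M.X, sqNormInv (M.design w) a) ≤ ⨆ a : M.X, sqNormInv (M.design w') a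

/-- `f` is an argmax oracle for `Z` (with some tie-breaking). -/
def IsArgmaxOracle (f : (Fin d → ℝ) → Fin d → ℝ) : Prop :=
  Measurable f ∧ ∀ θ, f θ ∈ M.Z ∧ ∀ z ∈ M.Z, z ⬝ᵥ θ ≤ f θ ⬝ᵥ θ

/-- `Δ_max = maxₓ max_{θ, θ'} |xᵀ(θ - θ')|`. -/
def deltaMax : ℝ :=
  sSup {r | ∃ a ∈ M.X, ∃ θ ∈ M.Θ, ∃ θ' ∈ M.Θ, r = |a ⬝ᵥ (θ - θ')|}

/-- `B_X = maxₓ max_θ xᵀθ`. -/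
def rewardMax : ℝ := sSup {r | ∃ a ∈ M.X, ∃ θ ∈ M.Θ, r = a ⬝ᵥ θ}

/-- `β(t, q) = B + √(2 log q + d log ((d + t L²) / d))`. -/
def beta (d : ℕ) (L B t q : ℝ) : ℝ :=
  B + Real.sqrt (2 * Real.log q + d * Real.log ((d + t * L ^ 2) / d))

/-- The horizon of epoch `ℓ`. -/
def horizon (ℓ : ℕ) : ℕ := 2 ^ ℓ

/-- `C_{3,ℓ} = B_X + Δ_max + L² β(T_ℓ, ℓ²)`. -/
def C3 (L B : ℝ) (ℓ : ℕ) : ℝ :=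
  M.rewardMax + M.deltaMax + L ^ 2 * beta d L B (horizon ℓ) ((ℓ : ℝ) ^ 2)

/-- Step size of the learner over the arms in epoch `ℓ`. -/
def etaLam (L B : ℝ) (ℓ : ℕ) : ℝ :=
  Real.sqrt (Real.log M.X.card / (M.C3 L B ℓ ^ 2 * horizon ℓ))

/-- Step size of the sampling distribution in epoch `ℓ`. -/
def etaP (L B : ℝ) (ℓ : ℕ) : ℝ :=
  Real.sqrt (d * Real.log (horizon ℓ * M.C3 L B ℓ) / (M.C3 L B ℓ ^ 2 * horizon ℓ))

/-- `V_n = I + ∑_{s=1}^n x_s x_sᵀ`. -/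
def gram (x : ℕ → M.X) (n : ℕ) : Matrix (Fin d) (Fin d) ℝ :=
  1 + ∑ s ∈ Finset.Icc 1 n, vecMulVec (x s : Fin d → ℝ) (x s : Fin d → ℝ)

/-- The reward `y_t = ⟨x_t, θ*⟩ + ε_t`. -/
def reward (x : ℕ → M.X) (ε : ℕ → ℝ) (t : ℕ) : ℝ := (x t : Fin d → ℝ) ⬝ᵥ M.θs + ε t

/-- The estimate based on the first `n` observations, that is `θ̂_{n+1}`:
the arbitrary initial value `θ₁` if `n = 0`, and `V_n⁻¹ ∑_{s=1}^n y_s x_s` otherwise. -/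
def est (θ₁ : Fin d → ℝ) (x : ℕ → M.X) (ε : ℕ → ℝ) (n : ℕ) : Fin d → ℝ :=
  if n = 0 then θ₁
  else (M.gram x n)⁻¹ *ᵥ ∑ s ∈ Finset.Icc 1 n, M.reward x ε s • (x s : Fin d → ℝ)

/-- The gain `g_{t,a} = ‖θ_t - θ̂_t‖²_{aaᵀ} = ⟨a, θ_t - θ̂_t⟩²` of arm `a` at time `t`. -/
def gain (θ₁ : Fin d → ℝ) (θ : ℕ → Fin d → ℝ) (x : ℕ → M.X) (ε : ℕ → ℝ) (t : ℕ) (a : M.X) : ℝ :=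
  ((a : Fin d → ℝ) ⬝ᵥ (θ t - M.est θ₁ x ε (t - 1))) ^ 2

/-- Exponential weights: `hedge η g n` is `λ_{n+1}`, the weights after the gains `g 1, …, g n`. -/
def hedge (η : ℝ) (g : ℕ → M.X → ℝ) : ℕ → M.X → ℝ
  | 0 => fun _ => 1 / (M.X.card : ℝ)
  | n + 1 => fun a =>
      hedge η g n a * Real.exp (η * g (n + 1) a) /
        ∑ b : M.X, hedge η g n b * Real.exp (η * g (n + 1) b)

/-- The distribution `(1 - γ_t) λ_t + γ_t λ^G` of `x_t`, with `γ_t = t^(-1/4)`. -/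
def armLaw (η : ℝ) (lamG : M.X → ℝ) (θ₁ : Fin d → ℝ) (θ : ℕ → Fin d → ℝ) (x : ℕ → M.X)
    (ε : ℕ → ℝ) (t : ℕ) (a : M.X) : ℝ :=
  (1 - (t : ℝ) ^ (-(1 / 4) : ℝ)) * M.hedge η (M.gain θ₁ θ x ε) (t - 1) a
    + (t : ℝ) ^ (-(1 / 4) : ℝ) * lamG a

/-- The distribution of `θ_t`: normal with mean `θ̂_t` and covariance `(η V_{t-1})⁻¹`, truncated to
the alternative of the current best answer `ẑ_t = f θ̂_t`. -/
def paramLaw (η : ℝ) (f : (Fin d → ℝ) → Fin d → ℝ) (θ₁ : Fin d → ℝ) (x : ℕ → M.X)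
    (ε : ℕ → ℝ) (t : ℕ) : Measure (Fin d → ℝ) :=
  truncNormal (M.est θ₁ x ε (t - 1)) (η • M.gram x (t - 1)) (M.alt (f (M.est θ₁ x ε (t - 1))))

/-- The normal distribution `N(θ̂_{n+1}, V_n⁻¹)` restricted to `Θ`. -/
def posterior (θ₁ : Fin d → ℝ) (x : ℕ → M.X) (ε : ℕ → ℝ) (n : ℕ) : Measure (Fin d → ℝ) :=
  truncNormal (M.est θ₁ x ε n) (M.gram x n) M.Θ

/-- The history `σ((θ_s, x_s, ε_s) : 1 ≤ s < t)`; as `ε_s = y_s - ⟨x_s, θ*⟩`, it is also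
`σ((θ_s, x_s, y_s) : 1 ≤ s < t)`. -/
abbrev history {Ω : Type*} (θ : ℕ → Ω → Fin d → ℝ) (x : ℕ → Ω → M.X) (ε : ℕ → Ω → ℝ) (t : ℕ) :
    MeasurableSpace Ω :=
  ⨆ s ∈ Finset.Ico 1 t, MeasurableSpace.comap (fun ω => (θ s ω, x s ω, ε s ω)) inferInstance

/-- `(θ_t, x_t, ε_t)_{1 ≤ t ≤ T}` is a run of PEPS with horizon `T` and step sizes `ηlam`, `ηp`:
given the history, the parameter `θ_t`, the arm `x_t` and the noise `ε_t` are drawn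
independently, `θ_t` from the truncated normal, `x_t` from the mixture of the exponential weights
with the G-optimal design, and `ε_t` from `N(0, 1)`. -/
structure IsRun {Ω : Type*} [MeasurableSpace Ω] (P : Measure Ω) (T : ℕ) (ηlam ηp : ℝ)
    (lamG : M.X → ℝ) (f : (Fin d → ℝ) → Fin d → ℝ) (θ₁ : Fin d → ℝ)
    (θ : ℕ → Ω → Fin d → ℝ) (x : ℕ → Ω → M.X) (ε : ℕ → Ω → ℝ) : Prop where
  measurable_param : ∀ t ∈ Finset.Icc 1 T, Measurable (θ t)
  measurable_arm : ∀ t ∈ Finset.Icc 1 T, Measurable (x t)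
  measurable_noise : ∀ t ∈ Finset.Icc 1 T, Measurable (ε t)
  step_law : ∀ t ∈ Finset.Icc 1 T, ∀ (U : Set (Fin d → ℝ)) (a : M.X) (C : Set ℝ),
    MeasurableSet U → MeasurableSet C →
    P[Set.indicator {ω | θ t ω ∈ U ∧ x t ω = a ∧ ε t ω ∈ C} (fun _ => (1 : ℝ)) |
        M.history θ x ε t] =ᵐ[P]
      fun ω =>
        (M.paramLaw ηp f θ₁ (fun s => x s ω) (fun s => ε s ω) t).real U *
        M.armLaw ηlam lamG θ₁ (fun s => θ s ω) (fun s => x s ω) (fun s => ε s ω) t a *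
        (gaussianReal 0 1).real C

/-- A run of the doubling scheme: for every `ℓ`, epoch `ℓ` is a fresh run of PEPS with horizon
`T_ℓ` and the step sizes of that epoch. Nothing is demanded of the joint law of different
epochs, so independent restarts are a special case. -/
def IsDoublingRun {Ω : Type*} [MeasurableSpace Ω] (P : Measure Ω) (L B : ℝ)
    (lamG : M.X → ℝ) (f : (Fin d → ℝ) → Fin d → ℝ) (θ₁ : Fin d → ℝ)
    (θ : ℕ → ℕ → Ω → Fin d → ℝ) (x : ℕ → ℕ → Ω → M.X) (ε : ℕ → ℕ → Ω → ℝ) : Prop :=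
  ∀ ℓ, M.IsRun P (horizon ℓ) (M.etaLam L B ℓ) (M.etaP L B ℓ) lamG f θ₁ (θ ℓ) (x ℓ) (ε ℓ)

end Bandit

end PEPS

end

/-! For `n ≠ 0` the Gaussian posterior on `Θ` has density proportional to `exp (-energy)`. Here
`energy` is the noiseless loss `cumLoss`, the sum of `½ ⟨x_s, ϑ - θ*⟩²` over the arms played, plus a
regulariser bounded on `Θ` and a noise term linear in `ϑ`. In almost surely all but finitely many
epochs the noise collected by each arm is `O(ℓ √T)`, hence `o(T)`. The closure-of-interior
assumptions provide volume near every alternative and near `θ*`. Laplace's method then gives the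
alternative an unnormalised mass `exp (-min cumLoss + o(T))` and the normaliser `exp (o(T))`. It
remains to show that the minimum of `cumLoss / T` over the alternative tends to `τ*`.

At most `τ*`: `cumLoss / T` is the objective of the game at the empirical design, and no design has
value above `τ*` (`exists_cumLoss_le`).

At least `τ* - δ` (`eventually_le_cumLoss`): two no-regret players face each other. The arm player
runs exponential weights with gains `⟨a, θ_t - θ̂_t⟩²`, about twice the true losses once `θ̂_t` is
accurate, and so collects nearly what any fixed design `w` guarantees
(`mul_le_sum_armLaw_mul_armLoss`). The truncated Gaussian is exactly continuous exponential weights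
on the alternative, so its mean loss is little more than that of any fixed `ϑ₀`
(`sum_integral_noisyLoss_le`). A martingale, `lossGap`, exchanges the loss averaged over arms for
the loss averaged over parameters. Chaining the three gives `T * designValue w ≤ cumLoss ϑ₀ + o(T)`
for all `w` and `ϑ₀`; the supremum over `w` finishes, without a minimax theorem.

The exploration rate `t^(-1/4)` along the G-optimal design makes `θ̂_t` accurate in every arm
direction after a burn-in of `ℓ^8` rounds (`sq_est_le`). By the span condition the current answer is
then `z_*`, so the parameter player works on one fixed set. As `T = 2^ℓ`, the burn-in is
polylogarithmic in `T`, and every error is either a polynomial in `ℓ` times at most `√T` or a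
vanishing fraction of `T`. The failure probabilities are summable in `ℓ`, so Borel–Cantelli applies
whatever the dependence between epochs. -/

noncomputable section

namespace PEPS

namespace Bandit

/-! ### Losses, noise, and the quadratic form centred at the estimate. -/

variable {d : ℕ} (M : Bandit d)

/-- The sum of the noise observed when arm `a` was played. -/
def armNoise (x : ℕ → M.X) (ε : ℕ → ℝ) (n : ℕ) (a : M.X) : ℝ :=
  ∑ s ∈ Finset.Icc 1 n, if x s = a then ε s else 0

/-- The number of plays of arm `a`. -/
def armCount (x : ℕ → M.X) (n : ℕ) (a : M.X) : ℝ :=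
  ∑ s ∈ Finset.Icc 1 n, if x s = a then 1 else 0

/-- The noise vector `∑ ε_s x_s`. -/
def noise (x : ℕ → M.X) (ε : ℕ → ℝ) (n : ℕ) : Fin d → ℝ :=
  ∑ s ∈ Finset.Icc 1 n, ε s • (x s : Fin d → ℝ)

/-- The noiseless quadratic loss of `ϑ` on the arm `a`. -/
def armLoss (ϑ : Fin d → ℝ) (a : M.X) : ℝ := (1 / 2) * ((a : Fin d → ℝ) ⬝ᵥ (ϑ - M.θs)) ^ 2

/-- The loss of `ϑ` at an observation of the arm `a` with noise `e`, up to a constant. -/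
def noisyLoss (a : M.X) (e : ℝ) (ϑ : Fin d → ℝ) : ℝ :=
  M.armLoss ϑ a - e * ((a : Fin d → ℝ) ⬝ᵥ (ϑ - M.θs))

/-- The cumulative noiseless loss. -/
def cumLoss (x : ℕ → M.X) (n : ℕ) (ϑ : Fin d → ℝ) : ℝ := ∑ s ∈ Finset.Icc 1 n, M.armLoss ϑ (x s)

/-- The regularised cumulative loss, up to a constant `½ ‖ϑ - θ̂_{n+1}‖²_{V_n}`. -/
def energy (x : ℕ → M.X) (ε : ℕ → ℝ) (n : ℕ) (ϑ : Fin d → ℝ) : ℝ :=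
  M.cumLoss x n ϑ + (1 / 2) * ((ϑ - M.θs) ⬝ᵥ (ϑ - M.θs)) - (ϑ - M.θs) ⬝ᵥ (M.noise x ε n - M.θs)

variable {M}

lemma dotProduct_noise (x : ℕ → M.X) (ε : ℕ → ℝ) (n : ℕ) (v : Fin d → ℝ) :
    v ⬝ᵥ M.noise x ε n = ∑ a : M.X, M.armNoise x ε n a * ((a : Fin d → ℝ) ⬝ᵥ v) := by
  simp only [noise, armNoise, dotProduct_sum, Finset.sum_mul]
  rw [Finset.sum_comm]
  refine Finset.sum_congr rfl fun s _ => ?_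
  simp [ite_mul, dotProduct_comm v]

lemma sum_armCount_mul (x : ℕ → M.X) (n : ℕ) (φ : M.X → ℝ) :
    ∑ a : M.X, M.armCount x n a * φ a = ∑ s ∈ Finset.Icc 1 n, φ (x s) := by
  simp only [armCount, Finset.sum_mul]
  rw [Finset.sum_comm]
  refine Finset.sum_congr rfl fun s _ => ?_
  simp [ite_mul]

lemma sum_armCount (x : ℕ → M.X) (n : ℕ) : ∑ a : M.X, M.armCount x n a = n := by
  simpa using M.sum_armCount_mul x n (fun _ => 1)

lemma armCount_nonneg (x : ℕ → M.X) (n : ℕ) (a : M.X) : 0 ≤ M.armCount x n a :=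
  Finset.sum_nonneg fun s _ => by split_ifs <;> norm_num

lemma armLoss_nonneg (ϑ : Fin d → ℝ) (a : M.X) : 0 ≤ M.armLoss ϑ a := by
  unfold armLoss; positivity

/-- Losses add up over time, so the Gibbs weights `exp (-η * energy)` evolve by multiplicative
updates with loss `noisyLoss`. -/
lemma energy_succ (x : ℕ → M.X) (ε : ℕ → ℝ) (n : ℕ) (ϑ : Fin d → ℝ) :
    M.energy x ε (n + 1) ϑ = M.energy x ε n ϑ + M.noisyLoss (x (n + 1)) (ε (n + 1)) ϑ := by
  simp only [energy, cumLoss, noise, noisyLoss]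
  rw [Finset.sum_Icc_succ_top (by omega), Finset.sum_Icc_succ_top (by omega)]
  simp only [dotProduct_sub, dotProduct_add, dotProduct_smul, smul_eq_mul]
  rw [dotProduct_comm (x (n + 1) : Fin d → ℝ) ϑ, dotProduct_comm (x (n + 1) : Fin d → ℝ) M.θs]
  simp only [sub_dotProduct]
  ring

lemma gram_mulVec (x : ℕ → M.X) (n : ℕ) (v : Fin d → ℝ) :
    M.gram x n *ᵥ v = v + ∑ s ∈ Finset.Icc 1 n, ((x s : Fin d → ℝ) ⬝ᵥ v) • (x s : Fin d → ℝ) := by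
  simp only [gram, add_mulVec, one_mulVec, sum_mulVec, vecMulVec_mulVec, op_smul_eq_smul]

lemma dotProduct_gram_mulVec (x : ℕ → M.X) (n : ℕ) (u v : Fin d → ℝ) :
    u ⬝ᵥ (M.gram x n *ᵥ v) = u ⬝ᵥ v
      + ∑ s ∈ Finset.Icc 1 n, ((x s : Fin d → ℝ) ⬝ᵥ u) * ((x s : Fin d → ℝ) ⬝ᵥ v) := by
  rw [gram_mulVec, dotProduct_add, dotProduct_sum]
  congr 1
  refine Finset.sum_congr rfl fun s _ => ?_
  rw [dotProduct_smul, smul_eq_mul, dotProduct_comm u, mul_comm]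

lemma sqNorm_gram (x : ℕ → M.X) (n : ℕ) (v : Fin d → ℝ) :
    sqNorm (M.gram x n) v = v ⬝ᵥ v + ∑ s ∈ Finset.Icc 1 n, ((x s : Fin d → ℝ) ⬝ᵥ v) ^ 2 := by
  simp only [sqNorm, dotProduct_gram_mulVec, sq]

lemma isUnit_det_gram (x : ℕ → M.X) (n : ℕ) : IsUnit (M.gram x n).det := by
  rw [isUnit_iff_ne_zero]
  intro h
  obtain ⟨v, hv, h0⟩ := Matrix.exists_mulVec_eq_zero_iff.2 h
  have h1 : sqNorm (M.gram x n) v = 0 := by simp [sqNorm, h0]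
  rw [sqNorm_gram] at h1
  have h2 : 0 < v ⬝ᵥ v := by
    have := dotProduct_self_star_pos_iff.2 hv
    simpa using this
  have h3 : 0 ≤ ∑ s ∈ Finset.Icc 1 n, ((x s : Fin d → ℝ) ⬝ᵥ v) ^ 2 :=
    Finset.sum_nonneg fun _ _ => sq_nonneg _
  linarith

/-- The normal equations recentred at `θs`; the ridge term contributes the bias `-θs`. At `n = 0`
the estimate is the arbitrary `θ₁`, which is why `n ≠ 0` is required. -/
lemma gram_mulVec_est_sub (θ₁ : Fin d → ℝ) (x : ℕ → M.X) (ε : ℕ → ℝ) {n : ℕ} (hn : n ≠ 0) :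
    M.gram x n *ᵥ (M.est θ₁ x ε n - M.θs) = M.noise x ε n - M.θs := by
  rw [est, if_neg hn, mulVec_sub, mulVec_mulVec, Matrix.mul_nonsing_inv _ (isUnit_det_gram x n),
    one_mulVec, gram_mulVec]
  simp only [reward, add_smul, Finset.sum_add_distrib, noise]
  abel

/-- Completing the square at `θs`. The last term does not depend on `ϑ`, so normalisation removes it
and Gaussian weights can be written with `energy`. -/
lemma half_sqNorm_gram_sub_est (θ₁ : Fin d → ℝ) (x : ℕ → M.X) (ε : ℕ → ℝ) {n : ℕ} (hn : n ≠ 0)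
    (ϑ : Fin d → ℝ) :
    (1 / 2) * sqNorm (M.gram x n) (ϑ - M.est θ₁ x ε n) = M.energy x ε n ϑ
      + (1 / 2) * sqNorm (M.gram x n) (M.est θ₁ x ε n - M.θs) := by
  have h1 := gram_mulVec_est_sub θ₁ x ε hn
  set v := M.est θ₁ x ε n - M.θs with hv
  set δ := ϑ - M.θs with hδ
  have h2 : ϑ - M.est θ₁ x ε n = δ - v := by simp [hv, hδ]
  have h3 : δ ⬝ᵥ (M.noise x ε n - M.θs) = δ ⬝ᵥ (M.gram x n *ᵥ v) := by rw [h1]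
  rw [h2, energy, ← hδ, h3, sqNorm_gram, sqNorm_gram, dotProduct_gram_mulVec]
  simp only [cumLoss, armLoss, ← hδ, dotProduct_sub, sub_dotProduct, sub_sq, Finset.sum_add_distrib,
    Finset.sum_sub_distrib, ← Finset.mul_sum, mul_assoc]
  rw [dotProduct_comm v δ]
  ring

lemma sqNorm_design (w : M.X → ℝ) (v : Fin d → ℝ) :
    sqNorm (M.design w) v = ∑ a : M.X, w a * ((a : Fin d → ℝ) ⬝ᵥ v) ^ 2 := by
  simp only [sqNorm, design, sum_mulVec, smul_mulVec, vecMulVec_mulVec, op_smul_eq_smul,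
    dotProduct_sum, dotProduct_smul, smul_eq_mul]
  refine Finset.sum_congr rfl fun a _ => ?_
  rw [dotProduct_comm v]; ring

lemma half_sqNorm_design (w : M.X → ℝ) (ϑ : Fin d → ℝ) :
    (1 / 2) * sqNorm (M.design w) (ϑ - M.θs) = ∑ a : M.X, w a * M.armLoss ϑ a := by
  rw [sqNorm_design, Finset.mul_sum]
  refine Finset.sum_congr rfl fun a _ => ?_
  unfold armLoss; ring

/-! ### Exponential weights over the arms -/

section Hedge

variable {η : ℝ} {g : ℕ → M.X → ℝ}

lemma hedge_pos [Nonempty M.X] (n : ℕ) (a : M.X) : 0 < M.hedge η g n a := by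
  induction n generalizing a with
  | zero =>
    have : 0 < M.X.card := Finset.card_pos.2 ⟨a, a.2⟩
    simp only [hedge]; positivity
  | succ n ih =>
    simp only [hedge]
    exact div_pos (mul_pos (ih a) (Real.exp_pos _))
      (Finset.sum_pos (fun b _ => mul_pos (ih b) (Real.exp_pos _)) ⟨a, Finset.mem_univ _⟩)

lemma sum_hedge [Nonempty M.X] (n : ℕ) : ∑ a : M.X, M.hedge η g n a = 1 := by
  cases n with
  | zero =>
    have : (M.X.card : ℝ) ≠ 0 := by
      obtain ⟨a⟩ := ‹Nonempty M.X›
      have : 0 < M.X.card := Finset.card_pos.2 ⟨a, a.2⟩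
      positivity
    simp [hedge, this]
  | succ n =>
    simp only [hedge]
    rw [← Finset.sum_div]
    refine div_self (ne_of_gt (Finset.sum_pos (fun b _ => mul_pos (hedge_pos n b) (Real.exp_pos _))
      Finset.univ_nonempty))

lemma hedge_le_one [Nonempty M.X] (n : ℕ) (a : M.X) : M.hedge η g n a ≤ 1 := by
  rw [← M.sum_hedge (η := η) (g := g) n]
  exact Finset.single_le_sum (fun b _ => (hedge_pos n b).le) (Finset.mem_univ a)

/-- The log weight of arm `a` starts at `-log card`, in each round gains `η * g` and loses the
log-normaliser, and ends at most `0`. The normaliser is controlled by `exp u ≤ 1 + u + u ^ 2` on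
`[0, 1]` and by `1 + u ≤ exp u`. Not dividing by `η` keeps the bound meaningful for `η = 0`. -/
lemma hedge_regret [Nonempty M.X] (hη : 0 ≤ η) {G : ℝ} (T : ℕ)
    (hg0 : ∀ t ∈ Finset.Icc 1 T, ∀ a, 0 ≤ g t a) (hg : ∀ t ∈ Finset.Icc 1 T, ∀ a, g t a ≤ G)
    (hηG : η * G ≤ 1) (a : M.X) :
    η * ∑ t ∈ Finset.Icc 1 T, g t a ≤
      η * ∑ t ∈ Finset.Icc 1 T, ∑ b : M.X, M.hedge η g (t - 1) b * g t b
        + T * (η * G) ^ 2 + Real.log M.X.card := by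
  have key : ∀ n ≤ T, Real.log M.X.card⁻¹ + η * ∑ t ∈ Finset.Icc 1 n, g t a ≤
      Real.log (M.hedge η g n a) +
      (η * ∑ t ∈ Finset.Icc 1 n, ∑ b : M.X, M.hedge η g (t - 1) b * g t b + n * (η * G) ^ 2) := by
    intro n
    induction n with
    | zero => simp [hedge]
    | succ n ih =>
      intro hn
      have ih' := ih (by omega)
      have hmem : n + 1 ∈ Finset.Icc 1 T := Finset.mem_Icc.2 ⟨by omega, hn⟩
      have hS : ∑ b : M.X, M.hedge η g n b * Real.exp (η * g (n + 1) b) ≤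
          Real.exp (η * ∑ b : M.X, M.hedge η g n b * g (n + 1) b + (η * G) ^ 2) := by
        have : ∀ b : M.X, Real.exp (η * g (n + 1) b) ≤ 1 + η * g (n + 1) b + (η * G) ^ 2 := by
          intro b
          have h0 : 0 ≤ η * g (n + 1) b := mul_nonneg hη (hg0 _ hmem b)
          have h1 : η * g (n + 1) b ≤ η * G := mul_le_mul_of_nonneg_left (hg _ hmem b) hη
          have := Real.abs_exp_sub_one_sub_id_le (x := η * g (n + 1) b)
            (by rw [abs_of_nonneg h0]; linarith)
          have h2 : (η * g (n + 1) b) ^ 2 ≤ (η * G) ^ 2 := by gcongr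
          have := (abs_le.1 this).2
          linarith
        calc _ ≤ ∑ b : M.X, M.hedge η g n b * (1 + η * g (n + 1) b + (η * G) ^ 2) :=
              Finset.sum_le_sum fun b _ =>
                mul_le_mul_of_nonneg_left (this b) (hedge_pos n b).le
          _ = 1 + (η * ∑ b : M.X, M.hedge η g n b * g (n + 1) b + (η * G) ^ 2) := by
              simp only [mul_add, Finset.sum_add_distrib, mul_one, sum_hedge, ← Finset.sum_mul,
                one_mul, Finset.mul_sum]
              rw [add_assoc]
              congr 2
              exact Finset.sum_congr rfl fun b _ => by ring
          _ ≤ _ := by rw [add_comm]; exact Real.add_one_le_exp _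
      have hSpos : 0 < ∑ b : M.X, M.hedge η g n b * Real.exp (η * g (n + 1) b) :=
        Finset.sum_pos (fun b _ => mul_pos (hedge_pos n b) (Real.exp_pos _)) Finset.univ_nonempty
      have hlog := (Real.log_le_iff_le_exp hSpos).2 hS
      have hl : Real.log (M.hedge η g (n + 1) a) = Real.log (M.hedge η g n a) + η * g (n + 1) a
          - Real.log (∑ b : M.X, M.hedge η g n b * Real.exp (η * g (n + 1) b)) := by
        simp only [hedge]
        rw [Real.log_div (mul_pos (hedge_pos n a) (Real.exp_pos _)).ne' hSpos.ne',
          Real.log_mul (hedge_pos n a).ne' (Real.exp_pos _).ne', Real.log_exp]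
      rw [Finset.sum_Icc_succ_top (by omega), Finset.sum_Icc_succ_top (by omega), hl]
      simp only [Nat.add_sub_cancel]
      push_cast
      linarith
  have h := key T le_rfl
  have h1 : Real.log (M.hedge η g T a) ≤ 0 :=
    Real.log_nonpos (hedge_pos T a).le (hedge_le_one T a)
  rw [Real.log_inv] at h
  linarith

end Hedge

end Bandit

/-! ### Gibbs measures: Laplace bounds and continuous exponential weights. -/

variable {d : ℕ}

/-- The probability measure with density proportional to `exp (-G)` on `S`. -/
def gibbs (S : Set (Fin d → ℝ)) (G : (Fin d → ℝ) → ℝ) : Measure (Fin d → ℝ) :=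
  let ν := (volume.restrict S).withDensity fun θ => ENNReal.ofReal (Real.exp (-G θ))
  (ν Set.univ)⁻¹ • ν

section Gibbs

variable {S : Set (Fin d → ℝ)} {G : (Fin d → ℝ) → ℝ}

lemma integrableOn_of_continuous (hS : Bornology.IsBounded S) {φ : (Fin d → ℝ) → ℝ}
    (hφ : Continuous φ) : IntegrableOn φ S volume :=
  (hφ.continuousOn.integrableOn_compact hS.isCompact_closure).mono_set subset_closure

lemma setIntegral_exp_pos (hS : Bornology.IsBounded S) (hvol : volume S ≠ 0) (hG : Continuous G) :
    0 < ∫ θ in S, Real.exp (-G θ) := by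
  have : NeZero (volume.restrict S) := ⟨by rwa [Ne, Measure.restrict_eq_zero]⟩
  exact integral_exp_pos (integrableOn_of_continuous hS (by fun_prop))

lemma gibbs_eq (hS : Bornology.IsBounded S) (hG : Continuous G) :
    gibbs S G = (ENNReal.ofReal (∫ θ in S, Real.exp (-G θ)))⁻¹ •
      (volume.restrict S).withDensity fun θ => ENNReal.ofReal (Real.exp (-G θ)) := by
  have hi : IntegrableOn (fun θ => Real.exp (-G θ)) S volume :=
    integrableOn_of_continuous hS (by fun_prop)
  simp only [gibbs]
  rw [withDensity_apply _ MeasurableSet.univ, Measure.restrict_univ,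
    ofReal_integral_eq_lintegral_ofReal hi (ae_of_all _ fun θ => (Real.exp_pos _).le)]

lemma integral_gibbs (hS : Bornology.IsBounded S) (hG : Continuous G) (φ : (Fin d → ℝ) → ℝ) :
    ∫ θ, φ θ ∂(gibbs S G) = (∫ θ in S, φ θ * Real.exp (-G θ)) / ∫ θ in S, Real.exp (-G θ) := by
  rw [gibbs_eq hS hG, integral_smul_measure,
    integral_withDensity_eq_integral_toReal_smul (by fun_prop) (by simp)]
  have h0 : 0 ≤ ∫ θ in S, Real.exp (-G θ) := integral_nonneg fun θ => (Real.exp_pos _).le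
  rw [ENNReal.toReal_inv, ENNReal.toReal_ofReal h0, smul_eq_mul, div_eq_inv_mul]
  congr 1
  refine integral_congr_ae (ae_of_all _ fun θ => ?_)
  simp only [smul_eq_mul, ENNReal.toReal_ofReal (Real.exp_pos _).le, mul_comm]

lemma isProbabilityMeasure_gibbs (hS : Bornology.IsBounded S) (hvol : volume S ≠ 0)
    (hG : Continuous G) : IsProbabilityMeasure (gibbs S G) := by
  have hi : IntegrableOn (fun θ => Real.exp (-G θ)) S volume :=
    integrableOn_of_continuous hS (by fun_prop)
  refine ⟨?_⟩
  rw [gibbs_eq hS hG, Measure.smul_apply, withDensity_apply _ MeasurableSet.univ,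
    Measure.restrict_univ,
    ← ofReal_integral_eq_lintegral_ofReal hi (ae_of_all _ fun θ => (Real.exp_pos _).le), smul_eq_mul]
  exact ENNReal.inv_mul_cancel (by simpa using setIntegral_exp_pos hS hvol hG) (by simp)

lemma gibbs_real_apply (hS : Bornology.IsBounded S) (hvol : volume S ≠ 0)
    (hG : Continuous G) {A : Set (Fin d → ℝ)} (hA : MeasurableSet A) (hAS : A ⊆ S) :
    (gibbs S G).real A = (∫ θ in A, Real.exp (-G θ)) / ∫ θ in S, Real.exp (-G θ) := by
  have := isProbabilityMeasure_gibbs hS hvol hG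
  rw [← integral_indicator_one hA, integral_gibbs hS hG]
  congr 1
  have : (fun θ => A.indicator (1 : (Fin d → ℝ) → ℝ) θ * Real.exp (-G θ))
      = A.indicator fun θ => Real.exp (-G θ) := by
    ext θ; by_cases h : θ ∈ A <;> simp [h]
  rw [this, setIntegral_indicator hA, Set.inter_eq_right.2 hAS]

lemma gibbs_absolutelyContinuous : gibbs S G ≪ volume.restrict S :=
  (Measure.AbsolutelyContinuous.rfl.smul_left _).trans (withDensity_absolutelyContinuous _ _)

lemma gibbs_add_const (hG : Continuous G) (c : ℝ) :
    gibbs S (fun θ => G θ + c) = gibbs S G := by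
  have hc : (fun θ => ENNReal.ofReal (Real.exp (-(G θ + c)))) =
      ENNReal.ofReal (Real.exp (-c)) • fun θ => ENNReal.ofReal (Real.exp (-G θ)) := by
    ext θ
    rw [Pi.smul_apply, smul_eq_mul, ← ENNReal.ofReal_mul (Real.exp_pos _).le, ← Real.exp_add]
    ring_nf
  have hm : Measurable fun θ => ENNReal.ofReal (Real.exp (-G θ)) := by fun_prop
  simp only [gibbs]
  rw [hc, withDensity_smul _ hm, Measure.smul_apply, smul_smul, smul_eq_mul]
  congr 1
  have h0 : ENNReal.ofReal (Real.exp (-c)) ≠ 0 := by simp [Real.exp_pos]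
  rw [ENNReal.mul_inv (Or.inl h0) (Or.inl ENNReal.ofReal_ne_top), mul_comm, ← mul_assoc,
    ENNReal.mul_inv_cancel h0 ENNReal.ofReal_ne_top, one_mul]

lemma truncNormal_eq_gibbs (m : Fin d → ℝ) (Q : Matrix (Fin d) (Fin d) ℝ) :
    truncNormal m Q S = gibbs S fun θ => (1 / 2) * sqNorm Q (θ - m) := by
  simp only [truncNormal, gibbs, neg_mul]

lemma continuous_sqNorm_sub (m : Fin d → ℝ) (Q : Matrix (Fin d) (Fin d) ℝ) :
    Continuous fun θ => sqNorm Q (θ - m) := by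
  simp only [sqNorm, mulVec, dotProduct]; fun_prop

lemma sqNorm_smul (c : ℝ) (Q : Matrix (Fin d) (Fin d) ℝ) (v : Fin d → ℝ) :
    sqNorm (c • Q) v = c * sqNorm Q v := by
  simp [sqNorm, smul_mulVec]

lemma log_setIntegral_exp_le (hS : Bornology.IsBounded S) (hSm : MeasurableSet S)
    (hvol : volume S ≠ 0) (hG : Continuous G) {b : ℝ} (hb : ∀ θ ∈ S, b ≤ G θ) :
    Real.log (∫ θ in S, Real.exp (-G θ)) ≤ Real.log (volume.real S) - b := by
  have hfin : volume S ≠ ⊤ := hS.measure_lt_top.ne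
  have hpos : 0 < volume.real S := ENNReal.toReal_pos hvol hfin
  have h : ∫ θ in S, Real.exp (-G θ) ≤ volume.real S * Real.exp (-b) := by
    have := setIntegral_mono_on (integrableOn_of_continuous hS (φ := fun θ => Real.exp (-G θ))
      (by fun_prop)) (integrableOn_const (C := Real.exp (-b)) hfin) hSm
      (fun θ hθ => Real.exp_le_exp.2 (neg_le_neg (hb θ hθ)))
    simpa using this
  have := Real.log_le_log (setIntegral_exp_pos hS hvol hG) h
  rwa [Real.log_mul hpos.ne' (Real.exp_pos _).ne', Real.log_exp, ← sub_eq_add_neg] at this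

/-- The lower half of Laplace's method, matching `log_setIntegral_exp_le`: only the part of `S` in a
ball around a near-minimiser is kept, at the price of `log v`. -/
lemma le_log_setIntegral_exp (hS : Bornology.IsBounded S) (hSm : MeasurableSet S)
    (hG : Continuous G) {θ₀ : Fin d → ℝ} {r v b : ℝ} (hv : 0 < v)
    (hvS : v ≤ volume.real (S ∩ Metric.ball θ₀ r)) (hb : ∀ θ ∈ S ∩ Metric.ball θ₀ r, G θ ≤ b) :
    Real.log v - b ≤ Real.log (∫ θ in S, Real.exp (-G θ)) := by
  set A := S ∩ Metric.ball θ₀ r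
  have hAb : Bornology.IsBounded A := hS.subset Set.inter_subset_left
  have hAm : MeasurableSet A := hSm.inter Metric.isOpen_ball.measurableSet
  have hfin : volume A ≠ ⊤ := hAb.measure_lt_top.ne
  have hi := integrableOn_of_continuous hS (φ := fun θ => Real.exp (-G θ)) (by fun_prop)
  have h1 : volume.real A * Real.exp (-b) ≤ ∫ θ in A, Real.exp (-G θ) := by
    have := setIntegral_mono_on (integrableOn_const (C := Real.exp (-b)) hfin)
      (hi.mono_set Set.inter_subset_left) hAm
      (fun θ hθ => Real.exp_le_exp.2 (neg_le_neg (hb θ hθ)))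
    simpa using this
  have h2 : ∫ θ in A, Real.exp (-G θ) ≤ ∫ θ in S, Real.exp (-G θ) :=
    setIntegral_mono_set hi (ae_of_all _ fun θ => (Real.exp_pos _).le)
      (Set.inter_subset_left.eventuallyLE)
  have h3 : v * Real.exp (-b) ≤ ∫ θ in S, Real.exp (-G θ) :=
    (mul_le_mul_of_nonneg_right hvS (Real.exp_pos _).le).trans (h1.trans h2)
  have := Real.log_le_log (by positivity) h3
  rwa [Real.log_mul hv.ne' (Real.exp_pos _).ne', Real.log_exp, ← sub_eq_add_neg] at this

/-- One step of exponential weights on a continuous domain. -/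
lemma log_setIntegral_exp_add_le (hS : Bornology.IsBounded S) (hSm : MeasurableSet S)
    (hvol : volume S ≠ 0) (hG : Continuous G) {h : (Fin d → ℝ) → ℝ} (hh : Continuous h) {b : ℝ}
    (hb : ∀ θ ∈ S, |h θ| ≤ b) (hb1 : b ≤ 1) :
    Real.log (∫ θ in S, Real.exp (-(G θ + h θ))) ≤
      Real.log (∫ θ in S, Real.exp (-G θ)) - ∫ θ, h θ ∂(gibbs S G) + b ^ 2 := by
  have hZ := setIntegral_exp_pos hS hvol hG
  have hb0 : 0 ≤ b := by
    obtain ⟨θ, hθ⟩ := nonempty_of_measure_ne_zero hvol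
    exact (abs_nonneg _).trans (hb θ hθ)
  have hi := integrableOn_of_continuous hS (φ := fun θ => Real.exp (-G θ)) (by fun_prop)
  have hi2 := integrableOn_of_continuous hS (φ := fun θ => h θ * Real.exp (-G θ)) (by fun_prop)
  have hle : ∫ θ in S, Real.exp (-(G θ + h θ)) ≤
      ∫ θ in S, ((1 + b ^ 2) * Real.exp (-G θ) - h θ * Real.exp (-G θ)) := by
    refine setIntegral_mono_on (integrableOn_of_continuous hS (by fun_prop))
      (integrableOn_of_continuous hS (by fun_prop)) hSm fun θ hθ => ?_
    -- Since `|h| ≤ 1` on `S`, `exp (-h) ≤ 1 - h + h ^ 2`; after integration the linear term becomes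
    -- the Gibbs mean of `h`.
    have h1 := Real.abs_exp_sub_one_sub_id_le (x := -h θ) (by rw [abs_neg]; linarith [hb θ hθ])
    have h2 : (-h θ) ^ 2 ≤ b ^ 2 := by
      rw [neg_sq, ← sq_abs]; gcongr; exact hb θ hθ
    have h3 := (abs_le.1 h1).2
    rw [neg_add, Real.exp_add, ← sub_mul, mul_comm]
    exact mul_le_mul_of_nonneg_right (by linarith) (Real.exp_pos _).le
  rw [integral_sub (hi.const_mul _) hi2, integral_const_mul] at hle
  have hE := integral_gibbs hS hG h
  set Z := ∫ θ in S, Real.exp (-G θ)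
  have h4 : ∫ θ in S, Real.exp (-(G θ + h θ)) ≤
      Z * Real.exp (-(∫ θ, h θ ∂(gibbs S G)) + b ^ 2) := by
    refine hle.trans ?_
    have := Real.add_one_le_exp (-(∫ θ, h θ ∂(gibbs S G)) + b ^ 2)
    calc _ = Z * (-(∫ θ, h θ ∂(gibbs S G)) + b ^ 2 + 1) := by
          rw [hE]; field_simp; ring
      _ ≤ _ := mul_le_mul_of_nonneg_left this hZ.le
  have h5 := Real.log_le_log (setIntegral_exp_pos hS hvol (hG.add hh)) h4
  rw [Real.log_mul hZ.ne' (Real.exp_pos _).ne', Real.log_exp] at h5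
  simp only [Pi.add_apply] at h5
  linarith

/-- Laplace's method is applied at points that depend on the epoch and the sample path, so the
volume bound must be uniform over `K`. Near `k`, the ball of radius `r / 2` around `k` contains a
piece of `interior S` and lies in the `r`-ball of each of its own points; compactness does the rest.
-/
lemma exists_le_volume_inter_ball (hS : Bornology.IsBounded S) {K : Set (Fin d → ℝ)}
    (hK : IsCompact K) (hKS : K ⊆ closure (interior S)) {r : ℝ} (hr : 0 < r) :
    ∃ v : ℝ, 0 < v ∧ ∀ θ₀ ∈ K, v ≤ volume.real (S ∩ Metric.ball θ₀ r) := by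
  have hfin : ∀ B : Set (Fin d → ℝ), volume (S ∩ B) ≠ ⊤ := fun B =>
    (hS.subset Set.inter_subset_left).measure_lt_top.ne
  refine hK.induction_on (p := fun K => ∃ v : ℝ, 0 < v ∧ ∀ θ₀ ∈ K,
    v ≤ volume.real (S ∩ Metric.ball θ₀ r)) ⟨1, one_pos, by simp⟩ ?_ ?_ ?_
  · rintro s t hst ⟨v, hv, h⟩
    exact ⟨v, hv, fun θ hθ => h θ (hst hθ)⟩
  · rintro s t ⟨v, hv, h⟩ ⟨v', hv', h'⟩
    refine ⟨min v v', lt_min hv hv', ?_⟩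
    rintro θ (hθ | hθ)
    · exact (min_le_left _ _).trans (h θ hθ)
    · exact (min_le_right _ _).trans (h' θ hθ)
  · intro k hk
    refine ⟨Metric.ball k (r / 2), mem_nhdsWithin_of_mem_nhds (Metric.ball_mem_nhds k (by positivity)),
      volume.real (interior S ∩ Metric.ball k (r / 2)), ?_, fun θ hθ => ?_⟩
    · have hne : (interior S ∩ Metric.ball k (r / 2)).Nonempty := by
        rw [Set.inter_comm]
        exact mem_closure_iff.1 (hKS hk) _ Metric.isOpen_ball (Metric.mem_ball_self (by positivity))
      refine ENNReal.toReal_pos ((isOpen_interior.inter Metric.isOpen_ball).measure_pos _ hne).ne' ?_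
      exact ne_top_of_le_ne_top (hfin (Metric.ball k (r / 2)))
        (measure_mono (Set.inter_subset_inter_left _ interior_subset))
    · refine measureReal_mono (Set.inter_subset_inter interior_subset fun y hy => ?_) (hfin _)
      have h1 := Metric.mem_ball.1 hθ
      have h2 := Metric.mem_ball.1 hy
      have := dist_triangle_right y θ k
      exact Metric.mem_ball.2 (by linarith)

end Gibbs

/-! ### Alternative sets, and the laws of the algorithm as Gibbs measures. -/

namespace Bandit

variable {M : Bandit d}

lemma continuous_dotProduct_left (a : Fin d → ℝ) : Continuous fun θ : Fin d → ℝ => a ⬝ᵥ θ := by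
  simp only [dotProduct]; fun_prop

lemma isClosed_alt (hclosed : IsClosed M.Θ) (z : Fin d → ℝ) : IsClosed (M.alt z) := by
  have : M.alt z = M.Θ ∩ ⋃ z' ∈ {z' | z' ∈ M.Z ∧ z' ≠ z}, {θ | z ⬝ᵥ θ ≤ z' ⬝ᵥ θ} := by
    ext θ; simp [alt, and_assoc]
  rw [this]
  refine hclosed.inter ((Set.Finite.subset M.Z.finite_toSet fun z' hz' => hz'.1).isClosed_biUnion ?_)
  intro z' _
  exact isClosed_le (continuous_dotProduct_left z) (continuous_dotProduct_left z')

lemma alt_subset (z : Fin d → ℝ) : M.alt z ⊆ M.Θ := fun _ h => h.1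

/-- The truncated normal must be a probability measure whatever the current answer. For `z = zs`
this is the regularity of the alternative; for any other `z`, the answer `zs` beats `z` near `θs`,
so `M.alt z` contains an open piece of `Θ` there. -/
lemma volume_alt_ne_zero (hzs : M.zs ∈ M.Z)
    (hunique : ∀ z ∈ M.Z, z ≠ M.zs → z ⬝ᵥ M.θs < M.zs ⬝ᵥ M.θs)
    (hθs_reg : M.θs ∈ closure (interior M.Θ)) (halt : (M.alt M.zs).Nonempty)
    (halt_reg : M.alt M.zs ⊆ closure (interior (M.alt M.zs))) {z : Fin d → ℝ} (hz : z ∈ M.Z) :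
    volume (M.alt z) ≠ 0 := by
  by_cases h : z = M.zs
  · subst h
    obtain ⟨θ, hθ⟩ := halt
    have hne : (interior (M.alt M.zs)).Nonempty := closure_nonempty_iff.1 ⟨θ, halt_reg hθ⟩
    exact (isOpen_interior.measure_pos _ hne |>.trans_le (measure_mono interior_subset)).ne'
  · have hU : IsOpen {θ : Fin d → ℝ | z ⬝ᵥ θ < M.zs ⬝ᵥ θ} :=
      isOpen_lt (continuous_dotProduct_left z) (continuous_dotProduct_left M.zs)
    have hne := mem_closure_iff.1 hθs_reg _ hU (hunique z hz h)
    refine ((hU.inter isOpen_interior).measure_pos _ hne |>.trans_le (measure_mono ?_)).ne'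
    rintro θ ⟨h1, h2⟩
    exact ⟨interior_subset h2, M.zs, hzs, fun h' => h h'.symm, le_of_lt h1⟩

lemma continuous_armLoss (a : M.X) : Continuous fun θ => M.armLoss θ a := by
  simp only [armLoss, dotProduct]; fun_prop

lemma continuous_noisyLoss (a : M.X) (e : ℝ) : Continuous (M.noisyLoss a e) := by
  unfold noisyLoss
  refine (continuous_armLoss a).sub ?_
  simp only [dotProduct]; fun_prop

lemma continuous_energy (x : ℕ → M.X) (ε : ℕ → ℝ) (n : ℕ) : Continuous (M.energy x ε n) := by
  unfold energy cumLoss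
  refine ((continuous_finsetSum _ fun s _ => continuous_armLoss _).add ?_).sub ?_ <;>
  · simp only [dotProduct]; fun_prop

lemma posterior_eq_gibbs (θ₁ : Fin d → ℝ) (x : ℕ → M.X)
    (ε : ℕ → ℝ) {n : ℕ} (hn : n ≠ 0) : M.posterior θ₁ x ε n = gibbs M.Θ (M.energy x ε n) := by
  rw [posterior, truncNormal_eq_gibbs]
  simp only [half_sqNorm_gram_sub_est θ₁ x ε hn]
  exact gibbs_add_const (continuous_energy x ε n) _

lemma paramLaw_eq_gibbs (η : ℝ) (f : (Fin d → ℝ) → Fin d → ℝ)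
    (θ₁ : Fin d → ℝ) (x : ℕ → M.X) (ε : ℕ → ℝ) {t : ℕ} (ht : t - 1 ≠ 0) :
    M.paramLaw η f θ₁ x ε t = gibbs (M.alt (f (M.est θ₁ x ε (t - 1))))
      (fun θ => η * M.energy x ε (t - 1) θ) := by
  rw [paramLaw, truncNormal_eq_gibbs]
  have h : ∀ ϑ, (1 / 2) * sqNorm (η • M.gram x (t - 1)) (ϑ - M.est θ₁ x ε (t - 1)) =
      η * M.energy x ε (t - 1) ϑ
      + η * ((1 / 2) * sqNorm (M.gram x (t - 1)) (M.est θ₁ x ε (t - 1) - M.θs)) := by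
    intro ϑ
    rw [sqNorm_smul, ← mul_add, ← half_sqNorm_gram_sub_est θ₁ x ε ht]
    ring
  simp only [h]
  exact gibbs_add_const (by have := continuous_energy x ε (t-1); fun_prop) _

lemma isProbabilityMeasure_paramLaw (hbdd : Bornology.IsBounded M.Θ) (η : ℝ)
    {f : (Fin d → ℝ) → Fin d → ℝ} (hf : M.IsArgmaxOracle f)
    (hvol : ∀ z ∈ M.Z, volume (M.alt z) ≠ 0) (θ₁ : Fin d → ℝ) (x : ℕ → M.X) (ε : ℕ → ℝ) (t : ℕ) :
    IsProbabilityMeasure (M.paramLaw η f θ₁ x ε t) := by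
  rw [paramLaw, truncNormal_eq_gibbs]
  exact isProbabilityMeasure_gibbs (hbdd.subset (alt_subset _)) (hvol _ (hf.2 _).1)
    (continuous_const.mul (continuous_sqNorm_sub _ _))

lemma paramLaw_alt_compl (hclosed : IsClosed M.Θ) (η : ℝ) (f : (Fin d → ℝ) → Fin d → ℝ)
    (θ₁ : Fin d → ℝ) (x : ℕ → M.X) (ε : ℕ → ℝ) (t : ℕ) :
    M.paramLaw η f θ₁ x ε t (M.alt (f (M.est θ₁ x ε (t - 1))))ᶜ = 0 := by
  rw [paramLaw, truncNormal_eq_gibbs]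
  refine gibbs_absolutelyContinuous ?_
  rw [Measure.restrict_apply (isClosed_alt hclosed _).measurableSet.compl]
  simp

/-- A distribution absolutely continuous on `Θ` does not charge ties, so both notions of a wrong
answer have the same probability. -/
lemma posterior_argmax_ne (hclosed : IsClosed M.Θ) {f : (Fin d → ℝ) → Fin d → ℝ}
    (hf : M.IsArgmaxOracle f) (hzs : M.zs ∈ M.Z) (θ₁ : Fin d → ℝ) (x : ℕ → M.X) (ε : ℕ → ℝ) (n : ℕ) :
    (M.posterior θ₁ x ε n).real {ϑ | f ϑ ≠ M.zs} = (M.posterior θ₁ x ε n).real (M.alt M.zs) := by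
  rw [posterior, truncNormal_eq_gibbs]
  refine measureReal_congr (gibbs_absolutelyContinuous.ae_eq ?_)
  -- Ties with `zs` lie in finitely many hyperplanes orthogonal to `z - zs ≠ 0`, which are Lebesgue
  -- null.
  have hties : ∀ᵐ ϑ : Fin d → ℝ, ∀ z ∈ M.Z, z ≠ M.zs → z ⬝ᵥ ϑ ≠ M.zs ⬝ᵥ ϑ := by
    refine (ae_ball_iff (S := (M.Z : Set (Fin d → ℝ))) M.Z.countable_toSet).2 fun z _ => ?_
    by_cases hne : z = M.zs
    · simp [hne]
    · let φ : (Fin d → ℝ) →ₗ[ℝ] ℝ :=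
        { toFun := fun ϑ => (z - M.zs) ⬝ᵥ ϑ
          map_add' := by intro u v; exact dotProduct_add _ _ _
          map_smul' := by intro c v; exact dotProduct_smul _ _ _ }
      have hker : LinearMap.ker φ ≠ ⊤ := by
        intro htop
        have : (z - M.zs) ⬝ᵥ (z - M.zs) = 0 := by
          have h : z - M.zs ∈ LinearMap.ker φ := htop ▸ Submodule.mem_top
          exact h
        exact hne (sub_eq_zero.1 (dotProduct_self_eq_zero.1 this))
      have h0 := Measure.addHaar_submodule volume _ hker
      refine (measure_eq_zero_iff_ae_notMem.1 h0).mono fun ϑ hϑ _ heq => hϑ ?_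
      change (z - M.zs) ⬝ᵥ ϑ = 0
      rw [sub_dotProduct, heq, sub_self]
  filter_upwards [ae_restrict_of_ae hties, ae_restrict_mem hclosed.measurableSet] with ϑ h1 h2
  refine propext ⟨fun h => ?_, fun h => ?_⟩
  · exact ⟨h2, f ϑ, (hf.2 ϑ).1, h, (hf.2 ϑ).2 _ hzs⟩
  · obtain ⟨-, z', hz', hne, hle⟩ := h
    intro heq
    have := (hf.2 ϑ).2 z' hz'
    rw [heq] at this
    exact h1 z' hz' hne (le_antisymm this hle)

/-! ### Measurability of the quantities of the algorithm -/

section Measurability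

variable {Ω : Type*} [MeasurableSpace Ω] {θ : ℕ → Ω → Fin d → ℝ} {x : ℕ → Ω → M.X} {ε : ℕ → Ω → ℝ}

lemma gram_congr {x y : ℕ → M.X} {n : ℕ} (h : ∀ s ∈ Finset.Icc 1 n, x s = y s) :
    M.gram x n = M.gram y n := by
  simp only [gram]
  congr 1
  exact Finset.sum_congr rfl fun s hs => by rw [h s hs]

/-- The matrix is a function of finitely many arms, each with values in a finite discrete space, so
measurability needs nothing about inversion. Outside `1, …, n` the arms are filled in by `a₀`;
without arms `Ω` is empty. -/
lemma measurable_gram_inv {n : ℕ} (hx : ∀ s ∈ Finset.Icc 1 n, Measurable (x s)) (i j : Fin d) :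
    Measurable fun ω => (M.gram (fun s => x s ω) n)⁻¹ i j := by
  rcases isEmpty_or_nonempty M.X with hX | ⟨⟨a₀⟩⟩
  · have : IsEmpty Ω := ⟨fun ω => hX.false (x 0 ω)⟩
    exact measurable_of_empty _
  · have h1 : Measurable fun ω => fun s : Finset.Icc 1 n => x s ω :=
      measurable_pi_iff.2 fun s => hx s s.2
    have h2 : Measurable fun y : Finset.Icc 1 n → M.X =>
        (M.gram (fun s => if h : s ∈ Finset.Icc 1 n then y ⟨s, h⟩ else a₀) n)⁻¹ i j :=
      Measurable.of_discrete
    have h3 : (fun ω => (M.gram (fun s => x s ω) n)⁻¹ i j) =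
        (fun y : Finset.Icc 1 n → M.X =>
          (M.gram (fun s => if h : s ∈ Finset.Icc 1 n then y ⟨s, h⟩ else a₀) n)⁻¹ i j) ∘
        fun ω => fun s : Finset.Icc 1 n => x s ω := by
      ext ω
      simp only [Function.comp_apply]
      rw [gram_congr (x := fun s => x s ω)
        (y := fun s => if h : s ∈ Finset.Icc 1 n then x s ω else a₀)]
      intro s hs
      simp only [dif_pos hs]
    rw [h3]
    exact h2.comp h1

lemma measurable_coe_apply (i : Fin d) : Measurable fun a : M.X => (a : Fin d → ℝ) i :=
  Measurable.of_discrete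

lemma measurable_est (θ₁ : Fin d → ℝ) {n : ℕ} (hx : ∀ s ∈ Finset.Icc 1 n, Measurable (x s))
    (hε : ∀ s ∈ Finset.Icc 1 n, Measurable (ε s)) :
    Measurable fun ω => M.est θ₁ (fun s => x s ω) (fun s => ε s ω) n := by
  unfold est
  split_ifs with hn
  · exact measurable_const
  · refine measurable_pi_iff.2 fun i => ?_
    simp only [mulVec, dotProduct, Finset.sum_apply, Pi.smul_apply, smul_eq_mul, reward]
    refine Finset.measurable_sum _ fun j _ => (measurable_gram_inv hx i j).mul ?_
    refine Finset.measurable_sum _ fun s hs => Measurable.mul (Measurable.add ?_ (hε s hs)) ?_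
    · exact Finset.measurable_sum _ fun k _ =>
        ((measurable_coe_apply k).comp (hx s hs)).mul measurable_const
    · exact (measurable_coe_apply j).comp (hx s hs)

lemma measurable_gain (θ₁ : Fin d → ℝ) {t : ℕ} (ht : 1 ≤ t)
    (hθ : ∀ s ∈ Finset.Icc 1 t, Measurable (θ s)) (hx : ∀ s ∈ Finset.Icc 1 t, Measurable (x s))
    (hε : ∀ s ∈ Finset.Icc 1 t, Measurable (ε s)) (a : M.X) :
    Measurable fun ω => M.gain θ₁ (fun s => θ s ω) (fun s => x s ω) (fun s => ε s ω) t a := by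
  have hsub : Finset.Icc 1 (t - 1) ⊆ Finset.Icc 1 t := Finset.Icc_subset_Icc_right (by omega)
  have he := measurable_est (x := x) (ε := ε) θ₁ (fun s hs => hx s (hsub hs))
    (fun s hs => hε s (hsub hs))
  have ht' := hθ t (Finset.mem_Icc.2 ⟨ht, le_rfl⟩)
  unfold gain
  exact (((continuous_dotProduct_left _).measurable).comp (ht'.sub he)).pow_const 2

lemma measurable_hedge (η : ℝ) {g : Ω → ℕ → M.X → ℝ} {n : ℕ}
    (hg : ∀ s ∈ Finset.Icc 1 n, ∀ a, Measurable fun ω => g ω s a) (a : M.X) :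
    Measurable fun ω => M.hedge η (g ω) n a := by
  induction n generalizing a with
  | zero => exact measurable_const
  | succ n ih =>
    have hsub : Finset.Icc 1 n ⊆ Finset.Icc 1 (n + 1) := Finset.Icc_subset_Icc_right (by omega)
    have ih' := ih fun s hs => hg s (hsub hs)
    have h1 : ∀ b, Measurable fun ω => M.hedge η (g ω) n b * Real.exp (η * g ω (n + 1) b) :=
      fun b => (ih' b).mul (Real.measurable_exp.comp
        ((hg (n + 1) (Finset.mem_Icc.2 ⟨by omega, le_rfl⟩) b).const_mul η))
    exact (h1 a).div (Finset.measurable_sum _ fun b _ => h1 b)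

lemma measurable_armLaw (η : ℝ) (lamG : M.X → ℝ) (θ₁ : Fin d → ℝ) {t : ℕ}
    (hθ : ∀ s ∈ Finset.Ico 1 t, Measurable (θ s)) (hx : ∀ s ∈ Finset.Ico 1 t, Measurable (x s))
    (hε : ∀ s ∈ Finset.Ico 1 t, Measurable (ε s)) (a : M.X) :
    Measurable fun ω =>
      M.armLaw η lamG θ₁ (fun s => θ s ω) (fun s => x s ω) (fun s => ε s ω) t a := by
  unfold armLaw
  have hIco : ∀ s ∈ Finset.Icc 1 (t - 1), ∀ r ∈ Finset.Icc 1 s, r ∈ Finset.Ico 1 t := by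
    intro s hs r hr
    simp only [Finset.mem_Icc, Finset.mem_Ico] at *
    omega
  refine ((measurable_hedge η (fun s hs b => ?_) a).const_mul _).add_const _
  exact measurable_gain θ₁ (Finset.mem_Icc.1 hs).1 (fun r hr => hθ r (hIco s hs r hr))
    (fun r hr => hx r (hIco s hs r hr)) (fun r hr => hε r (hIco s hs r hr)) b

end Measurability

/-! ### The mixture from which the arms are drawn. -/

section ArmLaw

variable {η : ℝ} {lamG : M.X → ℝ} {θ₁ : Fin d → ℝ} {θ : ℕ → Fin d → ℝ} {x : ℕ → M.X} {ε : ℕ → ℝ}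

lemma rate_nonneg (t : ℕ) : (0 : ℝ) ≤ (t : ℝ) ^ (-(1 / 4) : ℝ) := by positivity

lemma rate_le_one {t : ℕ} (ht : 1 ≤ t) : (t : ℝ) ^ (-(1 / 4) : ℝ) ≤ 1 :=
  Real.rpow_le_one_of_one_le_of_nonpos (by exact_mod_cast ht) (by norm_num)

lemma sum_armLaw [Nonempty M.X] (hG : lamG ∈ stdSimplex ℝ M.X) (t : ℕ) :
    ∑ a : M.X, M.armLaw η lamG θ₁ θ x ε t a = 1 := by
  simp only [armLaw, Finset.sum_add_distrib, ← Finset.mul_sum, sum_hedge, hG.2]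
  ring

lemma rate_mul_le_armLaw [Nonempty M.X] {t : ℕ} (ht : 1 ≤ t) (a : M.X) :
    (t : ℝ) ^ (-(1 / 4) : ℝ) * lamG a ≤ M.armLaw η lamG θ₁ θ x ε t a := by
  unfold armLaw
  have := mul_nonneg (sub_nonneg.2 (rate_le_one ht))
    (hedge_pos (η := η) (g := M.gain θ₁ θ x ε) (t - 1) a).le
  linarith

lemma one_sub_rate_mul_le_armLaw (hG : lamG ∈ stdSimplex ℝ M.X) (t : ℕ) (a : M.X) :
    (1 - (t : ℝ) ^ (-(1 / 4) : ℝ)) * M.hedge η (M.gain θ₁ θ x ε) (t - 1) a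
      ≤ M.armLaw η lamG θ₁ θ x ε t a := by
  unfold armLaw
  have := mul_nonneg (rate_nonneg t) (hG.1 a)
  linarith

lemma armLaw_nonneg [Nonempty M.X] (hG : lamG ∈ stdSimplex ℝ M.X) {t : ℕ} (ht : 1 ≤ t) (a : M.X) :
    0 ≤ M.armLaw η lamG θ₁ θ x ε t a :=
  (mul_nonneg (rate_nonneg t) (hG.1 a)).trans (rate_mul_le_armLaw ht a)

lemma armLaw_le_one [Nonempty M.X] (hG : lamG ∈ stdSimplex ℝ M.X) {t : ℕ} (ht : 1 ≤ t) (a : M.X) :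
    M.armLaw η lamG θ₁ θ x ε t a ≤ 1 := by
  rw [← sum_armLaw (η := η) (θ₁ := θ₁) (θ := θ) (x := x) (ε := ε) hG t]
  exact Finset.single_le_sum (fun b _ => armLaw_nonneg hG ht b) (Finset.mem_univ a)

end ArmLaw

/-! ### Histories and the quantities they determine. -/

namespace IsRun

variable {Ω : Type*} [mΩ : MeasurableSpace Ω] {P : Measure Ω} {T : ℕ} {ηlam ηp : ℝ} {lamG : M.X → ℝ}
  {f : (Fin d → ℝ) → Fin d → ℝ} {θ₁ : Fin d → ℝ} {θ : ℕ → Ω → Fin d → ℝ} {x : ℕ → Ω → M.X}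
  {ε : ℕ → Ω → ℝ}

lemma history_le (h : M.IsRun P T ηlam ηp lamG f θ₁ θ x ε) {t : ℕ} (ht : t ≤ T + 1) : M.history θ x ε t ≤ mΩ := by
  refine iSup₂_le fun s hs => ?_
  have hs' : s ∈ Finset.Icc 1 T := by
    simp only [Finset.mem_Icc, Finset.mem_Ico] at *; omega
  exact ((h.measurable_param s hs').prodMk
    ((h.measurable_arm s hs').prodMk (h.measurable_noise s hs'))).comap_le

end IsRun

section History

variable {Ω : Type*} {θ : ℕ → Ω → Fin d → ℝ} {x : ℕ → Ω → M.X} {ε : ℕ → Ω → ℝ}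

lemma history_mono {s t : ℕ} (hst : s ≤ t) : M.history θ x ε s ≤ M.history θ x ε t :=
  biSup_mono fun r hr => by
    simp only [Finset.mem_Ico] at *; omega

lemma measurable_step_history {s t : ℕ} (hs : s ∈ Finset.Ico 1 t) :
    Measurable[M.history θ x ε t] fun ω => (θ s ω, x s ω, ε s ω) :=
  (comap_measurable _).mono (le_iSup₂_of_le s hs le_rfl) le_rfl

lemma measurable_param_history {s t : ℕ} (hs : s ∈ Finset.Ico 1 t) :
    Measurable[M.history θ x ε t] (θ s) :=
  measurable_fst.comp (measurable_step_history hs)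

lemma measurable_arm_history {s t : ℕ} (hs : s ∈ Finset.Ico 1 t) :
    Measurable[M.history θ x ε t] (x s) :=
  (measurable_fst.comp measurable_snd).comp (measurable_step_history hs)

lemma measurable_noise_history {s t : ℕ} (hs : s ∈ Finset.Ico 1 t) :
    Measurable[M.history θ x ε t] (ε s) :=
  (measurable_snd.comp measurable_snd).comp (measurable_step_history hs)

lemma measurable_armLaw_history (η : ℝ) (lamG : M.X → ℝ) (θ₁ : Fin d → ℝ) (t : ℕ) (a : M.X) :
    Measurable[M.history θ x ε t] fun ω =>
      M.armLaw η lamG θ₁ (fun s => θ s ω) (fun s => x s ω) (fun s => ε s ω) t a :=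
  @measurable_armLaw d M Ω (M.history θ x ε t) θ x ε η lamG θ₁ t
    (fun _ hs => measurable_param_history hs) (fun _ hs => measurable_arm_history hs)
    (fun _ hs => measurable_noise_history hs) a

lemma measurable_est_history (θ₁ : Fin d → ℝ) (t : ℕ) :
    Measurable[M.history θ x ε t] fun ω => M.est θ₁ (fun s => x s ω) (fun s => ε s ω) (t - 1) := by
  have hsub : ∀ s ∈ Finset.Icc 1 (t - 1), s ∈ Finset.Ico 1 t := by
    intro s hs; simp only [Finset.mem_Icc, Finset.mem_Ico] at *; omega
  exact @measurable_est d M Ω (M.history θ x ε t) x ε θ₁ (t - 1)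
    (fun s hs => measurable_arm_history (hsub s hs))
    (fun s hs => measurable_noise_history (hsub s hs))

end History

/-- The standing assumptions on the bandit. -/
structure IsRegular (M : Bandit d) : Prop where
  isClosed : IsClosed M.Θ
  isBounded : Bornology.IsBounded M.Θ
  param_mem : M.θs ∈ M.Θ
  best_mem : M.zs ∈ M.Z
  unique : ∀ z ∈ M.Z, z ≠ M.zs → z ⬝ᵥ M.θs < M.zs ⬝ᵥ M.θs
  span_le : Submodule.span ℝ (M.Z : Set (Fin d → ℝ)) ≤ Submodule.span ℝ (M.X : Set (Fin d → ℝ))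
  param_mem_closure : M.θs ∈ closure (interior M.Θ)
  alt_nonempty : (M.alt M.zs).Nonempty
  alt_subset_closure : M.alt M.zs ⊆ closure (interior (M.alt M.zs))

namespace IsRegular

lemma volume_alt_ne_zero (hM : M.IsRegular) {z : Fin d → ℝ} (hz : z ∈ M.Z) :
    volume (M.alt z) ≠ 0 :=
  Bandit.volume_alt_ne_zero hM.best_mem hM.unique hM.param_mem_closure hM.alt_nonempty
    hM.alt_subset_closure hz

lemma isProbabilityMeasure_paramLaw (hM : M.IsRegular) {f : (Fin d → ℝ) → Fin d → ℝ}
    (hf : M.IsArgmaxOracle f) (η : ℝ) (θ₁ : Fin d → ℝ) (x : ℕ → M.X) (ε : ℕ → ℝ) (t : ℕ) :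
    IsProbabilityMeasure (M.paramLaw η f θ₁ x ε t) :=
  Bandit.isProbabilityMeasure_paramLaw hM.isBounded η hf (fun _ hz => hM.volume_alt_ne_zero hz)
    θ₁ x ε t

/-- Without arms the span condition would force every answer to be zero, leaving no competitor of
`zs` and hence no alternative. -/
lemma nonempty_arms (hM : M.IsRegular) : Nonempty M.X := by
  by_contra hX
  have hX' : M.X = ∅ := by
    by_contra h0
    obtain ⟨a, ha⟩ := Finset.nonempty_iff_ne_empty.2 h0
    exact hX ⟨⟨a, ha⟩⟩
  have h0 : ∀ z ∈ M.Z, z = 0 := by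
    intro z hz
    have := hM.span_le (Submodule.subset_span hz)
    simpa [hX'] using this
  obtain ⟨-, -, z', hz', hne, -⟩ := hM.alt_nonempty
  exact hne ((h0 z' hz').trans (h0 _ hM.best_mem).symm)

end IsRegular

/-- A finite measure is determined by its values on a suitable countable family. -/
lemma ae_eq_of_forall_measurableSet_ae_eq {Ω E : Type*} [MeasurableSpace Ω] [MeasurableSpace E]
    [MeasurableSpace.CountablyGenerated E] {P : Measure Ω} {κ ν : Ω → Measure E}
    [∀ ω, IsProbabilityMeasure (κ ω)] [∀ ω, IsProbabilityMeasure (ν ω)]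
    (h : ∀ U, MeasurableSet U → ∀ᵐ ω ∂P, (κ ω).real U = (ν ω).real U) : ∀ᵐ ω ∂P, κ ω = ν ω := by
  set 𝒜 := generateSetAlgebra (MeasurableSpace.countableGeneratingSet E) with h𝒜
  have hcount : 𝒜.Countable :=
    countable_generateSetAlgebra (MeasurableSpace.countable_countableGeneratingSet (α := E))
  have hgen : MeasurableSpace.generateFrom 𝒜 = ‹MeasurableSpace E› := by
    rw [h𝒜, generateFrom_generateSetAlgebra_eq, MeasurableSpace.generateFrom_countableGeneratingSet]
  have hmeas : ∀ U ∈ 𝒜, MeasurableSet U := fun U hU => by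
    rw [← hgen]; exact MeasurableSpace.measurableSet_generateFrom hU
  have hall : ∀ᵐ ω ∂P, ∀ U ∈ 𝒜, (κ ω).real U = (ν ω).real U :=
    (ae_ball_iff hcount).2 fun U hU => h U (hmeas U hU)
  filter_upwards [hall] with ω hω
  refine ext_of_generate_finite 𝒜 hgen.symm
    (fun s hs t ht _ => isSetAlgebra_generateSetAlgebra.inter_mem hs ht) (fun U hU => ?_) (by simp)
  have := hω U hU
  rwa [measureReal_def, measureReal_def,
    ENNReal.toReal_eq_toReal_iff' (measure_ne_top _ _) (measure_ne_top _ _)] at this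

/-! ### Conditional laws of the arm and of the sampled parameter. -/

namespace IsRun

variable {Ω : Type*} [mΩ : MeasurableSpace Ω] {P : Measure Ω} [IsProbabilityMeasure P] {T : ℕ}
  {ηlam ηp : ℝ} {lamG : M.X → ℝ}
  {f : (Fin d → ℝ) → Fin d → ℝ} {θ₁ : Fin d → ℝ} {θ : ℕ → Ω → Fin d → ℝ} {x : ℕ → Ω → M.X}
  {ε : ℕ → Ω → ℝ}

lemma history_le_of_mem (h : M.IsRun P T ηlam ηp lamG f θ₁ θ x ε) {t : ℕ}
    (ht : t ∈ Finset.Icc 1 T) : M.history θ x ε t ≤ mΩ :=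
  h.history_le ((Finset.mem_Icc.1 ht).2.trans (Nat.le_succ _))

lemma integrable_indicator_one {A : Set Ω} (hA : MeasurableSet A) :
    Integrable (A.indicator fun _ => (1 : ℝ)) P :=
  (integrable_const 1).indicator hA

lemma measurableSet_step (h : M.IsRun P T ηlam ηp lamG f θ₁ θ x ε) {t : ℕ}
    (ht : t ∈ Finset.Icc 1 T) {U : Set (Fin d → ℝ)} {C : Set ℝ} (a : M.X)
    (hU : MeasurableSet U) (hC : MeasurableSet C) :
    MeasurableSet {ω | θ t ω ∈ U ∧ x t ω = a ∧ ε t ω ∈ C} :=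
  (h.measurable_param t ht hU).inter
    ((h.measurable_arm t ht (measurableSet_singleton a)).inter (h.measurable_noise t ht hC))

lemma condExp_arm_noise (h : M.IsRun P T ηlam ηp lamG f θ₁ θ x ε) (hM : M.IsRegular)
    (hf : M.IsArgmaxOracle f) {t : ℕ} (ht : t ∈ Finset.Icc 1 T) (a : M.X) {C : Set ℝ}
    (hC : MeasurableSet C) :
    P[Set.indicator {ω | x t ω = a ∧ ε t ω ∈ C} (fun _ => (1 : ℝ)) | M.history θ x ε t] =ᵐ[P]
      fun ω => M.armLaw ηlam lamG θ₁ (fun s => θ s ω) (fun s => x s ω) (fun s => ε s ω) t a *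
        (gaussianReal 0 1).real C := by
  have h1 := h.step_law t ht Set.univ a C MeasurableSet.univ hC
  simp only [Set.mem_univ, true_and] at h1
  refine h1.trans (ae_of_all _ fun ω => ?_)
  have := hM.isProbabilityMeasure_paramLaw hf ηp θ₁ (fun s => x s ω) (fun s => ε s ω) t
  simp

lemma condExp_arm (h : M.IsRun P T ηlam ηp lamG f θ₁ θ x ε) (hM : M.IsRegular)
    (hf : M.IsArgmaxOracle f) {t : ℕ} (ht : t ∈ Finset.Icc 1 T) (a : M.X) :
    P[Set.indicator {ω | x t ω = a} (fun _ => (1 : ℝ)) | M.history θ x ε t] =ᵐ[P]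
      fun ω => M.armLaw ηlam lamG θ₁ (fun s => θ s ω) (fun s => x s ω) (fun s => ε s ω) t a := by
  have h1 := h.condExp_arm_noise hM hf ht a MeasurableSet.univ
  simpa only [Set.mem_univ, and_true, probReal_univ, mul_one] using h1

lemma condExp_param (h : M.IsRun P T ηlam ηp lamG f θ₁ θ x ε) (hM : M.IsRegular)
    (hG : lamG ∈ stdSimplex ℝ M.X) {t : ℕ} (ht : t ∈ Finset.Icc 1 T) {U : Set (Fin d → ℝ)}
    (hU : MeasurableSet U) :
    P[Set.indicator (θ t ⁻¹' U) (fun _ => (1 : ℝ)) | M.history θ x ε t] =ᵐ[P]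
      fun ω => (M.paramLaw ηp f θ₁ (fun s => x s ω) (fun s => ε s ω) t).real U := by
  have := hM.nonempty_arms
  have h1 : ∀ a : M.X, P[Set.indicator {ω | θ t ω ∈ U ∧ x t ω = a ∧ ε t ω ∈ Set.univ}
      (fun _ => (1 : ℝ)) | M.history θ x ε t] =ᵐ[P] fun ω =>
        (M.paramLaw ηp f θ₁ (fun s => x s ω) (fun s => ε s ω) t).real U *
        M.armLaw ηlam lamG θ₁ (fun s => θ s ω) (fun s => x s ω) (fun s => ε s ω) t a := by
    intro a
    simpa using h.step_law t ht U a Set.univ hU MeasurableSet.univ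
  have h2 : Set.indicator (θ t ⁻¹' U) (fun _ => (1 : ℝ)) = ∑ a : M.X,
      Set.indicator {ω | θ t ω ∈ U ∧ x t ω = a ∧ ε t ω ∈ Set.univ} (fun _ => (1 : ℝ)) := by
    ext ω
    rw [Finset.sum_apply]
    by_cases hω : θ t ω ∈ U
    · simp [Set.indicator, hω]
    · simp [Set.indicator, hω]
  rw [h2]
  refine (condExp_finsetSum (fun a _ =>
    integrable_indicator_one (h.measurableSet_step ht a hU MeasurableSet.univ)) _).trans ?_
  filter_upwards [ae_all_iff.2 h1] with ω hω
  rw [Finset.sum_apply, Finset.sum_congr rfl fun a _ => hω a, ← Finset.mul_sum, sum_armLaw hG,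
    mul_one]

/-- The target set is random, but it depends only on the answer `f θ̂_t`, which is determined by the
history and takes finitely many values. On each event `f θ̂_t = z` the conditional law gives no mass
to the complement of the fixed set `M.alt z`. -/
lemma param_mem_alt (h : M.IsRun P T ηlam ηp lamG f θ₁ θ x ε) (hM : M.IsRegular)
    (hf : M.IsArgmaxOracle f) (hG : lamG ∈ stdSimplex ℝ M.X) {t : ℕ} (ht : t ∈ Finset.Icc 1 T) :
    ∀ᵐ ω ∂P, θ t ω ∈ M.alt (f (M.est θ₁ (fun s => x s ω) (fun s => ε s ω) (t - 1))) := by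
  have hz : ∀ z ∈ M.Z, ∀ᵐ ω ∂P,
      f (M.est θ₁ (fun s => x s ω) (fun s => ε s ω) (t - 1)) = z → θ t ω ∈ M.alt z := by
    intro z _
    have hU : MeasurableSet (M.alt z)ᶜ := (isClosed_alt hM.isClosed z).measurableSet.compl
    set A := {ω | f (M.est θ₁ (fun s => x s ω) (fun s => ε s ω) (t - 1)) = z}
    have hA : MeasurableSet[M.history θ x ε t] A :=
      (hf.1.comp (measurable_est_history θ₁ t)) (measurableSet_singleton z)
    have hle := h.history_le_of_mem ht
    have hBm : MeasurableSet (θ t ⁻¹' (M.alt z)ᶜ) := h.measurable_param t ht hU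
    have h1 := setIntegral_condExp hle (integrable_indicator_one (P := P) hBm) hA
    have h2 : ∫ ω in A, (P[Set.indicator (θ t ⁻¹' (M.alt z)ᶜ) (fun _ => (1 : ℝ)) |
        M.history θ x ε t]) ω ∂P = 0 := by
      rw [setIntegral_congr_ae (g := fun _ => 0) (hle _ hA)]
      · simp
      · filter_upwards [h.condExp_param hM hG ht hU] with ω hω hωA
        rw [hω]
        have := paramLaw_alt_compl hM.isClosed ηp f θ₁ (fun s => x s ω) (fun s => ε s ω) t
        rw [show f (M.est θ₁ (fun s => x s ω) (fun s => ε s ω) (t - 1)) = z from hωA] at this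
        simp [measureReal_def, this]
    rw [h2, setIntegral_indicator hBm, setIntegral_const, smul_eq_mul, mul_one, eq_comm,
      measureReal_eq_zero_iff] at h1
    filter_upwards [measure_eq_zero_iff_ae_notMem.1 h1] with ω hω hωA
    by_contra hc
    exact hω ⟨hωA, hc⟩
  have hall := (ae_ball_iff (S := (M.Z : Set (Fin d → ℝ))) M.Z.countable_toSet).2 hz
  filter_upwards [hall] with ω hω
  exact hω _ (hf.2 _).1 rfl

/-- The step law only speaks of probabilities of sets. Its values for each measurable set identify
the regular conditional distribution of `θ t` with `paramLaw` almost surely, and integrals follow.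
-/
lemma condExp_param_integral (h : M.IsRun P T ηlam ηp lamG f θ₁ θ x ε) (hM : M.IsRegular)
    (hf : M.IsArgmaxOracle f) (hG : lamG ∈ stdSimplex ℝ M.X) {t : ℕ} (ht : t ∈ Finset.Icc 1 T)
    {φ : (Fin d → ℝ) → ℝ} (hφ : StronglyMeasurable φ) (hφi : Integrable (fun ω => φ (θ t ω)) P) :
    P[fun ω => φ (θ t ω) | M.history θ x ε t] =ᵐ[P]
      fun ω => ∫ ϑ, φ ϑ ∂(M.paramLaw ηp f θ₁ (fun s => x s ω) (fun s => ε s ω) t) := by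
  have hle := h.history_le_of_mem ht
  -- Conditioning on the identity map into `Ω` equipped with the history σ-algebra is conditioning
  -- on the history.
  have hX : @Measurable Ω Ω mΩ (M.history θ x ε t) id := measurable_id'' hle
  have hY := h.measurable_param t ht
  have hcomap : (M.history θ x ε t).comap id = M.history θ x ε t := MeasurableSpace.comap_id
  have h1 := condExp_ae_eq_integral_condDistrib (mβ := M.history θ x ε t) (X := id) hX
    hY.aemeasurable hφ hφi
  rw [hcomap] at h1
  refine h1.trans ?_
  have := fun ω => hM.isProbabilityMeasure_paramLaw hf ηp θ₁ (fun s => x s ω) (fun s => ε s ω) t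
  let κ := @condDistrib Ω Ω (Fin d → ℝ) _ _ _ mΩ (M.history θ x ε t) (θ t) id P _
  have hκ' : @IsMarkovKernel Ω (Fin d → ℝ) (M.history θ x ε t) _ κ := by
    unfold κ; infer_instance
  have hκ : ∀ ω, IsProbabilityMeasure (κ ω) := fun ω => hκ'.isProbabilityMeasure ω
  have h2 : ∀ᵐ ω ∂P, κ ω = M.paramLaw ηp f θ₁ (fun s => x s ω) (fun s => ε s ω) t := by
    refine ae_eq_of_forall_measurableSet_ae_eq fun U hU => ?_
    have h3 := condDistrib_ae_eq_condExp (μ := P) (mβ := M.history θ x ε t) (X := id) hX hY hU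
    rw [hcomap] at h3
    exact h3.trans (h.condExp_param hM hG ht hU)
  filter_upwards [h2] with ω hω
  exact congrArg (fun ν => ∫ ϑ, φ ϑ ∂ν) hω

end IsRun

/-! ### Independence of the noise, and exponential moments of noise sums and play counts. -/

namespace IsRun

variable {Ω : Type*} [mΩ : MeasurableSpace Ω] {P : Measure Ω} [IsProbabilityMeasure P] {T : ℕ}
  {ηlam ηp : ℝ} {lamG : M.X → ℝ}
  {f : (Fin d → ℝ) → Fin d → ℝ} {θ₁ : Fin d → ℝ} {θ : ℕ → Ω → Fin d → ℝ} {x : ℕ → Ω → M.X}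
  {ε : ℕ → Ω → ℝ}

lemma real_inter_arm_noise (h : M.IsRun P T ηlam ηp lamG f θ₁ θ x ε) (hM : M.IsRegular)
    (hf : M.IsArgmaxOracle f) {t : ℕ} (ht : t ∈ Finset.Icc 1 T) {A : Set Ω}
    (hA : MeasurableSet[M.history θ x ε t] A) (a : M.X) {C : Set ℝ} (hC : MeasurableSet C) :
    P.real (A ∩ {ω | x t ω = a ∧ ε t ω ∈ C}) =
      P.real (A ∩ {ω | x t ω = a}) * (gaussianReal 0 1).real C := by
  have hle := h.history_le_of_mem ht
  have hx : MeasurableSet {ω | x t ω = a} := h.measurable_arm t ht (measurableSet_singleton a)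
  have hε : MeasurableSet {ω | ε t ω ∈ C} := h.measurable_noise t ht hC
  have key : ∀ {D : Set Ω}, MeasurableSet D → P.real (A ∩ D) =
      ∫ ω in A, (P[Set.indicator D (fun _ => (1 : ℝ)) | M.history θ x ε t]) ω ∂P := by
    intro D hD
    rw [setIntegral_condExp hle (integrable_indicator_one hD) hA, setIntegral_indicator hD,
      setIntegral_const, smul_eq_mul, mul_one]
  have h1 : P.real (A ∩ {ω | x t ω = a ∧ ε t ω ∈ C}) = ∫ ω in A,
      (P[Set.indicator {ω | x t ω = a ∧ ε t ω ∈ C} (fun _ => (1 : ℝ)) | M.history θ x ε t]) ω ∂P :=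
    key (hx.inter hε)
  have h2 := key hx
  rw [setIntegral_congr_ae (hle _ hA) ((h.condExp_arm_noise hM hf ht a hC).mono fun ω hω _ => hω),
    integral_mul_const] at h1
  rw [setIntegral_congr_ae (hle _ hA) ((h.condExp_arm hM hf ht a).mono fun ω hω _ => hω)] at h2
  rw [h2]
  exact h1

lemma measure_inter_arm_noise (h : M.IsRun P T ηlam ηp lamG f θ₁ θ x ε) (hM : M.IsRegular)
    (hf : M.IsArgmaxOracle f) {t : ℕ} (ht : t ∈ Finset.Icc 1 T) {A : Set Ω}
    (hA : MeasurableSet[M.history θ x ε t] A) (S : Set M.X) {C : Set ℝ} (hC : MeasurableSet C) :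
    P (A ∩ x t ⁻¹' S ∩ ε t ⁻¹' C) = P (A ∩ x t ⁻¹' S) * gaussianReal 0 1 C := by
  classical
  have hle := h.history_le_of_mem ht
  have hx : ∀ a, MeasurableSet {ω | x t ω = a} := fun a =>
    h.measurable_arm t ht (measurableSet_singleton a)
  have hε : MeasurableSet (ε t ⁻¹' C) := h.measurable_noise t ht hC
  have hsplit : ∀ D : Set Ω, MeasurableSet D →
      P (A ∩ x t ⁻¹' S ∩ D) = ∑ a : S, P (A ∩ {ω | x t ω = a ∧ ω ∈ D}) := by
    intro D hD
    have hU : A ∩ x t ⁻¹' S ∩ D = ⋃ a : S, A ∩ {ω | x t ω = a ∧ ω ∈ D} := by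
      ext ω
      simp only [Set.mem_inter_iff, Set.mem_preimage, Set.mem_iUnion, Set.mem_ofPred_eq]
      constructor
      · rintro ⟨⟨h1, h2⟩, h3⟩
        exact ⟨⟨x t ω, h2⟩, h1, rfl, h3⟩
      · rintro ⟨a, h1, h2, h3⟩
        exact ⟨⟨h1, h2 ▸ a.2⟩, h3⟩
    rw [hU, measure_iUnion, tsum_fintype]
    · intro a b hab
      refine Set.disjoint_left.2 fun ω h1 h2 => hab (Subtype.ext ?_)
      exact h1.2.1.symm.trans h2.2.1
    · exact fun a => (hle _ hA).inter ((hx a).inter hD)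
  have h1 := hsplit _ hε
  have h2 := hsplit Set.univ MeasurableSet.univ
  simp only [Set.inter_univ, Set.mem_univ, and_true] at h2
  rw [h1, h2, Finset.sum_mul]
  refine Finset.sum_congr rfl fun a _ => ?_
  have h3 := h.real_inter_arm_noise hM hf ht hA a hC
  rw [measureReal_def, measureReal_def, measureReal_def, ← ENNReal.toReal_mul,
    ENNReal.toReal_eq_toReal_iff' (measure_ne_top _ _)
      (ENNReal.mul_ne_top (measure_ne_top _ _) (measure_ne_top _ _))] at h3
  exact h3

lemma map_noise (h : M.IsRun P T ηlam ηp lamG f θ₁ θ x ε) (hM : M.IsRegular)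
    (hf : M.IsArgmaxOracle f) {t : ℕ} (ht : t ∈ Finset.Icc 1 T) :
    P.map (ε t) = gaussianReal 0 1 := by
  ext C hC
  have h1 := h.measure_inter_arm_noise hM hf ht MeasurableSet.univ Set.univ hC
  rw [Measure.map_apply (h.measurable_noise t ht) hC]
  simpa using h1

/-- The noise is independent of the history and the current arm. -/
lemma indep_noise (h : M.IsRun P T ηlam ηp lamG f θ₁ θ x ε) (hM : M.IsRegular)
    (hf : M.IsArgmaxOracle f) {t : ℕ} (ht : t ∈ Finset.Icc 1 T) :
    Indep (M.history θ x ε t ⊔ MeasurableSpace.comap (x t) inferInstance)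
      (MeasurableSpace.comap (ε t) inferInstance) P := by
  have hle := h.history_le_of_mem ht
  have hlex := (h.measurable_arm t ht).comap_le
  -- These intersections form a π-system generating the join of the history with the σ-algebra of
  -- the arm, and on them independence is the product formula `measure_inter_arm_noise`.
  set p : Set (Set Ω) :=
    {B | ∃ A, MeasurableSet[M.history θ x ε t] A ∧ ∃ S : Set M.X, B = A ∩ x t ⁻¹' S} with hp
  refine IndepSets.indep (p1 := p) (p2 := {B | MeasurableSet[MeasurableSpace.comap (ε t) inferInstance] B})
    (sup_le hle hlex) (h.measurable_noise t ht).comap_le ?_ ?_ ?_ ?_ ?_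
  · rintro _ ⟨A, hA, S, rfl⟩ _ ⟨A', hA', S', rfl⟩ -
    exact ⟨A ∩ A', hA.inter hA', S ∩ S', by rw [Set.preimage_inter]; ac_rfl⟩
  · exact @MeasurableSpace.isPiSystem_measurableSet Ω (MeasurableSpace.comap (ε t) inferInstance)
  · refine le_antisymm (sup_le (fun A hA => ?_) ?_) (MeasurableSpace.generateFrom_le ?_)
    · exact MeasurableSpace.measurableSet_generateFrom ⟨A, hA, Set.univ, by simp⟩
    · rintro _ ⟨S, -, rfl⟩
      exact MeasurableSpace.measurableSet_generateFrom ⟨Set.univ, MeasurableSet.univ, S, by simp⟩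
    · rintro _ ⟨A, hA, S, rfl⟩
      refine MeasurableSet.inter (le_sup_left (a := M.history θ x ε t) _ hA)
        (le_sup_right (a := M.history θ x ε t) _ ⟨S, Set.toFinite S |>.measurableSet, rfl⟩)
  · exact (@MeasurableSpace.generateFrom_measurableSet Ω
      (MeasurableSpace.comap (ε t) inferInstance)).symm
  · rw [IndepSets_iff]
    rintro _ _ ⟨A, hA, S, rfl⟩ ⟨C, hC, rfl⟩
    rw [h.measure_inter_arm_noise hM hf ht hA S hC, ← h.map_noise hM hf ht,
      Measure.map_apply (h.measurable_noise t ht) hC]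

lemma lintegral_exp_noise (h : M.IsRun P T ηlam ηp lamG f θ₁ θ x ε) (hM : M.IsRegular)
    (hf : M.IsArgmaxOracle f) {t : ℕ} (ht : t ∈ Finset.Icc 1 T) (μ : ℝ) :
    ∫⁻ ω, ENNReal.ofReal (Real.exp (μ * ε t ω)) ∂P = ENNReal.ofReal (Real.exp (μ ^ 2 / 2)) := by
  have hmap := h.map_noise hM hf ht
  have h1 := mgf_gaussianReal hmap μ
  have h2 : Integrable (fun ω => Real.exp (μ * ε t ω)) P := by
    have := integrable_exp_mul_gaussianReal (μ := 0) (v := 1) μ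
    rw [← hmap] at this
    exact this.comp_measurable (h.measurable_noise t ht)
  rw [← ofReal_integral_eq_lintegral_ofReal h2 (ae_of_all _ fun ω => (Real.exp_pos _).le)]
  rw [mgf] at h1
  rw [h1]
  simp

lemma measurable_armNoise {m : MeasurableSpace Ω} {n : ℕ}
    (hx : ∀ s ∈ Finset.Icc 1 n, Measurable[m] (x s)) (hε : ∀ s ∈ Finset.Icc 1 n, Measurable[m] (ε s))
    (a : M.X) : Measurable[m] fun ω => M.armNoise (fun s => x s ω) (fun s => ε s ω) n a :=
  Finset.measurable_sum _ fun s hs =>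
    Measurable.ite (hx s hs (measurableSet_singleton a)) (hε s hs) measurable_const

lemma measurable_armCount {m : MeasurableSpace Ω} {n : ℕ}
    (hx : ∀ s ∈ Finset.Icc 1 n, Measurable[m] (x s)) (a : M.X) :
    Measurable[m] fun ω => M.armCount (fun s => x s ω) n a :=
  Finset.measurable_sum _ fun s hs =>
    Measurable.ite (hx s hs (measurableSet_singleton a)) measurable_const measurable_const

lemma mem_Ico_succ {n s : ℕ} (hs : s ∈ Finset.Icc 1 n) : s ∈ Finset.Ico 1 (n + 1) := by
  simp only [Finset.mem_Icc, Finset.mem_Ico] at *; omega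

/-- A supermartingale argument: a round contributes the factor `exp (μ ^ 2 / 2)` if `a` is played
and `1 ≤ exp (μ ^ 2 / 2)` otherwise. The random play count is thus replaced by `n`, and no
self-normalised inequality is needed. Lower integrals spare the integrability of the exponentials.
-/
lemma lintegral_exp_armNoise_le (h : M.IsRun P T ηlam ηp lamG f θ₁ θ x ε) (hM : M.IsRegular)
    (hf : M.IsArgmaxOracle f) (a : M.X) (μ : ℝ) {n : ℕ} (hn : n ≤ T) :
    ∫⁻ ω, ENNReal.ofReal (Real.exp (μ * M.armNoise (fun s => x s ω) (fun s => ε s ω) n a)) ∂P ≤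
      ENNReal.ofReal (Real.exp (n * (μ ^ 2 / 2))) := by
  induction n with
  | zero => simp [armNoise]
  | succ n ih =>
    have ht : n + 1 ∈ Finset.Icc 1 T := Finset.mem_Icc.2 ⟨by omega, hn⟩
    have hle := h.history_le_of_mem ht
    have hlex := (h.measurable_arm _ ht).comap_le
    set F : Ω → ENNReal := fun ω =>
      ENNReal.ofReal (Real.exp (μ * M.armNoise (fun s => x s ω) (fun s => ε s ω) n a)) with hF
    set g : Ω → ENNReal := fun ω => ENNReal.ofReal (Real.exp (μ * ε (n + 1) ω)) with hg
    have hFm : Measurable[M.history θ x ε (n + 1)] F := by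
      refine ENNReal.measurable_ofReal.comp (Real.measurable_exp.comp ?_)
      exact (measurable_armNoise (m := M.history θ x ε (n + 1))
        (fun s hs => measurable_arm_history (mem_Ico_succ hs))
        (fun s hs => measurable_noise_history (mem_Ico_succ hs)) a).const_mul μ
    have hB : MeasurableSet[M.history θ x ε (n + 1) ⊔
        MeasurableSpace.comap (x (n + 1)) inferInstance] {ω | x (n + 1) ω = a} :=
      le_sup_right (a := M.history θ x ε (n + 1)) _ ⟨{a}, measurableSet_singleton a, rfl⟩
    have hBm : MeasurableSet {ω | x (n + 1) ω = a} := sup_le hle hlex _ hB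
    have hFH' : Measurable[M.history θ x ε (n + 1) ⊔ MeasurableSpace.comap (x (n + 1)) inferInstance] F := hFm.mono le_sup_left le_rfl
    have hgm : Measurable[MeasurableSpace.comap (ε (n + 1)) inferInstance] g :=
      ENNReal.measurable_ofReal.comp (Real.measurable_exp.comp
        ((comap_measurable (ε (n + 1))).const_mul μ))
    have hsplit : ∀ ω, ENNReal.ofReal
        (Real.exp (μ * M.armNoise (fun s => x s ω) (fun s => ε s ω) (n + 1) a)) =
        Set.indicator {ω | x (n + 1) ω = a} F ω * g ω
          + Set.indicator {ω | x (n + 1) ω = a}ᶜ F ω := by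
      intro ω
      have : M.armNoise (fun s => x s ω) (fun s => ε s ω) (n + 1) a =
          M.armNoise (fun s => x s ω) (fun s => ε s ω) n a +
            if x (n + 1) ω = a then ε (n + 1) ω else 0 := by
        simp only [armNoise]
        rw [Finset.sum_Icc_succ_top (by omega)]
      rw [this]
      by_cases hω : x (n + 1) ω = a
      · have h1 : ω ∈ {ω | x (n + 1) ω = a} := hω
        rw [if_pos hω, Set.indicator_of_mem h1, Set.indicator_of_notMem (Set.notMem_compl_iff.2 h1), add_zero,
          mul_add, Real.exp_add, ENNReal.ofReal_mul (Real.exp_pos _).le]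
      · have h1 : ω ∉ {ω | x (n + 1) ω = a} := hω
        rw [if_neg hω, Set.indicator_of_notMem h1, Set.indicator_of_mem (by exact h1), zero_mul,
          zero_add, add_zero]
    simp only [hsplit]
    have hFm' : Measurable F := hFm.mono hle le_rfl
    have hgm' : Measurable g := hgm.mono (h.measurable_noise _ ht).comap_le le_rfl
    rw [lintegral_add_left (f := fun ω => Set.indicator {ω | x (n + 1) ω = a} F ω * g ω)
        ((hFm'.indicator hBm).mul hgm'),
      lintegral_mul_eq_lintegral_mul_lintegral_of_independent_measurableSpace (sup_le hle hlex)
        (h.measurable_noise _ ht).comap_le (h.indep_noise hM hf ht)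
        (Measurable.indicator hFH' hB) hgm, hg, h.lintegral_exp_noise hM hf ht μ]
    have hone : (1 : ENNReal) ≤ ENNReal.ofReal (Real.exp (μ ^ 2 / 2)) := by
      rw [← ENNReal.ofReal_one]
      exact ENNReal.ofReal_le_ofReal (Real.one_le_exp (by positivity))
    calc _ ≤ (∫⁻ ω, Set.indicator {ω | x (n + 1) ω = a} F ω ∂P) *
          ENNReal.ofReal (Real.exp (μ ^ 2 / 2)) +
          (∫⁻ ω, Set.indicator {ω | x (n + 1) ω = a}ᶜ F ω ∂P) *
          ENNReal.ofReal (Real.exp (μ ^ 2 / 2)) := by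
          gcongr
          exact le_mul_of_one_le_right' hone
      _ = (∫⁻ ω, F ω ∂P) * ENNReal.ofReal (Real.exp (μ ^ 2 / 2)) := by
          rw [← add_mul, ← lintegral_add_left (hFm'.indicator hBm)]
          congr 2
          ext ω
          exact Set.indicator_self_add_compl_apply _ F ω
      _ ≤ ENNReal.ofReal (Real.exp (n * (μ ^ 2 / 2))) * ENNReal.ofReal (Real.exp (μ ^ 2 / 2)) := by
          gcongr
          exact ih (by omega)
      _ = _ := by
          rw [← ENNReal.ofReal_mul (Real.exp_pos _).le, ← Real.exp_add]
          congr 2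
          push_cast
          ring

/-- The exponential Markov inequality in the form used for the noise. -/
lemma measure_le_of_lintegral_exp_le {X : Ω → ℝ} (hX : Measurable X) {u c : ℝ}
    (hc : ∫⁻ ω, ENNReal.ofReal (Real.exp (X ω)) ∂P ≤ ENNReal.ofReal (Real.exp c)) :
    P {ω | u ≤ X ω} ≤ ENNReal.ofReal (Real.exp (c - u)) := by
  have h1 := meas_ge_le_lintegral_div (μ := P) (f := fun ω => ENNReal.ofReal (Real.exp (X ω)))
    (by fun_prop) (ε := ENNReal.ofReal (Real.exp u)) (by simp [Real.exp_pos]) ENNReal.ofReal_ne_top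
  have h2 : {ω | u ≤ X ω} ⊆
      {ω | ENNReal.ofReal (Real.exp u) ≤ ENNReal.ofReal (Real.exp (X ω))} := fun ω hω =>
    ENNReal.ofReal_le_ofReal (Real.exp_le_exp.2 hω)
  refine (measure_mono h2).trans (h1.trans ?_)
  rw [Real.exp_sub, ENNReal.ofReal_div_of_pos (Real.exp_pos u)]
  gcongr

/-- For bounded `F` measurable with respect to `m`, `E[F g] = E[F E[g | m]]`. -/
lemma integral_mul_condExp {m : MeasurableSpace Ω} (hm : m ≤ mΩ) {F g : Ω → ℝ}
    (hF : StronglyMeasurable[m] F) (hg : Integrable g P) (c : ℝ) (hFc : ∀ᵐ ω ∂P, ‖F ω‖ ≤ c) :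
    ∫ ω, F ω * g ω ∂P = ∫ ω, F ω * (P[g | m]) ω ∂P := by
  rw [← integral_condExp hm (f := fun ω => F ω * g ω)]
  exact integral_congr_ae (condExp_stronglyMeasurable_mul_of_bound hm hF hg c hFc)

/-- Conditionally on the past, a round multiplies the mean by `1 - (1 - exp (-1)) p`, where `p` is
the chance of playing `a`. Forced exploration gives `p ≥ s^(-1/4) * lamG a`, and `1 - exp (-1) ≥ 1 /
2`. -/
lemma integral_exp_neg_armCount_le (h : M.IsRun P T ηlam ηp lamG f θ₁ θ x ε) (hM : M.IsRegular)
    (hf : M.IsArgmaxOracle f) (a : M.X) {n : ℕ} (hn : n ≤ T) :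
    ∫ ω, Real.exp (-M.armCount (fun s => x s ω) n a) ∂P ≤
      Real.exp (-(1 / 2) * (lamG a * ∑ s ∈ Finset.Icc 1 n, (s : ℝ) ^ (-(1 / 4) : ℝ))) := by
  have := hM.nonempty_arms
  induction n with
  | zero => simp [armCount]
  | succ n ih =>
    have ht : n + 1 ∈ Finset.Icc 1 T := Finset.mem_Icc.2 ⟨by omega, hn⟩
    have hle := h.history_le_of_mem ht
    set F : Ω → ℝ := fun ω => Real.exp (-M.armCount (fun s => x s ω) n a) with hF
    set g : Ω → ℝ := Set.indicator {ω | x (n + 1) ω = a} (fun _ => (1 : ℝ)) with hg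
    have hFm : Measurable[M.history θ x ε (n + 1)] F :=
      Real.measurable_exp.comp (measurable_armCount (m := M.history θ x ε (n + 1))
        (fun s hs => measurable_arm_history (mem_Ico_succ hs)) a).neg
    have hFb : ∀ ω, ‖F ω‖ ≤ 1 := fun ω => by
      rw [Real.norm_of_nonneg (Real.exp_pos _).le]
      exact Real.exp_le_one_iff.2 (neg_nonpos.2 (armCount_nonneg _ _ _))
    have hgi : Integrable g P :=
      integrable_indicator_one (h.measurable_arm _ ht (measurableSet_singleton a))
    have hFi : Integrable F P := Integrable.of_bound
      (hFm.mono hle le_rfl).aestronglyMeasurable 1 (ae_of_all _ hFb)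
    have hFgi : Integrable (fun ω => F ω * g ω) P :=
      hgi.bdd_mul (hFm.mono hle le_rfl).aestronglyMeasurable (ae_of_all _ hFb)
    set γ : ℝ := ((n + 1 : ℕ) : ℝ) ^ (-(1 / 4) : ℝ) with hγ
    have hsplit : ∀ ω, Real.exp (-M.armCount (fun s => x s ω) (n + 1) a) =
        F ω - (1 - Real.exp (-1)) * (F ω * g ω) := by
      intro ω
      have : M.armCount (fun s => x s ω) (n + 1) a =
          M.armCount (fun s => x s ω) n a + if x (n + 1) ω = a then 1 else 0 := by
        simp only [armCount]
        rw [Finset.sum_Icc_succ_top (by omega)]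
      rw [this]
      by_cases hω : x (n + 1) ω = a
      · simp only [hF, hg, Set.indicator, Set.mem_ofPred_eq, if_pos hω]
        rw [neg_add, Real.exp_add]; ring
      · simp only [hF, hg, Set.indicator, Set.mem_ofPred_eq, if_neg hω]
        rw [add_zero]; ring
    have h1 : ∫ ω, F ω * g ω ∂P = ∫ ω, F ω * (P[g | M.history θ x ε (n + 1)]) ω ∂P :=
      integral_mul_condExp hle hFm.stronglyMeasurable hgi 1 (ae_of_all _ hFb)
    have h2 : γ * lamG a * ∫ ω, F ω ∂P ≤ ∫ ω, F ω * g ω ∂P := by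
      rw [h1, ← integral_const_mul]
      refine integral_mono_ae (hFi.const_mul _) ?_ ?_
      · exact (integrable_condExp (m := M.history θ x ε (n + 1)) (f := g)).bdd_mul
          (hFm.mono hle le_rfl).aestronglyMeasurable (ae_of_all _ hFb)
      · filter_upwards [h.condExp_arm hM hf ht a] with ω hω
        simp only [hg, hω]
        rw [mul_comm]
        exact mul_le_mul_of_nonneg_left (rate_mul_le_armLaw (by omega) a) (Real.exp_pos _).le
    have he : (1 / 2 : ℝ) ≤ 1 - Real.exp (-1) := by
      have := Real.exp_one_gt_d9
      rw [Real.exp_neg]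
      have h3 : (Real.exp 1)⁻¹ ≤ 2⁻¹ := inv_anti₀ (by norm_num) (by linarith)
      linarith
    have hIpos : 0 ≤ ∫ ω, F ω ∂P := integral_nonneg fun ω => (Real.exp_pos _).le
    have hFg0 : 0 ≤ ∫ ω, F ω * g ω ∂P := integral_nonneg fun ω =>
      mul_nonneg (Real.exp_pos _).le (Set.indicator_nonneg (fun _ _ => zero_le_one) ω)
    simp only [hsplit]
    rw [integral_sub hFi (hFgi.const_mul _), integral_const_mul]
    calc _ ≤ (∫ ω, F ω ∂P) * (-(1 / 2) * (lamG a * γ) + 1) := by nlinarith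
      _ ≤ (∫ ω, F ω ∂P) * Real.exp (-(1 / 2) * (lamG a * γ)) :=
          mul_le_mul_of_nonneg_left (Real.add_one_le_exp _) hIpos
      _ ≤ _ := mul_le_mul_of_nonneg_right (ih (by omega)) (Real.exp_pos _).le
      _ = _ := by
          rw [← Real.exp_add, Finset.sum_Icc_succ_top (by omega)]
          congr 1
          ring

end IsRun

end Bandit

/-! ### The martingale linking the losses of the two players. -/

/-- Orthogonality of martingale differences. -/
lemma memLp_and_integral_sq_sum_le {Ω : Type*} {mΩ : MeasurableSpace Ω} {P : Measure Ω}
    [IsProbabilityMeasure P] {T : ℕ} {D : ℕ → Ω → ℝ} {H : ℕ → MeasurableSpace Ω} {C : ℝ}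
    (hH : ∀ n ∈ Finset.Icc 1 T, H n ≤ mΩ)
    (hD : ∀ n ∈ Finset.Icc 1 T, ∀ s ∈ Finset.Ico 1 n, StronglyMeasurable[H n] (D s))
    (hL : ∀ n ∈ Finset.Icc 1 T, MemLp (D n) 2 P)
    (hC : ∀ n ∈ Finset.Icc 1 T, ∫ ω, D n ω ^ 2 ∂P ≤ C)
    (h0 : ∀ n ∈ Finset.Icc 1 T, P[D n | H n] =ᵐ[P] 0) {n : ℕ} (hn : n ≤ T) :
    MemLp (fun ω => ∑ s ∈ Finset.Icc 1 n, D s ω) 2 P ∧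
      ∫ ω, (∑ s ∈ Finset.Icc 1 n, D s ω) ^ 2 ∂P ≤ n * C := by
  induction n with
  | zero => simp
  | succ n ih =>
    obtain ⟨ih1, ih2⟩ := ih (by omega)
    have ht : n + 1 ∈ Finset.Icc 1 T := Finset.mem_Icc.2 ⟨by omega, hn⟩
    have hsum : ∀ ω, ∑ s ∈ Finset.Icc 1 (n + 1), D s ω =
        ∑ s ∈ Finset.Icc 1 n, D s ω + D (n + 1) ω := fun ω =>
      Finset.sum_Icc_succ_top (by omega) _
    simp only [hsum]
    refine ⟨ih1.add (hL _ ht), ?_⟩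
    set S : Ω → ℝ := fun ω => ∑ s ∈ Finset.Icc 1 n, D s ω with hS
    have hSm : StronglyMeasurable[H (n + 1)] S :=
      Finset.stronglyMeasurable_fun_sum _ fun s hs => hD _ ht s
        (by simp only [Finset.mem_Icc, Finset.mem_Ico] at *; omega)
    have hint : Integrable (S * D (n + 1)) P := ih1.integrable_mul (hL _ ht)
    have hcross : ∫ ω, S ω * D (n + 1) ω ∂P = 0 := by
      have h1 := condExp_mul_of_stronglyMeasurable_left hSm hint
        ((hL _ ht).integrable (by norm_num))
      have h2 : ∫ ω, (S * D (n + 1)) ω ∂P = ∫ ω, (P[S * D (n + 1) | H (n + 1)]) ω ∂P :=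
        (integral_condExp (hH _ ht)).symm
      refine h2.trans ?_
      rw [integral_congr_ae (g := fun _ => (0 : ℝ)), integral_zero]
      filter_upwards [h1, h0 _ ht] with ω h3 h4
      rw [h3, Pi.mul_apply, h4, Pi.zero_apply, mul_zero]
    have hexp : ∀ ω, (S ω + D (n + 1) ω) ^ 2 =
        S ω ^ 2 + (2 * (S ω * D (n + 1) ω) + D (n + 1) ω ^ 2) := fun ω => by ring
    have hint' : Integrable (fun ω => S ω * D (n + 1) ω) P := hint
    have hi2 := (hL _ ht).integrable_sq
    change ∫ ω, (S ω + D (n + 1) ω) ^ 2 ∂P ≤ _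
    simp only [hexp]
    rw [integral_add (f := fun ω => S ω ^ 2)
      (g := fun ω => 2 * (S ω * D (n + 1) ω) + D (n + 1) ω ^ 2) ih1.integrable_sq
      ((hint'.const_mul 2).add hi2), integral_add (hint'.const_mul 2) hi2, integral_const_mul,
      hcross]
    have := hC _ ht
    push_cast
    linarith

lemma integrable_gibbs {d : ℕ} {S : Set (Fin d → ℝ)} {G : (Fin d → ℝ) → ℝ}
    (hS : Bornology.IsBounded S) (hSm : MeasurableSet S) (hvol : volume S ≠ 0) (hG : Continuous G)
    {φ : (Fin d → ℝ) → ℝ} (hφ : Continuous φ) : Integrable φ (gibbs S G) := by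
  have := isProbabilityMeasure_gibbs hS hvol hG
  obtain ⟨C, hC⟩ := hS.isCompact_closure.exists_bound_of_continuousOn hφ.continuousOn
  refine Integrable.of_bound hφ.aestronglyMeasurable C ?_
  exact gibbs_absolutelyContinuous.ae_le
    ((ae_restrict_mem hSm).mono fun θ hθ => hC θ (subset_closure hθ))

namespace Bandit

variable {d : ℕ} {M : Bandit d}

lemma integrable_paramLaw (hM : M.IsRegular) {f : (Fin d → ℝ) → Fin d → ℝ}
    (hf : M.IsArgmaxOracle f) (η : ℝ) (θ₁ : Fin d → ℝ) (x : ℕ → M.X) (ε : ℕ → ℝ) (t : ℕ)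
    {φ : (Fin d → ℝ) → ℝ} (hφ : Continuous φ) : Integrable φ (M.paramLaw η f θ₁ x ε t) := by
  rw [paramLaw, truncNormal_eq_gibbs]
  exact integrable_gibbs (hM.isBounded.subset (alt_subset _)) (isClosed_alt hM.isClosed _).measurableSet
    (hM.volume_alt_ne_zero (hf.2 _).1) (continuous_const.mul (continuous_sqNorm_sub _ _)) hφ

namespace IsRun

variable {Ω : Type*} [mΩ : MeasurableSpace Ω] {P : Measure Ω} [IsProbabilityMeasure P] {T : ℕ}
  {ηlam ηp : ℝ} {lamG : M.X → ℝ}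
  {f : (Fin d → ℝ) → Fin d → ℝ} {θ₁ : Fin d → ℝ} {θ : ℕ → Ω → Fin d → ℝ} {x : ℕ → Ω → M.X}
  {ε : ℕ → Ω → ℝ}

lemma memLp_noise (h : M.IsRun P T ηlam ηp lamG f θ₁ θ x ε) (hM : M.IsRegular)
    (hf : M.IsArgmaxOracle f) {t : ℕ} (ht : t ∈ Finset.Icc 1 T) : MemLp (ε t) 2 P := by
  have h1 := memLp_id_gaussianReal (μ := 0) (v := 1) 2
  rw [← h.map_noise hM hf ht] at h1
  exact h1.comp_measurePreserving ⟨h.measurable_noise t ht, rfl⟩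

lemma integral_noise (h : M.IsRun P T ηlam ηp lamG f θ₁ θ x ε) (hM : M.IsRegular)
    (hf : M.IsArgmaxOracle f) {t : ℕ} (ht : t ∈ Finset.Icc 1 T) : ∫ ω, ε t ω ∂P = 0 := by
  have h1 : ∫ y, y ∂(gaussianReal 0 1) = 0 := integral_id_gaussianReal
  rw [← h.map_noise hM hf ht, integral_map (h.measurable_noise t ht).aemeasurable
    (by fun_prop)] at h1
  exact h1

lemma integral_noise_sq (h : M.IsRun P T ηlam ηp lamG f θ₁ θ x ε) (hM : M.IsRegular)
    (hf : M.IsArgmaxOracle f) {t : ℕ} (ht : t ∈ Finset.Icc 1 T) : ∫ ω, ε t ω ^ 2 ∂P = 1 := by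
  have h1 : Var[fun y => y; gaussianReal 0 1] = 1 := by
    rw [variance_fun_id_gaussianReal]; rfl
  rw [variance_of_integral_eq_zero (by fun_prop) integral_id_gaussianReal,
    ← h.map_noise hM hf ht, integral_map (h.measurable_noise t ht).aemeasurable
    (by fun_prop)] at h1
  exact h1

/-- The noise is centred given the history together with the current arm; the tower property then
removes the arm. -/
lemma condExp_arm_mul_noise (h : M.IsRun P T ηlam ηp lamG f θ₁ θ x ε) (hM : M.IsRegular)
    (hf : M.IsArgmaxOracle f) {t : ℕ} (ht : t ∈ Finset.Icc 1 T) (a : M.X) :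
    P[fun ω => Set.indicator {ω | x t ω = a} (fun _ => (1 : ℝ)) ω * ε t ω | M.history θ x ε t]
      =ᵐ[P] 0 := by
  have hle := h.history_le_of_mem ht
  have hle' := sup_le hle (h.measurable_arm t ht).comap_le
  have hi : Integrable (ε t) P := (h.memLp_noise hM hf ht).integrable (by norm_num)
  have h1 : P[ε t | M.history θ x ε t ⊔ MeasurableSpace.comap (x t) inferInstance] =ᵐ[P]
      fun _ => 0 := by
    have := condExp_indep_eq (h.measurable_noise t ht).comap_le hle'
      (comap_measurable (ε t)).stronglyMeasurable (h.indep_noise hM hf ht).symm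
    simpa only [h.integral_noise hM hf ht] using this
  have hB : MeasurableSet[M.history θ x ε t ⊔ MeasurableSpace.comap (x t) inferInstance]
      {ω | x t ω = a} :=
    le_sup_right (a := M.history θ x ε t) _ ⟨{a}, measurableSet_singleton a, rfl⟩
  have h2 := condExp_stronglyMeasurable_mul_of_bound hle'
    (stronglyMeasurable_const.indicator (f := fun _ : Ω => (1 : ℝ)) hB) hi 1 (ae_of_all _ fun ω => by
      by_cases hω : x t ω = a <;> simp [Set.indicator, hω])
  have h3 : P[fun ω => Set.indicator {ω | x t ω = a} (fun _ => (1 : ℝ)) ω * ε t ω |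
      M.history θ x ε t ⊔ MeasurableSpace.comap (x t) inferInstance] =ᵐ[P] 0 := by
    refine h2.trans ?_
    filter_upwards [h1] with ω hω
    rw [Pi.mul_apply, hω, mul_zero, Pi.zero_apply]
  refine (condExp_condExp_of_le (m₁ := M.history θ x ε t) le_sup_left hle').symm.trans ?_
  refine (condExp_congr_ae h3).trans ?_
  rw [condExp_zero]

/-- The compensated loss of the sampling distribution: its loss on the observed arm minus the
averaged loss of the sampled parameter. -/
def lossGap (P : Measure Ω) (ηlam : ℝ) (lamG : M.X → ℝ) (θ₁ : Fin d → ℝ) (θ : ℕ → Ω → Fin d → ℝ)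
    (x : ℕ → Ω → M.X) (ε : ℕ → Ω → ℝ) (t : ℕ) (a : M.X) (ω : Ω) : ℝ :=
  (P[fun ω => M.armLoss (θ t ω) a | M.history θ x ε t]) ω
      * Set.indicator {ω | x t ω = a} (fun _ => (1 : ℝ)) ω
    - (P[fun ω => (a : Fin d → ℝ) ⬝ᵥ (θ t ω - M.θs) | M.history θ x ε t]) ω
      * (Set.indicator {ω | x t ω = a} (fun _ => (1 : ℝ)) ω * ε t ω)
    - M.armLaw ηlam lamG θ₁ (fun s => θ s ω) (fun s => x s ω) (fun s => ε s ω) t a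
      * M.armLoss (θ t ω) a

section Gap

variable {D : ℝ}

lemma armLoss_le {ϑ : Fin d → ℝ} {a : M.X} (h : |(a : Fin d → ℝ) ⬝ᵥ (ϑ - M.θs)| ≤ D) :
    M.armLoss ϑ a ≤ D ^ 2 := by
  have : ((a : Fin d → ℝ) ⬝ᵥ (ϑ - M.θs)) ^ 2 ≤ D ^ 2 := by rw [← sq_abs]; gcongr
  unfold armLoss; nlinarith [sq_nonneg D]

lemma ae_abs_le (h : M.IsRun P T ηlam ηp lamG f θ₁ θ x ε) (hM : M.IsRegular)
    (hf : M.IsArgmaxOracle f) (hG : lamG ∈ stdSimplex ℝ M.X)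
    (hD : ∀ ϑ ∈ M.Θ, ∀ a : M.X, |(a : Fin d → ℝ) ⬝ᵥ (ϑ - M.θs)| ≤ D)
    {t : ℕ} (ht : t ∈ Finset.Icc 1 T) (a : M.X) :
    ∀ᵐ ω ∂P, |(a : Fin d → ℝ) ⬝ᵥ (θ t ω - M.θs)| ≤ D := by
  filter_upwards [h.param_mem_alt hM hf hG ht] with ω hω
  exact hD _ (alt_subset _ hω) a

lemma integrable_armLoss (h : M.IsRun P T ηlam ηp lamG f θ₁ θ x ε) (hM : M.IsRegular)
    (hf : M.IsArgmaxOracle f) (hG : lamG ∈ stdSimplex ℝ M.X)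
    (hD : ∀ ϑ ∈ M.Θ, ∀ a : M.X, |(a : Fin d → ℝ) ⬝ᵥ (ϑ - M.θs)| ≤ D)
    {t : ℕ} (ht : t ∈ Finset.Icc 1 T) (a : M.X) : Integrable (fun ω => M.armLoss (θ t ω) a) P := by
  refine Integrable.of_bound ((continuous_armLoss a).measurable.comp
    (h.measurable_param t ht)).aestronglyMeasurable (D ^ 2) ?_
  filter_upwards [h.ae_abs_le hM hf hG hD ht a] with ω hω
  rw [Real.norm_of_nonneg (armLoss_nonneg _ _)]
  exact armLoss_le hω

lemma continuous_dotProduct_sub (a v : Fin d → ℝ) : Continuous fun ϑ : Fin d → ℝ => a ⬝ᵥ (ϑ - v) := by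
  simp only [dotProduct]; fun_prop

lemma integrable_dotProduct (h : M.IsRun P T ηlam ηp lamG f θ₁ θ x ε) (hM : M.IsRegular)
    (hf : M.IsArgmaxOracle f) (hG : lamG ∈ stdSimplex ℝ M.X)
    (hD : ∀ ϑ ∈ M.Θ, ∀ a : M.X, |(a : Fin d → ℝ) ⬝ᵥ (ϑ - M.θs)| ≤ D)
    {t : ℕ} (ht : t ∈ Finset.Icc 1 T) (a : M.X) :
    Integrable (fun ω => (a : Fin d → ℝ) ⬝ᵥ (θ t ω - M.θs)) P :=
  Integrable.of_bound ((continuous_dotProduct_sub _ _).measurable.comp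
    (h.measurable_param t ht)).aestronglyMeasurable D (h.ae_abs_le hM hf hG hD ht a)

/-- Each term of the gap is a history-measurable factor times one fresh quantity. The first and the
last term have the same conditional mean, `armLaw` times the conditional mean loss, and the noise
term has conditional mean zero. The bound leaves `|ε t|` in place, since the noise is only square
integrable, not bounded. -/
lemma condExp_lossGap (h : M.IsRun P T ηlam ηp lamG f θ₁ θ x ε) (hM : M.IsRegular)
    (hf : M.IsArgmaxOracle f) (hG : lamG ∈ stdSimplex ℝ M.X) (hD0 : 0 ≤ D)
    (hD : ∀ ϑ ∈ M.Θ, ∀ a : M.X, |(a : Fin d → ℝ) ⬝ᵥ (ϑ - M.θs)| ≤ D)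
    {t : ℕ} (ht : t ∈ Finset.Icc 1 T) (a : M.X) :
    P[lossGap P ηlam lamG θ₁ θ x ε t a | M.history θ x ε t] =ᵐ[P] 0 ∧
      ∀ᵐ ω ∂P, |lossGap P ηlam lamG θ₁ θ x ε t a ω| ≤ 2 * D ^ 2 + D * |ε t ω| := by
  have := hM.nonempty_arms
  have hle := h.history_le_of_mem ht
  have hloss := h.integrable_armLoss hM hf hG hD ht a
  have hdot := h.integrable_dotProduct hM hf hG hD ht a
  have hx : MeasurableSet {ω | x t ω = a} := h.measurable_arm t ht (measurableSet_singleton a)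
  have hI1 : ∀ ω, |Set.indicator {ω | x t ω = a} (fun _ => (1 : ℝ)) ω| ≤ 1 := fun ω => by
    by_cases hω : x t ω = a <;> simp [Set.indicator, hω]
  have hIi : Integrable (Set.indicator {ω | x t ω = a} (fun _ => (1 : ℝ))) P :=
    integrable_indicator_one hx
  have hεi : Integrable (ε t) P := (h.memLp_noise hM hf ht).integrable (by norm_num)
  have hIεi : Integrable (fun ω => Set.indicator {ω | x t ω = a} (fun _ => (1 : ℝ)) ω * ε t ω) P :=
    hεi.bdd_mul hIi.aestronglyMeasurable (ae_of_all _ hI1)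
  have hA0 : ∀ ω, |M.armLaw ηlam lamG θ₁ (fun s => θ s ω) (fun s => x s ω) (fun s => ε s ω) t a|
      ≤ 1 := fun ω => by
    rw [abs_of_nonneg (armLaw_nonneg hG (Finset.mem_Icc.1 ht).1 a)]
    exact armLaw_le_one hG (Finset.mem_Icc.1 ht).1 a
  have hAm := (measurable_armLaw_history (M := M) (θ := θ) (x := x) (ε := ε) ηlam lamG θ₁ t
    a).stronglyMeasurable
  have hq : ∀ᵐ ω ∂P, |(P[fun ω => M.armLoss (θ t ω) a | M.history θ x ε t]) ω| ≤ D ^ 2 := by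
    refine ae_bdd_abs_condExp_of_ae_bdd_abs ?_
    filter_upwards [h.ae_abs_le hM hf hG hD ht a] with ω hω
    rw [abs_of_nonneg (armLoss_nonneg _ _)]
    exact armLoss_le hω
  have hm : ∀ᵐ ω ∂P, |(P[fun ω => (a : Fin d → ℝ) ⬝ᵥ (θ t ω - M.θs) | M.history θ x ε t]) ω| ≤ D :=
    ae_bdd_abs_condExp_of_ae_bdd_abs (h.ae_abs_le hM hf hG hD ht a)
  constructor
  · have hqm := stronglyMeasurable_condExp (μ := P) (m := M.history θ x ε t)
      (f := fun ω => M.armLoss (θ t ω) a)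
    have hmm := stronglyMeasurable_condExp (μ := P) (m := M.history θ x ε t)
      (f := fun ω => (a : Fin d → ℝ) ⬝ᵥ (θ t ω - M.θs))
    have e1 := condExp_stronglyMeasurable_mul_of_bound hle hqm hIi _ hq
    have e2 := condExp_stronglyMeasurable_mul_of_bound hle hmm hIεi _ hm
    have e3 := condExp_stronglyMeasurable_mul_of_bound hle hAm hloss 1 (ae_of_all _ hA0)
    have i1 := hIi.bdd_mul (hqm.mono hle).aestronglyMeasurable hq
    have i2 := hIεi.bdd_mul (hmm.mono hle).aestronglyMeasurable hm
    have i3 := hloss.bdd_mul (hAm.mono hle).aestronglyMeasurable (ae_of_all _ hA0)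
    have e4 := condExp_sub (i1.sub i2) i3 (M.history θ x ε t)
    have e5 := condExp_sub i1 i2 (M.history θ x ε t)
    refine e4.trans ?_
    filter_upwards [e1, e2, e3, e5, h.condExp_arm hM hf ht a, h.condExp_arm_mul_noise hM hf ht a]
      with ω h1 h2 h3 h5 h6 h7
    rw [Pi.sub_apply, h5, Pi.sub_apply]
    rw [Pi.mul_apply, h6] at h1
    rw [Pi.mul_apply, h7, Pi.zero_apply, mul_zero] at h2
    rw [Pi.mul_apply] at h3
    refine (congrArg₂ (· - ·) (congrArg₂ (· - ·) h1 h2) h3).trans ?_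
    simp only [Pi.zero_apply]
    ring
  · filter_upwards [hq, hm, h.ae_abs_le hM hf hG hD ht a] with ω h1 h2 h3
    have h4 : |M.armLoss (θ t ω) a| ≤ D ^ 2 := by
      rw [abs_of_nonneg (armLoss_nonneg _ _)]; exact armLoss_le h3
    have b1 : |(P[fun ω => M.armLoss (θ t ω) a | M.history θ x ε t]) ω
      * Set.indicator {ω | x t ω = a} (fun _ => (1 : ℝ)) ω| ≤ D ^ 2 * 1 := by
      rw [abs_mul]; exact mul_le_mul h1 (hI1 ω) (abs_nonneg _) (sq_nonneg D)
    have b2 : |(P[fun ω => (a : Fin d → ℝ) ⬝ᵥ (θ t ω - M.θs) | M.history θ x ε t]) ω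
      * (Set.indicator {ω | x t ω = a} (fun _ => (1 : ℝ)) ω * ε t ω)| ≤ D * (1 * |ε t ω|) := by
      rw [abs_mul, abs_mul]
      exact mul_le_mul h2 (mul_le_mul_of_nonneg_right (hI1 ω) (abs_nonneg _)) (by positivity) hD0
    have b3 : |M.armLaw ηlam lamG θ₁ (fun s => θ s ω) (fun s => x s ω) (fun s => ε s ω) t a
      * M.armLoss (θ t ω) a| ≤ 1 * D ^ 2 := by
      rw [abs_mul]; exact mul_le_mul (hA0 ω) h4 (abs_nonneg _) zero_le_one
    unfold lossGap
    refine (abs_sub _ _).trans ?_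
    refine (add_le_add (abs_sub _ _) le_rfl).trans ?_
    linarith

lemma stronglyMeasurable_lossGap {s t : ℕ} (hs : s ∈ Finset.Ico 1 t) (a : M.X) :
    StronglyMeasurable[M.history θ x ε t] (lossGap P ηlam lamG θ₁ θ x ε s a) := by
  have hle : M.history θ x ε s ≤ M.history θ x ε t := history_mono (Finset.mem_Ico.1 hs).2.le
  have hI : StronglyMeasurable[M.history θ x ε t]
      (Set.indicator {ω | x s ω = a} (fun _ => (1 : ℝ))) :=
    stronglyMeasurable_const.indicator (measurable_arm_history hs (measurableSet_singleton a))
  have hε : StronglyMeasurable[M.history θ x ε t] (ε s) :=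
    (measurable_noise_history hs).stronglyMeasurable
  have hl : StronglyMeasurable[M.history θ x ε t] fun ω => M.armLoss (θ s ω) a :=
    ((continuous_armLoss a).measurable.comp (measurable_param_history hs)).stronglyMeasurable
  exact (((stronglyMeasurable_condExp.mono hle).mul hI).sub
    ((stronglyMeasurable_condExp.mono hle).mul (hI.mul hε))).sub
    (((measurable_armLaw_history ηlam lamG θ₁ s a).stronglyMeasurable.mono hle).mul hl)

/-- Summed over the arms, the indicators select the arm played. The gap thus compares the loss the
parameter player suffers at the observation (averaged over parameters) with the loss the arm player
collects (averaged over arms). -/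
lemma ae_sum_lossGap_eq (h : M.IsRun P T ηlam ηp lamG f θ₁ θ x ε) (hM : M.IsRegular)
    (hf : M.IsArgmaxOracle f) (hG : lamG ∈ stdSimplex ℝ M.X)
    (hD : ∀ ϑ ∈ M.Θ, ∀ a : M.X, |(a : Fin d → ℝ) ⬝ᵥ (ϑ - M.θs)| ≤ D)
    {t : ℕ} (ht : t ∈ Finset.Icc 1 T) :
    ∀ᵐ ω ∂P, ∑ a : M.X, lossGap P ηlam lamG θ₁ θ x ε t a ω =
      ∫ ϑ, M.noisyLoss (x t ω) (ε t ω) ϑ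
          ∂(M.paramLaw ηp f θ₁ (fun s => x s ω) (fun s => ε s ω) t)
        - ∑ a : M.X, M.armLaw ηlam lamG θ₁ (fun s => θ s ω) (fun s => x s ω) (fun s => ε s ω) t a
          * M.armLoss (θ t ω) a := by
  have h1 := fun a => h.condExp_param_integral hM hf hG ht (continuous_armLoss a).stronglyMeasurable
    (h.integrable_armLoss hM hf hG hD ht a)
  have h2 := fun a : M.X => h.condExp_param_integral hM hf hG ht
    (continuous_dotProduct_sub a M.θs).stronglyMeasurable
    (h.integrable_dotProduct hM hf hG hD ht a)
  filter_upwards [ae_all_iff.2 h1, ae_all_iff.2 h2] with ω hω1 hω2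
  simp only [lossGap, hω1, hω2, Finset.sum_sub_distrib]
  congr 1
  simp only [Set.indicator, Set.mem_ofPred_eq, mul_ite, ite_mul, mul_one, mul_zero, one_mul, zero_mul,
    Finset.sum_ite_eq, Finset.mem_univ, if_true]
  simp only [noisyLoss]
  rw [integral_sub (integrable_paramLaw hM hf _ _ _ _ _ (continuous_armLoss _))
    ((integrable_paramLaw hM hf _ _ _ _ _ (continuous_dotProduct_sub _ _)).const_mul _),
    integral_const_mul, mul_comm (ε t ω)]

/-- The compensated losses form a martingale, whose second moment grows linearly. -/
lemma measure_sum_lossGap_le (h : M.IsRun P T ηlam ηp lamG f θ₁ θ x ε) (hM : M.IsRegular)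
    (hf : M.IsArgmaxOracle f) (hG : lamG ∈ stdSimplex ℝ M.X) (hD0 : 0 ≤ D)
    (hD : ∀ ϑ ∈ M.Θ, ∀ a : M.X, |(a : Fin d → ℝ) ⬝ᵥ (ϑ - M.θs)| ≤ D) {u : ℝ} (hu : 0 < u) :
    P {ω | u < |∑ t ∈ Finset.Icc 1 T, ∑ a : M.X, lossGap P ηlam lamG θ₁ θ x ε t a ω|} ≤
      ENNReal.ofReal (T * (2 * M.X.card ^ 2 * (4 * D ^ 4 + D ^ 2)) / u ^ 2) := by
  -- A bound on the second moment of one increment: it is at most `card * (2 D² + D |ε|)`, `(u + v)²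
  -- ≤ 2 (u² + v²)`, and `ε` has second moment `1`.
  set K : ℝ := 2 * M.X.card ^ 2 * (4 * D ^ 4 + D ^ 2)
  set g : ℕ → Ω → ℝ := fun t ω => ∑ a : M.X, lossGap P ηlam lamG θ₁ θ x ε t a ω with hg
  have hbound : ∀ t ∈ Finset.Icc 1 T, ∀ᵐ ω ∂P,
      |g t ω| ≤ M.X.card * (2 * D ^ 2 + D * |ε t ω|) := by
    intro t ht
    filter_upwards [ae_all_iff.2 fun a => (h.condExp_lossGap hM hf hG hD0 hD ht a).2] with ω hω
    refine (Finset.abs_sum_le_sum_abs _ _).trans ((Finset.sum_le_sum fun a _ => hω a).trans ?_)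
    simp only [Finset.sum_const, Finset.card_univ, Fintype.card_coe, nsmul_eq_mul, le_refl]
  have hmeas : ∀ t ∈ Finset.Icc 1 T, AEStronglyMeasurable (g t) P := by
    intro t ht
    refine Finset.aestronglyMeasurable_fun_sum _ fun a _ => ?_
    exact ((stronglyMeasurable_lossGap (t := t + 1) (Finset.mem_Ico.2
      ⟨(Finset.mem_Icc.1 ht).1, Nat.lt_succ_self t⟩) a).mono
      (h.history_le (Nat.succ_le_succ (Finset.mem_Icc.1 ht).2))).aestronglyMeasurable
  have hL : ∀ t ∈ Finset.Icc 1 T, MemLp (g t) 2 P := by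
    intro t ht
    have h1 : MemLp (fun ω => D * |ε t ω|) 2 P := (h.memLp_noise hM hf ht).norm.const_mul D
    have h2 : MemLp (fun _ : Ω => 2 * D ^ 2) 2 P := memLp_const _
    exact ((h2.add h1).const_mul (M.X.card : ℝ)).mono' (hmeas t ht) (hbound t ht)
  have hC : ∀ t ∈ Finset.Icc 1 T, ∫ ω, g t ω ^ 2 ∂P ≤ K := by
    intro t ht
    have hi := (h.memLp_noise hM hf ht).integrable_sq
    have h1 : ∫ ω, g t ω ^ 2 ∂P ≤
        ∫ ω, 2 * (M.X.card : ℝ) ^ 2 * (4 * D ^ 4 + D ^ 2 * ε t ω ^ 2) ∂P := by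
      refine integral_mono_ae (hL t ht).integrable_sq
        (((integrable_const _).add (hi.const_mul _)).const_mul _) ?_
      filter_upwards [hbound t ht] with ω hω
      have h2 : g t ω ^ 2 ≤ (M.X.card * (2 * D ^ 2 + D * |ε t ω|)) ^ 2 := by
        rw [← sq_abs]; gcongr
      refine h2.trans ?_
      have h3 : (2 * D ^ 2 + D * |ε t ω|) ^ 2 ≤ 2 * (4 * D ^ 4 + D ^ 2 * ε t ω ^ 2) := by
        have := sq_abs (ε t ω)
        nlinarith [sq_nonneg (2 * D ^ 2 - D * |ε t ω|)]
      rw [mul_pow]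
      calc _ ≤ (M.X.card : ℝ) ^ 2 * (2 * (4 * D ^ 4 + D ^ 2 * ε t ω ^ 2)) := by gcongr
        _ = _ := by ring
    refine h1.trans (le_of_eq ?_)
    rw [integral_const_mul, integral_add (integrable_const _) (hi.const_mul _),
      integral_const_mul (D ^ 2), h.integral_noise_sq hM hf ht]
    simp [K]
  have h0 : ∀ t ∈ Finset.Icc 1 T, P[g t | M.history θ x ε t] =ᵐ[P] 0 := by
    intro t ht
    have hgt : g t = ∑ a : M.X, lossGap P ηlam lamG θ₁ θ x ε t a := by
      ext ω; simp [hg]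
    rw [hgt]
    have hint : ∀ a ∈ Finset.univ, Integrable (lossGap P ηlam lamG θ₁ θ x ε t a) P := by
      intro a _
      have hi : Integrable (ε t) P := (h.memLp_noise hM hf ht).integrable (by norm_num)
      refine Integrable.mono' ((integrable_const (2 * D ^ 2)).add (hi.norm.const_mul D)) ?_
        (h.condExp_lossGap hM hf hG hD0 hD ht a).2
      exact ((stronglyMeasurable_lossGap (t := t + 1) (Finset.mem_Ico.2
        ⟨(Finset.mem_Icc.1 ht).1, Nat.lt_succ_self t⟩) a).mono
        (h.history_le (Nat.succ_le_succ (Finset.mem_Icc.1 ht).2))).aestronglyMeasurable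
    refine (condExp_finsetSum hint _).trans ?_
    filter_upwards [ae_all_iff.2 fun a => (h.condExp_lossGap hM hf hG hD0 hD ht a).1] with ω hω
    rw [Finset.sum_apply]
    simp [hω]
  obtain ⟨h1, h2⟩ := memLp_and_integral_sq_sum_le (H := fun t => M.history θ x ε t)
    (fun t ht => h.history_le_of_mem ht)
    (fun t _ s hs => Finset.stronglyMeasurable_fun_sum _ fun a _ => stronglyMeasurable_lossGap hs a)
    hL hC h0 le_rfl
  have h3 := mul_meas_ge_le_integral_of_nonneg (ae_of_all _ fun ω => sq_nonneg _) h1.integrable_sq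
    (u ^ 2)
  have hu2 : 0 < u ^ 2 := by positivity
  have h4 : P.real {ω | u < |∑ t ∈ Finset.Icc 1 T, g t ω|} ≤ T * K / u ^ 2 := by
    rw [le_div_iff₀ hu2, mul_comm]
    refine (mul_le_mul_of_nonneg_left (measureReal_mono fun ω hω => ?_) hu2.le).trans (h3.trans h2)
    have hω' : u < |∑ t ∈ Finset.Icc 1 T, g t ω| := hω
    change u ^ 2 ≤ (∑ t ∈ Finset.Icc 1 T, g t ω) ^ 2
    rw [← sq_abs (∑ t ∈ Finset.Icc 1 T, g t ω)]
    gcongr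
  rw [← ofReal_measureReal]
  exact ENNReal.ofReal_le_ofReal h4

end Gap

end IsRun

/-! ### Typical epochs: tail bounds and Borel–Cantelli. -/

/-- The almost sure behaviour of epoch `ℓ` for large `ℓ`. -/
structure IsTypical (M : Bandit d) (ℓ : ℕ) (ηlam ηp : ℝ) (lamG : M.X → ℝ)
    (f : (Fin d → ℝ) → Fin d → ℝ) (θ₁ : Fin d → ℝ) (θ : ℕ → Fin d → ℝ) (x : ℕ → M.X)
    (ε : ℕ → ℝ) : Prop where
  abs_armNoise_le : ∀ t ∈ Finset.Icc 1 (horizon ℓ), ∀ a, |M.armNoise x ε t a| ≤ 2 * ℓ * √t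
  abs_noise_le : ∀ t ∈ Finset.Icc 1 (horizon ℓ), |ε t| ≤ 2 * ℓ
  le_armCount : ∀ t ∈ Finset.Icc 1 (horizon ℓ), ℓ ^ 8 ≤ t → ∀ a,
    lamG a / 4 * (√t * ℓ ^ 2) ≤ M.armCount x t a
  param_mem : ∀ t ∈ Finset.Icc 1 (horizon ℓ), θ t ∈ M.alt (f (M.est θ₁ x ε (t - 1)))
  abs_gap_le : |∑ t ∈ Finset.Icc 1 (horizon ℓ),
    (∫ ϑ, M.noisyLoss (x t) (ε t) ϑ ∂(M.paramLaw ηp f θ₁ x ε t)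
      - ∑ a : M.X, M.armLaw ηlam lamG θ₁ θ x ε t a * M.armLoss (θ t) a)| ≤ horizon ℓ / (ℓ + 1)

lemma ae_eventually_notMem_of_summable {Ω : Type*} [MeasurableSpace Ω] {P : Measure Ω}
    {bad : ℕ → Set Ω} {u : ℕ → ℝ} (h : ∀ ℓ, P (bad ℓ) ≤ ENNReal.ofReal (u ℓ)) (hu : Summable u) :
    ∀ᵐ ω ∂P, ∀ᶠ ℓ in atTop, ω ∉ bad ℓ := by
  refine ae_eventually_notMem (ne_top_of_le_ne_top ?_ (ENNReal.tsum_le_tsum h))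
  exact hu.tsum_ofReal_ne_top

namespace IsRun

variable {Ω : Type*} [mΩ : MeasurableSpace Ω] {P : Measure Ω} [IsProbabilityMeasure P] {T : ℕ}
  {ηlam ηp : ℝ} {lamG : M.X → ℝ}
  {f : (Fin d → ℝ) → Fin d → ℝ} {θ₁ : Fin d → ℝ} {θ : ℕ → Ω → Fin d → ℝ} {x : ℕ → Ω → M.X}
  {ε : ℕ → Ω → ℝ}

lemma measure_biUnion_le {bad : ℕ → Set Ω} {c : ℝ}
    (h : ∀ t ∈ Finset.Icc 1 T, P (bad t) ≤ ENNReal.ofReal c) :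
    P (⋃ t ∈ Finset.Icc 1 T, bad t) ≤ ENNReal.ofReal (T * c) := by
  refine (measure_biUnion_finset_le _ _).trans ((Finset.sum_le_sum h).trans ?_)
  rw [Finset.sum_const, Nat.card_Icc, Nat.add_sub_cancel, nsmul_eq_mul,
    ENNReal.ofReal_mul (Nat.cast_nonneg _), ENNReal.ofReal_natCast]

/-- Markov at the fixed parameters `±1 / s`, not the optimal ones. With `k = ℓ` the tail `exp (-2
ℓ)` already beats a union bound over `2 ^ ℓ` rounds, because `exp 2 > 2`. -/
lemma measure_abs_gt_le {X : Ω → ℝ} (hX : Measurable X) {v s k : ℝ} (hs : 0 < s) (hvs : v ≤ s ^ 2)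
    (hexp : ∀ μ : ℝ, ∫⁻ ω, ENNReal.ofReal (Real.exp (μ * X ω)) ∂P ≤
      ENNReal.ofReal (Real.exp (v * (μ ^ 2 / 2)))) :
    P {ω | 2 * k * s < |X ω|} ≤ ENNReal.ofReal (2 * Real.exp (1 / 2 - 2 * k)) := by
  have hv : v * ((1 / s) ^ 2 / 2) ≤ 1 / 2 := by
    have : v * ((1 / s) ^ 2) ≤ 1 := by
      rw [div_pow, one_pow, mul_one_div, div_le_one (by positivity)]; exact hvs
    linarith
  have key : ∀ σ : ℝ, σ ^ 2 = 1 → P {ω | 2 * k ≤ (σ / s) * X ω} ≤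
      ENNReal.ofReal (Real.exp (1 / 2 - 2 * k)) := by
    intro σ hσ
    refine measure_le_of_lintegral_exp_le (hX.const_mul _) ((hexp (σ / s)).trans ?_)
    refine ENNReal.ofReal_le_ofReal (Real.exp_le_exp.2 ?_)
    rw [div_pow, hσ]; rwa [div_pow, one_pow] at hv
  have hsub : {ω | 2 * k * s < |X ω|} ⊆
      {ω | 2 * k ≤ (1 / s) * X ω} ∪ {ω | 2 * k ≤ (-1 / s) * X ω} := by
    intro ω hω
    have hω' : 2 * k * s < |X ω| := hω
    rcases lt_abs.1 hω' with h1 | h1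
    · left
      change 2 * k ≤ (1 / s) * X ω
      rw [one_div_mul_eq_div, le_div_iff₀ hs]; exact h1.le
    · right
      change 2 * k ≤ (-1 / s) * X ω
      rw [div_mul_eq_mul_div, le_div_iff₀ hs]; linarith
  refine (measure_mono hsub).trans ((measure_union_le _ _).trans ?_)
  refine (add_le_add (key 1 (by norm_num)) (key (-1) (by norm_num))).trans (le_of_eq ?_)
  rw [← ENNReal.ofReal_add (Real.exp_pos _).le (Real.exp_pos _).le]
  congr 1; ring

lemma measure_exists_armNoise_gt_le (h : M.IsRun P T ηlam ηp lamG f θ₁ θ x ε) (hM : M.IsRegular)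
    (hf : M.IsArgmaxOracle f) (a : M.X) (k : ℝ) :
    P (⋃ t ∈ Finset.Icc 1 T,
      {ω | 2 * k * √t < |M.armNoise (fun s => x s ω) (fun s => ε s ω) t a|}) ≤
      ENNReal.ofReal (T * (2 * Real.exp (1 / 2 - 2 * k))) := by
  refine measure_biUnion_le fun t ht => ?_
  have ht1 := Finset.mem_Icc.1 ht
  have hsub : ∀ s ∈ Finset.Icc 1 t, s ∈ Finset.Icc 1 T := fun s hs =>
    Finset.Icc_subset_Icc_right ht1.2 hs
  have htpos : (0 : ℝ) < t := by exact_mod_cast ht1.1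
  refine measure_abs_gt_le (v := t) (measurable_armNoise (fun s hs => h.measurable_arm s (hsub s hs))
    (fun s hs => h.measurable_noise s (hsub s hs)) a) (Real.sqrt_pos.2 htpos)
    (Real.sq_sqrt htpos.le).ge fun μ => h.lintegral_exp_armNoise_le hM hf a μ ht1.2

lemma measure_exists_noise_gt_le (h : M.IsRun P T ηlam ηp lamG f θ₁ θ x ε) (hM : M.IsRegular)
    (hf : M.IsArgmaxOracle f) (k : ℝ) :
    P (⋃ t ∈ Finset.Icc 1 T, {ω | 2 * k < |ε t ω|}) ≤
      ENNReal.ofReal (T * (2 * Real.exp (1 / 2 - 2 * k))) := by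
  refine measure_biUnion_le fun t ht => ?_
  have := measure_abs_gt_le (P := P) (k := k) (v := 1) (s := 1) (h.measurable_noise t ht) one_pos
    (by norm_num) fun μ => by rw [h.lintegral_exp_noise hM hf ht μ, one_mul]
  simpa only [mul_one] using this

/-- The sum is at least `t * t^(-1/4) = √t * t^(1/4)`, and `t ≥ ℓ ^ 8` turns the last factor into `ℓ
^ 2`. This surplus over `√t` is what lets the play counts dominate noise of size `ℓ √t`. -/
lemma le_sum_rate {t ℓ : ℕ} (ht : 1 ≤ t) (hℓ : ℓ ^ 8 ≤ t) :
    √t * (ℓ : ℝ) ^ 2 ≤ ∑ s ∈ Finset.Icc 1 t, (s : ℝ) ^ (-(1 / 4) : ℝ) := by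
  have htpos : (0 : ℝ) < t := by exact_mod_cast ht
  have h1 : ∑ _s ∈ Finset.Icc 1 t, (t : ℝ) ^ (-(1 / 4) : ℝ) ≤
      ∑ s ∈ Finset.Icc 1 t, (s : ℝ) ^ (-(1 / 4) : ℝ) := by
    refine Finset.sum_le_sum fun s hs => ?_
    have hs' := Finset.mem_Icc.1 hs
    exact Real.rpow_le_rpow_of_nonpos (by exact_mod_cast hs'.1) (by exact_mod_cast hs'.2)
      (by norm_num)
  refine le_trans ?_ h1
  rw [Finset.sum_const, Nat.card_Icc, Nat.add_sub_cancel, nsmul_eq_mul]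
  have h2 : (t : ℝ) * (t : ℝ) ^ (-(1 / 4) : ℝ) = √t * (t : ℝ) ^ (1 / 4 : ℝ) := by
    rw [Real.sqrt_eq_rpow, ← Real.rpow_add htpos]
    nth_rewrite 1 [← Real.rpow_one (t : ℝ)]
    rw [← Real.rpow_add htpos]
    norm_num
  rw [h2]
  refine mul_le_mul_of_nonneg_left ?_ (Real.sqrt_nonneg _)
  have h3 : ((ℓ : ℝ) ^ 8) ^ (1 / 4 : ℝ) ≤ (t : ℝ) ^ (1 / 4 : ℝ) :=
    Real.rpow_le_rpow (by positivity) (by exact_mod_cast hℓ) (by norm_num)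
  refine le_trans (le_of_eq ?_) h3
  rw [← Real.rpow_natCast, ← Real.rpow_natCast, ← Real.rpow_mul (Nat.cast_nonneg _)]
  norm_num

/-- The exponential moment has exponent `-½ lamG a √t ℓ²` and the threshold uses up half of it; the
remaining quarter is at least `lamG a / 4 * ℓ ^ 6`, again because `t ≥ ℓ ^ 8`. -/
lemma measure_exists_armCount_lt_le (h : M.IsRun P T ηlam ηp lamG f θ₁ θ x ε) (hM : M.IsRegular)
    (hf : M.IsArgmaxOracle f) (hG : lamG ∈ stdSimplex ℝ M.X) (a : M.X) (ℓ : ℕ) :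
    P (⋃ t ∈ Finset.Icc 1 T, {ω | ℓ ^ 8 ≤ t ∧
      M.armCount (fun s => x s ω) t a < lamG a / 4 * (√t * ℓ ^ 2)}) ≤
      ENNReal.ofReal (T * Real.exp (-(lamG a / 4 * ℓ ^ 6))) := by
  refine measure_biUnion_le fun t ht => ?_
  have ht1 := Finset.mem_Icc.1 ht
  by_cases hℓ : ℓ ^ 8 ≤ t
  swap
  · simp [hℓ]
  have hsub : ∀ s ∈ Finset.Icc 1 t, s ∈ Finset.Icc 1 T := fun s hs =>
    Finset.Icc_subset_Icc_right ht1.2 hs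
  have hNm : Measurable fun ω => M.armCount (fun s => x s ω) t a :=
    measurable_armCount (fun s hs => h.measurable_arm s (hsub s hs)) a
  have hsqrt : (ℓ : ℝ) ^ 4 ≤ √t := by
    refine Real.le_sqrt_of_sq_le ?_
    rw [← pow_mul]; exact_mod_cast hℓ
  have hexp : ∫⁻ ω, ENNReal.ofReal (Real.exp (-M.armCount (fun s => x s ω) t a)) ∂P ≤
      ENNReal.ofReal (Real.exp (-(1 / 2) * (lamG a * (√t * ℓ ^ 2)))) := by
    rw [← ofReal_integral_eq_lintegral_ofReal _ (ae_of_all _ fun ω => (Real.exp_pos _).le)]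
    · refine ENNReal.ofReal_le_ofReal ((h.integral_exp_neg_armCount_le hM hf a ht1.2).trans ?_)
      refine Real.exp_le_exp.2 ?_
      have := mul_le_mul_of_nonneg_left (le_sum_rate ht1.1 hℓ) (hG.1 a)
      linarith
    · refine Integrable.of_bound (Real.measurable_exp.comp hNm.neg).aestronglyMeasurable 1
        (ae_of_all _ fun ω => ?_)
      rw [Real.norm_of_nonneg (Real.exp_pos _).le]
      exact Real.exp_le_one_iff.2 (neg_nonpos.2 (armCount_nonneg _ _ _))
  have h1 := measure_le_of_lintegral_exp_le (u := -(lamG a / 4 * (√t * ℓ ^ 2))) hNm.neg hexp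
  refine (measure_mono ?_).trans (h1.trans (ENNReal.ofReal_le_ofReal (Real.exp_le_exp.2 ?_)))
  · rintro ω ⟨-, hω⟩
    exact neg_le_neg hω.le
  · have h2 : (ℓ : ℝ) ^ 6 ≤ √t * ℓ ^ 2 := by
      calc (ℓ : ℝ) ^ 6 = ℓ ^ 4 * ℓ ^ 2 := by ring
        _ ≤ _ := mul_le_mul_of_nonneg_right hsqrt (by positivity)
    have h3 := mul_le_mul_of_nonneg_left h2 (hG.1 a)
    linarith

end IsRun

lemma exists_abs_dotProduct_le (hM : M.IsRegular) : ∃ D : ℝ, 0 ≤ D ∧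
    ∀ ϑ ∈ M.Θ, ∀ a : M.X, |(a : Fin d → ℝ) ⬝ᵥ (ϑ - M.θs)| ≤ D := by
  have hK : IsCompact M.Θ := Metric.isCompact_of_isClosed_isBounded hM.isClosed hM.isBounded
  have hc : Continuous fun ϑ : Fin d → ℝ => ∑ a : M.X, |(a : Fin d → ℝ) ⬝ᵥ (ϑ - M.θs)| := by
    simp only [dotProduct]; fun_prop
  obtain ⟨C, hC⟩ := hK.exists_bound_of_continuousOn hc.continuousOn
  have h1 : ∀ ϑ ∈ M.Θ, ∀ a : M.X, |(a : Fin d → ℝ) ⬝ᵥ (ϑ - M.θs)| ≤ C := fun ϑ hϑ a =>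
    (Finset.single_le_sum (f := fun a : M.X => |(a : Fin d → ℝ) ⬝ᵥ (ϑ - M.θs)|)
      (fun b _ => abs_nonneg _) (Finset.mem_univ a)).trans ((le_abs_self _).trans (hC ϑ hϑ))
  exact ⟨C, (norm_nonneg _).trans (hC _ hM.param_mem), h1⟩

lemma summable_two_pow_mul_exp : Summable fun ℓ : ℕ =>
    ((horizon ℓ : ℕ) : ℝ) * (2 * Real.exp (1 / 2 - 2 * ℓ)) := by
  have h1 : 2 * Real.exp (-2) < 1 := by
    have h2 : (2 : ℝ) < Real.exp 2 := by
      have := Real.add_one_lt_exp (x := 2) (by norm_num)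
      linarith
    rw [Real.exp_neg, ← div_eq_mul_inv, div_lt_one (Real.exp_pos _)]
    exact h2
  refine ((summable_geometric_of_lt_one (by positivity) h1).mul_left
    (2 * Real.exp (1 / 2))).congr fun ℓ => ?_
  rw [mul_pow, ← Real.exp_nat_mul, horizon, sub_eq_add_neg, Real.exp_add]
  push_cast
  ring_nf

lemma summable_two_pow_mul_exp_pow {c : ℝ} (hc : 0 < c) : Summable fun ℓ : ℕ =>
    ((horizon ℓ : ℕ) : ℝ) * Real.exp (-(c * (ℓ : ℝ) ^ 6)) := by
  refine Summable.of_norm_bounded_eventually_nat summable_two_pow_mul_exp ?_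
  have h1 : ∀ᶠ ℓ : ℕ in atTop, 2 / c ≤ (ℓ : ℝ) := tendsto_natCast_atTop_atTop.eventually_ge_atTop _
  filter_upwards [h1, eventually_ge_atTop 1] with ℓ h2 h3
  rw [Real.norm_of_nonneg (by positivity)]
  refine mul_le_mul_of_nonneg_left ?_ (Nat.cast_nonneg _)
  have h4 : (1 : ℝ) ≤ ℓ := by exact_mod_cast h3
  have h5 : 2 ≤ c * ℓ := by rwa [div_le_iff₀' hc] at h2
  have h6 : (ℓ : ℝ) ≤ ℓ ^ 5 := le_self_pow₀ h4 (by norm_num)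
  have h7 : 2 * (ℓ : ℝ) ≤ c * ℓ ^ 6 := by
    calc 2 * (ℓ : ℝ) ≤ (c * ℓ) * ℓ ^ 5 := mul_le_mul h5 h6 (by positivity) (by positivity)
      _ = _ := by ring
  have h8 : Real.exp (-(c * (ℓ : ℝ) ^ 6)) ≤ Real.exp (1 / 2 - 2 * ℓ) :=
    Real.exp_le_exp.2 (by linarith)
  have := Real.exp_pos (1 / 2 - 2 * (ℓ : ℝ))
  linarith

lemma summable_sq_div_two_pow (K : ℝ) : Summable fun ℓ : ℕ =>
    ((horizon ℓ : ℕ) : ℝ) * K / ((horizon ℓ : ℝ) / (ℓ + 1)) ^ 2 := by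
  have h1 : Summable fun n : ℕ => ((n + 1 : ℕ) : ℝ) ^ 2 * (1 / 2 : ℝ) ^ (n + 1) :=
    (summable_nat_add_iff 1).2 (summable_pow_mul_geometric_of_norm_lt_one 2
      (r := (1 / 2 : ℝ)) (by norm_num))
  refine (h1.mul_left (2 * K)).congr fun ℓ => ?_
  have h2 : (2 : ℝ) ^ ℓ ≠ 0 := by positivity
  have h3 : (ℓ : ℝ) + 1 ≠ 0 := by positivity
  simp only [horizon]
  push_cast
  rw [pow_succ (1 / 2 : ℝ), div_pow, one_pow]
  field_simp

/-- Almost surely, all but finitely many epochs are typical. -/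
lemma IsDoublingRun.ae_eventually_isTypical {Ω : Type*} [MeasurableSpace Ω] {P : Measure Ω}
    [IsProbabilityMeasure P] {L B : ℝ} {lamG : M.X → ℝ} {f : (Fin d → ℝ) → Fin d → ℝ}
    {θ₁ : Fin d → ℝ} {θ : ℕ → ℕ → Ω → Fin d → ℝ} {x : ℕ → ℕ → Ω → M.X} {ε : ℕ → ℕ → Ω → ℝ}
    (h : M.IsDoublingRun P L B lamG f θ₁ θ x ε) (hM : M.IsRegular) (hf : M.IsArgmaxOracle f)
    (hG : lamG ∈ stdSimplex ℝ M.X) :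
    ∀ᵐ ω ∂P, ∀ᶠ ℓ in atTop, M.IsTypical ℓ (M.etaLam L B ℓ) (M.etaP L B ℓ) lamG f θ₁
      (fun t => θ ℓ t ω) (fun t => x ℓ t ω) (fun t => ε ℓ t ω) := by
  obtain ⟨D, hD0, hD⟩ := exists_abs_dotProduct_le hM
  have e1 := fun a : M.X => ae_eventually_notMem_of_summable (P := P)
    (fun ℓ => (h ℓ).measure_exists_armNoise_gt_le hM hf a ℓ) summable_two_pow_mul_exp
  have e2 := ae_eventually_notMem_of_summable (P := P)
    (fun ℓ => (h ℓ).measure_exists_noise_gt_le hM hf ℓ) summable_two_pow_mul_exp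
  -- Summability needs positive weight; for an arm with `lamG a = 0` the claimed lower bound on its
  -- count is zero.
  have e3 : ∀ a : M.X, 0 < lamG a → _ := fun a ha => ae_eventually_notMem_of_summable (P := P)
    (fun ℓ => (h ℓ).measure_exists_armCount_lt_le hM hf hG a ℓ)
    (summable_two_pow_mul_exp_pow (c := lamG a / 4) (by positivity))
  have e4 := ae_eventually_notMem_of_summable (P := P)
    (fun ℓ => (h ℓ).measure_sum_lossGap_le hM hf hG hD0 hD
      (u := (horizon ℓ : ℝ) / (ℓ + 1)) (by have : 0 < horizon ℓ := Nat.two_pow_pos ℓ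
                                           positivity))
    (summable_sq_div_two_pow _)
  have e5 : ∀ ℓ, ∀ t ∈ Finset.Icc 1 (horizon ℓ), _ := fun ℓ t ht =>
    (h ℓ).param_mem_alt hM hf hG ht
  have e6 : ∀ ℓ, ∀ t ∈ Finset.Icc 1 (horizon ℓ), _ := fun ℓ t ht =>
    (h ℓ).ae_sum_lossGap_eq hM hf hG hD ht
  have e5' := ae_all_iff.2 fun ℓ => (ae_ball_iff
    (S := (Finset.Icc 1 (horizon ℓ) : Set ℕ)) (Set.to_countable _)).2 (e5 ℓ)
  have e6' := ae_all_iff.2 fun ℓ => (ae_ball_iff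
    (S := (Finset.Icc 1 (horizon ℓ) : Set ℕ)) (Set.to_countable _)).2 (e6 ℓ)
  have e3' := ae_all_iff.2 fun a : M.X => eventually_imp_distrib_left.2 (e3 a)
  filter_upwards [ae_all_iff.2 e1, e2, e3', e4, e5', e6'] with ω h1 h2 h3 h4 h5 h6
  have h3'' : ∀ᶠ ℓ in atTop, ∀ a : M.X, 0 < lamG a → _ :=
    eventually_all.2 fun a => eventually_imp_distrib_left.2 (h3 a)
  filter_upwards [eventually_all.2 h1, h2, h3'', h4] with ℓ g1 g2 g3 g4
  refine ⟨fun t ht a => ?_, fun t ht => ?_, fun t ht htℓ a => ?_, fun t ht => h5 ℓ t ht, ?_⟩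
  · by_contra hc
    exact g1 a (Set.mem_biUnion (t := fun t : ℕ => {ω | 2 * (ℓ : ℝ) * √t <
      |M.armNoise (fun s => x ℓ s ω) (fun s => ε ℓ s ω) t a|}) ht (not_le.1 hc))
  · by_contra hc
    exact g2 (Set.mem_biUnion (t := fun t : ℕ => {ω | 2 * (ℓ : ℝ) < |ε ℓ t ω|}) ht (not_le.1 hc))
  · rcases (hG.1 a).eq_or_lt with ha | ha
    · rw [← ha]
      simpa using armCount_nonneg (M := M) (fun s => x ℓ s ω) t a
    · by_contra hc
      exact g3 a ha (Set.mem_biUnion (t := fun t : ℕ => {ω | ℓ ^ 8 ≤ t ∧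
        M.armCount (fun s => x ℓ s ω) t a < lamG a / 4 * (√t * ℓ ^ 2)}) ht ⟨htℓ, not_le.1 hc⟩)
  · have h7 := not_lt.1 g4
    rwa [Finset.sum_congr rfl fun t ht => h6 ℓ t ht] at h7

/-- A common bound for the bounded quantities of the problem. -/
structure IsBound (M : Bandit d) (θ₁ : Fin d → ℝ) (D : ℝ) : Prop where
  one_le : 1 ≤ D
  abs_arm_le : ∀ ϑ ∈ M.Θ, ∀ a : M.X, |(a : Fin d → ℝ) ⬝ᵥ (ϑ - M.θs)| ≤ D
  abs_self_le : ∀ ϑ ∈ M.Θ, |(ϑ - M.θs) ⬝ᵥ (ϑ - M.θs)| ≤ D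
  abs_cross_le : ∀ ϑ ∈ M.Θ, |(ϑ - M.θs) ⬝ᵥ M.θs| ≤ D
  sum_abs_le : ∀ a : M.X, ∑ i, |(a : Fin d → ℝ) i| ≤ D
  arm_self_le : ∀ a : M.X, (a : Fin d → ℝ) ⬝ᵥ (a : Fin d → ℝ) ≤ D
  abs_init_le : ∀ a : M.X, |(a : Fin d → ℝ) ⬝ᵥ (θ₁ - M.θs)| ≤ D
  param_self_le : M.θs ⬝ᵥ M.θs ≤ D

lemma exists_isBound (hM : M.IsRegular) (θ₁ : Fin d → ℝ) : ∃ D, M.IsBound θ₁ D := by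
  have hK : IsCompact M.Θ := Metric.isCompact_of_isClosed_isBounded hM.isClosed hM.isBounded
  have key : ∀ φ : (Fin d → ℝ) → ℝ, Continuous φ → ∀ᶠ D in atTop, ∀ ϑ ∈ M.Θ, |φ ϑ| ≤ D := by
    intro φ hφ
    obtain ⟨C, hC⟩ := hK.exists_bound_of_continuousOn hφ.continuousOn
    filter_upwards [eventually_ge_atTop C] with D hD ϑ hϑ
    exact (hC ϑ hϑ).trans hD
  obtain ⟨C, -, hC⟩ := exists_abs_dotProduct_le hM
  have h1 : ∀ᶠ D in atTop, ∀ a : M.X, ∑ i, |(a : Fin d → ℝ) i| ≤ D :=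
    eventually_all.2 fun a => eventually_ge_atTop _
  have h2 : ∀ᶠ D in atTop, ∀ a : M.X, (a : Fin d → ℝ) ⬝ᵥ (a : Fin d → ℝ) ≤ D :=
    eventually_all.2 fun a => eventually_ge_atTop _
  have h3 : ∀ᶠ D in atTop, ∀ a : M.X, |(a : Fin d → ℝ) ⬝ᵥ (θ₁ - M.θs)| ≤ D :=
    eventually_all.2 fun a => eventually_ge_atTop _
  have h4 := key (fun ϑ => (ϑ - M.θs) ⬝ᵥ (ϑ - M.θs)) (by simp only [dotProduct]; fun_prop)
  have h5 := key (fun ϑ => (ϑ - M.θs) ⬝ᵥ M.θs) (by simp only [dotProduct]; fun_prop)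
  obtain ⟨D, g0, g1, g2, g3, g4, g5, g6, g7⟩ := ((eventually_ge_atTop (1 : ℝ)).and
    ((eventually_ge_atTop C).and (h1.and (h2.and (h3.and (h4.and
      (h5.and (eventually_ge_atTop (M.θs ⬝ᵥ M.θs))))))))).exists
  exact ⟨D, g0, fun ϑ hϑ a => (hC ϑ hϑ a).trans g1, g5, g6, g2, g3, g4, g7⟩

/-! ### The G-optimal design controls all arms -/

lemma design_mulVec (w : M.X → ℝ) (v : Fin d → ℝ) :
    M.design w *ᵥ v = ∑ b : M.X, (w b * ((b : Fin d → ℝ) ⬝ᵥ v)) • (b : Fin d → ℝ) := by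
  simp only [design, sum_mulVec, smul_mulVec, vecMulVec_mulVec, op_smul_eq_smul, smul_smul]

/-- With positive weights the design maps the span of the arms into itself. It is injective there: a
kernel vector is orthogonal to all arms, hence to the span containing it. In finite dimension it is
then surjective. -/
lemma exists_design_mulVec_eq {w : M.X → ℝ} (hw : ∀ b, 0 < w b) (a : M.X) :
    ∃ u, M.design w *ᵥ u = a := by
  set W : Submodule ℝ (Fin d → ℝ) := Submodule.span ℝ (M.X : Set (Fin d → ℝ))
  have hmem : ∀ v, M.design w *ᵥ v ∈ W := fun v => by
    rw [design_mulVec]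
    exact W.sum_mem fun b _ => W.smul_mem _ (Submodule.subset_span b.2)
  let A : W →ₗ[ℝ] W := (Matrix.mulVecLin (M.design w)).restrict fun v _ => hmem v
  have hinj : Function.Injective A := by
    rw [← LinearMap.ker_eq_bot, LinearMap.ker_eq_bot']
    rintro ⟨v, hv⟩ h0
    have h1 : M.design w *ᵥ v = 0 := congrArg Subtype.val h0
    have h2 : sqNorm (M.design w) v = 0 := by simp [sqNorm, h1]
    rw [sqNorm_design, Finset.sum_eq_zero_iff_of_nonneg
      (fun b _ => mul_nonneg (hw b).le (sq_nonneg _))] at h2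
    have h3 : ∀ b ∈ M.X, b ⬝ᵥ v = 0 := by
      intro b hb
      have := h2 ⟨b, hb⟩ (Finset.mem_univ _)
      rcases mul_eq_zero.1 this with h | h
      · exact absurd h (hw _).ne'
      · exact pow_eq_zero_iff (two_ne_zero) |>.1 h
    have h4 : ∀ y ∈ W, y ⬝ᵥ v = 0 := by
      intro y hy
      induction hy using Submodule.span_induction with
      | mem y hy => exact h3 y hy
      | zero => exact zero_dotProduct _
      | add y z _ _ hy hz => rw [add_dotProduct, hy, hz, add_zero]
      | smul c y _ hy => rw [smul_dotProduct, hy, smul_zero]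
    exact Subtype.ext (dotProduct_self_eq_zero.1 (h4 v hv))
  obtain ⟨u, hu⟩ := (LinearMap.injective_iff_surjective.1 hinj) ⟨a, Submodule.subset_span a.2⟩
  exact ⟨u, congrArg Subtype.val hu⟩

/-- The uniform design has a finite objective, so the optimal one has too, and a finite value puts
every arm in the range. -/
lemma IsGOptimal.exists_mulVec_eq {lamG : M.X → ℝ} (hG : M.IsGOptimal lamG) (a : M.X) :
    ∃ u, M.design lamG *ᵥ u = a := by
  have hcard : 0 < (M.X.card : ℝ) := Nat.cast_pos.2 (Finset.card_pos.2 ⟨a.1, a.2⟩)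
  set w : M.X → ℝ := fun _ => 1 / (M.X.card : ℝ)
  have hw : w ∈ stdSimplex ℝ M.X := by
    refine ⟨fun b => by positivity, ?_⟩
    simp [w, hcard.ne']
  have hfin : (⨆ b : M.X, sqNormInv (M.design w) b) < ⊤ := by
    rw [← Finset.sup_univ_eq_iSup, Finset.sup_lt_iff ENNReal.zero_lt_top]
    intro b _
    obtain ⟨u, hu⟩ := exists_design_mulVec_eq (w := w) (fun _ => by positivity) b
    exact (iInf₂_le u hu).trans_lt ENNReal.ofReal_lt_top
  have h1 : sqNormInv (M.design lamG) a < ⊤ :=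
    (le_iSup (fun b : M.X => sqNormInv (M.design lamG) b) a).trans_lt ((hG.2 w hw).trans_lt hfin)
  by_contra hne
  push Not at hne
  refine h1.ne ?_
  simp only [sqNormInv, iInf_eq_top]
  exact fun u hu => absurd hu (hne u)

/-- Writing `a = A u`, this is the Cauchy–Schwarz inequality for the semi-inner product of `A =
M.design lamG`. Any finite constant is enough for the limit; the optimal value is not needed. -/
lemma IsGOptimal.exists_sq_le {lamG : M.X → ℝ} (hG : M.IsGOptimal lamG) :
    ∃ C : ℝ, 0 ≤ C ∧ ∀ (a : M.X) (v : Fin d → ℝ), ((a : Fin d → ℝ) ⬝ᵥ v) ^ 2 ≤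
      C * ∑ b : M.X, lamG b * ((b : Fin d → ℝ) ⬝ᵥ v) ^ 2 := by
  choose u hu using hG.exists_mulVec_eq
  have hnn : ∀ (v : Fin d → ℝ) (b : M.X), 0 ≤ lamG b * ((b : Fin d → ℝ) ⬝ᵥ v) ^ 2 := fun v b =>
    mul_nonneg (hG.1.1 b) (sq_nonneg _)
  refine ⟨∑ a : M.X, ∑ b : M.X, lamG b * ((b : Fin d → ℝ) ⬝ᵥ u a) ^ 2,
    Finset.sum_nonneg fun a _ => Finset.sum_nonneg fun b _ => hnn _ _, fun a v => ?_⟩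
  have h1 : (a : Fin d → ℝ) ⬝ᵥ v =
      ∑ b : M.X, lamG b * ((b : Fin d → ℝ) ⬝ᵥ u a) * ((b : Fin d → ℝ) ⬝ᵥ v) := by
    conv_lhs => rw [← hu a]
    rw [design_mulVec, sum_dotProduct]
    simp only [smul_dotProduct, smul_eq_mul]
  rw [h1]
  refine (Finset.sum_sq_le_sum_mul_sum_of_sq_le_mul _ (fun b _ => hnn (u a) b)
    (fun b _ => hnn v b) (fun b _ => le_of_eq (by ring))).trans ?_
  refine mul_le_mul_of_nonneg_right ?_ (Finset.sum_nonneg fun b _ => hnn v b)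
  exact Finset.single_le_sum (f := fun a : M.X =>
    ∑ b : M.X, lamG b * ((b : Fin d → ℝ) ⬝ᵥ u a) ^ 2)
    (fun a _ => Finset.sum_nonneg fun b _ => hnn _ _) (Finset.mem_univ a)

/-! ### Accuracy of the estimate -/

lemma abs_dotProduct_noise_le {x : ℕ → M.X} {ε : ℕ → ℝ} {n : ℕ} {v : Fin d → ℝ} {k m : ℝ}
    (hk : ∀ a, |M.armNoise x ε n a| ≤ k)
    (hv : ∀ a : M.X, |(a : Fin d → ℝ) ⬝ᵥ v| ≤ m) :
    |v ⬝ᵥ M.noise x ε n| ≤ M.X.card * (k * m) := by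
  rw [dotProduct_noise]
  refine (Finset.abs_sum_le_sum_abs _ _).trans ?_
  have : ∀ a ∈ (Finset.univ : Finset M.X),
      |M.armNoise x ε n a * ((a : Fin d → ℝ) ⬝ᵥ v)| ≤ k * m := fun a _ => by
    rw [abs_mul]
    exact mul_le_mul (hk a) (hv a) (abs_nonneg _) ((abs_nonneg _).trans (hk a))
  refine (Finset.sum_le_sum this).trans ?_
  simp

lemma sq_dotProduct_le (u v : Fin d → ℝ) : (u ⬝ᵥ v) ^ 2 ≤ (u ⬝ᵥ u) * (v ⬝ᵥ v) := by
  simp only [dotProduct]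
  refine (Finset.sum_mul_sq_le_sq_mul_sq _ _ _).trans (le_of_eq ?_)
  simp only [sq]

lemma dotProduct_self_nonneg (v : Fin d → ℝ) : 0 ≤ v ⬝ᵥ v :=
  Finset.sum_nonneg fun i _ => mul_self_nonneg (v i)

section Est

variable {θ₁ : Fin d → ℝ} {x : ℕ → M.X} {ε : ℕ → ℝ} {D k : ℝ} {n : ℕ}

lemma sqNorm_gram_est (hn : n ≠ 0) :
    sqNorm (M.gram x n) (M.est θ₁ x ε n - M.θs) =
      (M.est θ₁ x ε n - M.θs) ⬝ᵥ M.noise x ε n - (M.est θ₁ x ε n - M.θs) ⬝ᵥ M.θs := by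
  rw [sqNorm, gram_mulVec_est_sub θ₁ x ε hn, dotProduct_sub]

/-- With `v = θ̂ - θ*`, the ridge gives `v ⬝ᵥ v ≤ vᵀ V v = v ⬝ᵥ noise - v ⬝ᵥ θ*`; the right side is
linear in the length of `v`. This crude bound needs no lower bound on the play counts. -/
lemma sqrt_est_self_le (hD : M.IsBound θ₁ D) (hn : n ≠ 0) (hk0 : 0 ≤ k)
    (hk : ∀ a, |M.armNoise x ε n a| ≤ k) :
    √((M.est θ₁ x ε n - M.θs) ⬝ᵥ (M.est θ₁ x ε n - M.θs)) ≤ √D * (M.X.card * k + 1) := by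
  have h0 := sqNorm_gram_est (θ₁ := θ₁) (x := x) (ε := ε) hn
  rw [sqNorm_gram] at h0
  set v := M.est θ₁ x ε n - M.θs
  set s := v ⬝ᵥ v with hs
  have hs0 : 0 ≤ s := dotProduct_self_nonneg v
  have hD0 : 0 ≤ D := zero_le_one.trans hD.one_le
  have hsq : √s * √s = s := Real.mul_self_sqrt hs0
  have hdot : ∀ u : Fin d → ℝ, u ⬝ᵥ u ≤ D → |u ⬝ᵥ v| ≤ √D * √s := by
    intro u hu
    rw [← Real.sqrt_mul hD0, ← Real.sqrt_sq_eq_abs]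
    exact Real.sqrt_le_sqrt ((sq_dotProduct_le u v).trans (mul_le_mul_of_nonneg_right hu hs0))
  have h1 := (abs_le.1 (abs_dotProduct_noise_le (m := √D * √s) hk
    fun a => hdot a (hD.arm_self_le a))).2
  have h2 := (abs_le.1 (hdot M.θs hD.param_self_le)).1
  rw [dotProduct_comm] at h2
  have h3 : 0 ≤ ∑ r ∈ Finset.Icc 1 n, ((x r : Fin d → ℝ) ⬝ᵥ v) ^ 2 :=
    Finset.sum_nonneg fun _ _ => sq_nonneg _
  rcases (Real.sqrt_nonneg s).eq_or_lt with h4 | h4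
  · rw [← h4]; positivity
  · refine le_of_mul_le_mul_right ?_ h4
    rw [hsq]
    nlinarith

lemma abs_dotProduct_est_le (hD : M.IsBound θ₁ D) (hn : n ≠ 0) (hk0 : 0 ≤ k)
    (hk : ∀ a, |M.armNoise x ε n a| ≤ k) {u : Fin d → ℝ} (hu : u ⬝ᵥ u ≤ D) :
    |u ⬝ᵥ (M.est θ₁ x ε n - M.θs)| ≤ D * (M.X.card * k + 1) := by
  have hD0 : 0 ≤ D := zero_le_one.trans hD.one_le
  have h1 := sqrt_est_self_le (x := x) hD hn hk0 hk
  set v := M.est θ₁ x ε n - M.θs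
  have h2 : |u ⬝ᵥ v| ≤ √D * √(v ⬝ᵥ v) := by
    rw [← Real.sqrt_mul hD0, ← Real.sqrt_sq_eq_abs]
    exact Real.sqrt_le_sqrt ((sq_dotProduct_le u v).trans
      (mul_le_mul_of_nonneg_right hu (dotProduct_self_nonneg v)))
  calc _ ≤ √D * √(v ⬝ᵥ v) := h2
    _ ≤ √D * (√D * (M.X.card * k + 1)) := by gcongr
    _ = _ := by rw [← mul_assoc, Real.mul_self_sqrt hD0]

/-- If every arm has been played often in proportion to the design `lamG`, the estimate is accurate in
the direction of every arm. -/
lemma sq_dotProduct_est_le [Nonempty M.X] {lamG : M.X → ℝ} {C κ : ℝ} (hD : M.IsBound θ₁ D)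
    (hC : 0 ≤ C) (hGC : ∀ (a : M.X) (v : Fin d → ℝ), ((a : Fin d → ℝ) ⬝ᵥ v) ^ 2 ≤
      C * ∑ b : M.X, lamG b * ((b : Fin d → ℝ) ⬝ᵥ v) ^ 2)
    (hn : n ≠ 0) (hk0 : 0 ≤ k) (hk : ∀ a, |M.armNoise x ε n a| ≤ k) (hκ : 0 < κ)
    (hcount : ∀ a, κ * lamG a ≤ M.armCount x n a) {ρ : ℝ}
    (hρ : C * (D * (M.X.card * k + 1)) ≤ ρ * κ) (hρ1 : ρ ≤ 1) (a : M.X) :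
    ((a : Fin d → ℝ) ⬝ᵥ (M.est θ₁ x ε n - M.θs)) ^ 2 ≤ 3 * ρ := by
  have h0 := sqNorm_gram_est (θ₁ := θ₁) (x := x) (ε := ε) hn
  have h1 := fun u hu => abs_dotProduct_est_le (x := x) hD hn hk0 hk (u := u) hu
  rw [sqNorm_gram] at h0
  set v := M.est θ₁ x ε n - M.θs
  -- The largest error `m` over the arms satisfies a self-bounding inequality: `κ m²` is controlled
  -- through the design by the quadratic form, and that form through the noise by a bound affine in
  -- `m`.
  obtain ⟨b, hb⟩ := Finite.exists_max fun b : M.X => |(b : Fin d → ℝ) ⬝ᵥ v|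
  set m := |(b : Fin d → ℝ) ⬝ᵥ v| with hm
  have hm0 : 0 ≤ m := abs_nonneg _
  have h2 := (abs_le.1 (abs_dotProduct_noise_le (x := x) (ε := ε) hk hb)).2
  have h3 := (abs_le.1 (h1 M.θs hD.param_self_le)).1
  rw [dotProduct_comm] at h3
  have hD1 := hD.one_le
  have hcard : (0 : ℝ) ≤ M.X.card := Nat.cast_nonneg _
  have hNk : 0 ≤ (M.X.card : ℝ) * k := by positivity
  have h4 : ∑ r ∈ Finset.Icc 1 n, ((x r : Fin d → ℝ) ⬝ᵥ v) ^ 2 ≤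
      D * (M.X.card * k + 1) * (m + 1) := by
    have h5 := dotProduct_self_nonneg v
    have h6 : (M.X.card : ℝ) * (k * m) ≤ D * (M.X.card * k + 1) * m := by
      rw [← mul_assoc]
      refine mul_le_mul_of_nonneg_right ?_ hm0
      nlinarith
    linarith
  have h7 : κ * m ^ 2 ≤ ρ * κ * (m + 1) := by
    calc κ * m ^ 2 ≤ κ * (C * ∑ c : M.X, lamG c * ((c : Fin d → ℝ) ⬝ᵥ v) ^ 2) := by
          rw [hm, sq_abs]; gcongr; exact hGC b v
      _ = C * ∑ c : M.X, κ * lamG c * ((c : Fin d → ℝ) ⬝ᵥ v) ^ 2 := by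
          simp only [Finset.mul_sum]
          exact Finset.sum_congr rfl fun c _ => by ring
      _ ≤ C * ∑ c : M.X, M.armCount x n c * ((c : Fin d → ℝ) ⬝ᵥ v) ^ 2 := by
          gcongr with c _; exact hcount c
      _ ≤ C * (D * (M.X.card * k + 1) * (m + 1)) := by
          rw [sum_armCount_mul x n fun c => ((c : Fin d → ℝ) ⬝ᵥ v) ^ 2]
          gcongr
      _ = C * (D * (M.X.card * k + 1)) * (m + 1) := by ring
      _ ≤ _ := by gcongr
  have h8 : m ^ 2 ≤ ρ * (m + 1) := by
    refine le_of_mul_le_mul_left ?_ hκ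
    linarith
  -- As `ρ ≤ 1`, `m² ≤ m + 1` forces `m ≤ 2`; substituting this into `m² ≤ ρ (m + 1)` gives the
  -- factor `3`.
  have hm2 : m ≤ 2 := by nlinarith
  have hρ0 : 0 ≤ ρ := by
    by_contra hneg
    nlinarith
  have h9 : ((a : Fin d → ℝ) ⬝ᵥ v) ^ 2 ≤ m ^ 2 := by
    rw [← sq_abs]; gcongr; exact hb a
  nlinarith

end Est

/-! ### Identification of the best answer -/

lemma exists_abs_dotProduct_le_of_mem_span {z : Fin d → ℝ}
    (hz : z ∈ Submodule.span ℝ (M.X : Set (Fin d → ℝ))) :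
    ∃ C : ℝ, 0 ≤ C ∧ ∀ (v : Fin d → ℝ) (m : ℝ), 0 ≤ m →
      (∀ a : M.X, |(a : Fin d → ℝ) ⬝ᵥ v| ≤ m) → |z ⬝ᵥ v| ≤ C * m := by
  induction hz using Submodule.span_induction with
  | mem y hy => exact ⟨1, zero_le_one, fun v m _ h => by rw [one_mul]; exact h ⟨y, hy⟩⟩
  | zero => exact ⟨0, le_rfl, fun v m _ _ => by simp⟩
  | add y z _ _ hy hz =>
    obtain ⟨C, hC, h⟩ := hy
    obtain ⟨C', hC', h'⟩ := hz
    refine ⟨C + C', add_nonneg hC hC', fun v m hm hv => ?_⟩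
    rw [add_dotProduct, add_mul]
    exact (abs_add_le _ _).trans (add_le_add (h v m hm hv) (h' v m hm hv))
  | smul c y _ hy =>
    obtain ⟨C, hC, h⟩ := hy
    refine ⟨|c| * C, mul_nonneg (abs_nonneg c) hC, fun v m hm hv => ?_⟩
    rw [smul_dotProduct, smul_eq_mul, abs_mul, mul_assoc]
    exact mul_le_mul_of_nonneg_left (h v m hm hv) (abs_nonneg c)

/-- Differences of answers lie in the span of the arms, so small errors along the arms give small
errors in `(zs - z) ⬝ᵥ y`, and the strict gaps at `θs` survive for the finitely many answers. -/
lemma exists_argmax_eq (hM : M.IsRegular) {f : (Fin d → ℝ) → Fin d → ℝ} (hf : M.IsArgmaxOracle f) :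
    ∃ m : ℝ, 0 < m ∧ ∀ y : Fin d → ℝ, (∀ a : M.X, |(a : Fin d → ℝ) ⬝ᵥ (y - M.θs)| ≤ m) →
      f y = M.zs := by
  have key : ∀ z ∈ M.Z, ∀ᶠ m in 𝓝[>] (0 : ℝ), ∀ y : Fin d → ℝ,
      (∀ a : M.X, |(a : Fin d → ℝ) ⬝ᵥ (y - M.θs)| ≤ m) → z ≠ M.zs → z ⬝ᵥ y < M.zs ⬝ᵥ y := by
    intro z hz
    by_cases hne : z = M.zs
    · exact Eventually.of_forall fun m y _ h => absurd hne h
    have hgap := hM.unique z hz hne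
    have hmem : M.zs - z ∈ Submodule.span ℝ (M.X : Set (Fin d → ℝ)) :=
      Submodule.sub_mem _ (hM.span_le (Submodule.subset_span hM.best_mem))
        (hM.span_le (Submodule.subset_span hz))
    obtain ⟨C, hC, h⟩ := exists_abs_dotProduct_le_of_mem_span hmem
    have hlim : Tendsto (fun m : ℝ => C * m) (𝓝[>] 0) (𝓝 0) := by
      have : Tendsto (fun m : ℝ => C * m) (𝓝 0) (𝓝 (C * 0)) := tendsto_id.const_mul C
      rw [mul_zero] at this
      exact this.mono_left nhdsWithin_le_nhds
    filter_upwards [hlim.eventually_lt_const (sub_pos.2 hgap), self_mem_nhdsWithin] with m hm hm0 y hy _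
    have h1 := (abs_le.1 (h _ m (le_of_lt hm0) hy)).1
    simp only [sub_dotProduct, dotProduct_sub] at h1
    linarith
  have hall := (eventually_all_finset M.Z).2 key
  obtain ⟨m, h, hm⟩ := (hall.and self_mem_nhdsWithin).exists
  refine ⟨m, hm, fun y hy => ?_⟩
  by_contra hne
  have h1 := h _ (hf.2 y).1 y hy hne
  exact absurd ((hf.2 y).2 _ hM.best_mem) (not_le.2 h1)

/-! ### Regret of the two players. -/

/-- With a single arm the step size vanishes with `log card` and division by it is meaningless; but
all the weight then sits on that arm and there is no regret. -/
lemma hedge_regret_div [Nonempty M.X] {η G R : ℝ} {g : ℕ → M.X → ℝ} (T : ℕ)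
    (hη : 0 < η ∨ M.X.card = 1) (hη0 : 0 ≤ η) (hR : Real.log M.X.card / η ≤ R) (hR0 : 0 ≤ R)
    (hg0 : ∀ t ∈ Finset.Icc 1 T, ∀ a, 0 ≤ g t a) (hg : ∀ t ∈ Finset.Icc 1 T, ∀ a, g t a ≤ G)
    (hηG : η * G ≤ 1) (a : M.X) :
    ∑ t ∈ Finset.Icc 1 T, g t a ≤
      ∑ t ∈ Finset.Icc 1 T, ∑ b : M.X, M.hedge η g (t - 1) b * g t b + (T * (η * G ^ 2) + R) := by
  rcases hη with hη | hcard
  · have h1 := hedge_regret hη.le T hg0 hg hηG a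
    have h2 : Real.log M.X.card = η * (Real.log M.X.card / η) := by field_simp
    rw [h2] at h1
    have h3 : T * (η * G) ^ 2 = η * (T * (η * G ^ 2)) := by ring
    rw [h3, ← mul_add, ← mul_add] at h1
    have := le_of_mul_le_mul_left h1 hη
    linarith
  · have hsub : Subsingleton M.X := by
      rw [← Fintype.card_le_one_iff_subsingleton, Fintype.card_coe, hcard]
    have h1 : ∀ t, ∑ b : M.X, M.hedge η g (t - 1) b * g t b = g t a := by
      intro t
      have h2 := M.sum_hedge (η := η) (g := g) (t - 1)
      rw [Fintype.sum_subsingleton _ a] at h2 ⊢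
      rw [h2, one_mul]
    simp only [h1]
    have : 0 ≤ (T : ℝ) * (η * G ^ 2) := by positivity
    linarith

lemma sum_ite_le (T n : ℕ) :
    ∑ t ∈ Finset.Icc 1 T, (if t ≤ n then (1 : ℝ) else 0) ≤ n := by
  rw [← Finset.sum_filter, Finset.sum_const, nsmul_eq_mul, mul_one]
  have hsub : (Finset.Icc 1 T).filter (· ≤ n) ⊆ Finset.Icc 1 n := by
    intro t ht
    simp only [Finset.mem_filter, Finset.mem_Icc] at *
    omega
  have := Finset.card_le_card hsub
  rw [Nat.card_Icc, Nat.add_sub_cancel] at this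
  exact_mod_cast this

section Regret

variable {θ₁ : Fin d → ℝ} {θ : ℕ → Fin d → ℝ} {x : ℕ → M.X} {ε : ℕ → ℝ} {lamG : M.X → ℝ} {D : ℝ}

/-- The exponential weights over the arms play nearly as well as any fixed design `w`. -/
lemma mul_le_sum_armLaw_mul_armLoss [Nonempty M.X] (hD : M.IsBound θ₁ D)
    (hG : lamG ∈ stdSimplex ℝ M.X) {T n₀ : ℕ} {η E μ γ R : ℝ} (hE : D ≤ E) (hμ0 : 0 ≤ μ) (hμ1 : μ ≤ 1)
    (hη : 0 < η ∨ M.X.card = 1) (hη0 : 0 ≤ η) (hR : Real.log M.X.card / η ≤ R) (hR0 : 0 ≤ R)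
    (hηE : η * (4 * E ^ 2) ≤ 1) (hmem : ∀ t ∈ Finset.Icc 1 T, θ t ∈ M.Θ)
    (halt : ∀ t ∈ Finset.Icc 1 T, n₀ < t → θ t ∈ M.alt M.zs) (halt0 : (M.alt M.zs).Nonempty)
    (hcrude : ∀ t ∈ Finset.Icc 1 T, ∀ a : M.X,
      |(a : Fin d → ℝ) ⬝ᵥ (M.est θ₁ x ε (t - 1) - M.θs)| ≤ E)
    (hfine : ∀ t ∈ Finset.Icc 1 T, n₀ < t → ∀ a : M.X,
      |(a : Fin d → ℝ) ⬝ᵥ (M.est θ₁ x ε (t - 1) - M.θs)| ≤ μ)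
    (hγ : ∀ t, n₀ < t → (t : ℝ) ^ (-(1 / 4) : ℝ) ≤ γ)
    {w : M.X → ℝ} (hw : w ∈ stdSimplex ℝ M.X) {I : ℝ}
    (hI : ∀ ϑ ∈ M.alt M.zs, I ≤ ∑ a : M.X, w a * M.armLoss ϑ a) :
    T * I ≤ ∑ t ∈ Finset.Icc 1 T, ∑ a : M.X, M.armLaw η lamG θ₁ θ x ε t a * M.armLoss (θ t) a
      + (1 / 2) * (T * (η * (4 * E ^ 2) ^ 2) + R) + T * (3 * D * μ + γ * D ^ 2)
      + n₀ * (D ^ 2 + 4 * E ^ 2) := by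
  have hD1 := hD.one_le
  have hγ0 : 0 ≤ γ := (rate_nonneg (n₀ + 1)).trans (hγ (n₀ + 1) (Nat.lt_succ_self n₀))
  set g := M.gain θ₁ θ x ε with hg
  have hgdef : ∀ t a, g t a = ((a : Fin d → ℝ) ⬝ᵥ (θ t - M.θs)
      - (a : Fin d → ℝ) ⬝ᵥ (M.est θ₁ x ε (t - 1) - M.θs)) ^ 2 := by
    intro t a
    rw [hg, gain, ← dotProduct_sub]
    congr 2
    abel
  have hg0 : ∀ t a, 0 ≤ g t a := fun t a => by rw [hgdef]; positivity
  have hgE : ∀ t ∈ Finset.Icc 1 T, ∀ a, g t a ≤ 4 * E ^ 2 := by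
    intro t ht a
    have h1 := abs_le.1 (hD.abs_arm_le _ (hmem t ht) a)
    have h2 := abs_le.1 (hcrude t ht a)
    rw [hgdef]
    calc _ ≤ (2 * E) ^ 2 := sq_le_sq' (by linarith) (by linarith)
      _ = _ := by ring
  have hlossD : ∀ t ∈ Finset.Icc 1 T, ∀ a, M.armLoss (θ t) a ≤ D ^ 2 := fun t ht a =>
    IsRun.armLoss_le (hD.abs_arm_le _ (hmem t ht) a)
  -- the average gain of `w`
  have hwg : ∑ t ∈ Finset.Icc 1 T, ∑ a : M.X, w a * g t a ≤
      ∑ t ∈ Finset.Icc 1 T, ∑ b : M.X, M.hedge η g (t - 1) b * g t b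
        + (T * (η * (4 * E ^ 2) ^ 2) + R) := by
    rw [Finset.sum_comm]
    set A := ∑ t ∈ Finset.Icc 1 T, ∑ b : M.X, M.hedge η g (t - 1) b * g t b
        + (T * (η * (4 * E ^ 2) ^ 2) + R)
    calc _ ≤ ∑ a : M.X, w a * A := by
          refine Finset.sum_le_sum fun a _ => ?_
          rw [← Finset.mul_sum]
          exact mul_le_mul_of_nonneg_left (hedge_regret_div T hη hη0 hR hR0
            (fun t _ a => hg0 t a) hgE hηE a) (hw.1 a)
      _ = A := by rw [← Finset.sum_mul, hw.2, one_mul]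
  have hID : I ≤ D ^ 2 := by
    obtain ⟨ϑ, hϑ⟩ := halt0
    refine (hI ϑ hϑ).trans ?_
    calc _ ≤ ∑ a : M.X, w a * D ^ 2 := Finset.sum_le_sum fun a _ =>
          mul_le_mul_of_nonneg_left (IsRun.armLoss_le (hD.abs_arm_le _ hϑ.1 a)) (hw.1 a)
      _ = _ := by rw [← Finset.sum_mul, hw.2, one_mul]
  -- In the first `n₀` rounds `θ t` may belong to the alternative of a wrong answer, so they are
  -- charged `D ^ 2`. Later `p² / 2 ≤ (p - q)² / 2 + p q`, where the estimation error `q` is at most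
  -- `μ`.
  have hlow : ∀ t ∈ Finset.Icc 1 T, I ≤ (1 / 2) * ∑ a : M.X, w a * g t a + D * μ
      + (if t ≤ n₀ then (1 : ℝ) else 0) * D ^ 2 := by
    intro t ht
    have hs0 : 0 ≤ ∑ a : M.X, w a * g t a :=
      Finset.sum_nonneg fun a _ => mul_nonneg (hw.1 a) (hg0 t a)
    split_ifs with htn
    · have : 0 ≤ D * μ := by positivity
      linarith
    · have htn' := not_le.1 htn
      have h1 : ∀ a : M.X, M.armLoss (θ t) a ≤ (1 / 2) * g t a + D * μ := by
        intro a
        have h2 := abs_le.1 (hD.abs_arm_le _ (hmem t ht) a)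
        have h3 := abs_le.1 (hfine t ht htn' a)
        rw [hgdef, armLoss]
        set p := (a : Fin d → ℝ) ⬝ᵥ (θ t - M.θs)
        set q := (a : Fin d → ℝ) ⬝ᵥ (M.est θ₁ x ε (t - 1) - M.θs)
        have h4 : p * q ≤ D * μ := by
          refine (le_abs_self _).trans ?_
          rw [abs_mul]
          exact mul_le_mul (abs_le.2 h2) (abs_le.2 h3) (abs_nonneg _) (by linarith)
        nlinarith [sq_nonneg q]
      calc I ≤ ∑ a : M.X, w a * M.armLoss (θ t) a := hI _ (halt t ht htn')
        _ ≤ ∑ a : M.X, w a * ((1 / 2) * g t a + D * μ) := Finset.sum_le_sum fun a _ =>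
            mul_le_mul_of_nonneg_left (h1 a) (hw.1 a)
        _ = (1 / 2) * ∑ a : M.X, w a * g t a + D * μ := by
            simp only [mul_add, Finset.sum_add_distrib, ← Finset.sum_mul, hw.2, one_mul,
              Finset.mul_sum]
            congr 1
            exact Finset.sum_congr rfl fun a _ => by ring
        _ = _ := by ring
  -- The converse comparison: `(p - q)² / 2 = p² / 2 - p q + q² / 2`, with `q² ≤ D μ` because `μ ≤ 1
  -- ≤ D`. Passing from the weights to their mixture with `lamG` costs `γ * D ^ 2`.
  have hupp : ∀ t ∈ Finset.Icc 1 T, (1 / 2) * ∑ b : M.X, M.hedge η g (t - 1) b * g t b ≤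
      ∑ a : M.X, M.armLaw η lamG θ₁ θ x ε t a * M.armLoss (θ t) a + (2 * D * μ + γ * D ^ 2)
      + (if t ≤ n₀ then (1 : ℝ) else 0) * (4 * E ^ 2) := by
    intro t ht
    have ht1 := (Finset.mem_Icc.1 ht).1
    have hs0 : 0 ≤ ∑ a : M.X, M.armLaw η lamG θ₁ θ x ε t a * M.armLoss (θ t) a :=
      Finset.sum_nonneg fun a _ => mul_nonneg (armLaw_nonneg hG ht1 a) (armLoss_nonneg _ _)
    split_ifs with htn
    · have h1 : ∑ b : M.X, M.hedge η g (t - 1) b * g t b ≤ 4 * E ^ 2 := by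
        calc _ ≤ ∑ b : M.X, M.hedge η g (t - 1) b * (4 * E ^ 2) := Finset.sum_le_sum fun b _ =>
              mul_le_mul_of_nonneg_left (hgE t ht b) (hedge_pos _ b).le
          _ = _ := by rw [← Finset.sum_mul, sum_hedge, one_mul]
      have : 0 ≤ 2 * D * μ + γ * D ^ 2 := by positivity
      nlinarith [sq_nonneg E]
    · have htn' := not_le.1 htn
      have h1 : ∀ a : M.X, M.hedge η g (t - 1) a * ((1 / 2) * g t a) ≤
          M.armLaw η lamG θ₁ θ x ε t a * M.armLoss (θ t) a
            + M.hedge η g (t - 1) a * (2 * D * μ + γ * D ^ 2) := by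
        intro a
        have h2 := abs_le.1 (hD.abs_arm_le _ (hmem t ht) a)
        have h3 := abs_le.1 (hfine t ht htn' a)
        have hh0 := (hedge_pos (η := η) (g := g) (t - 1) a).le
        have h5 : (1 / 2) * g t a ≤ M.armLoss (θ t) a + 2 * D * μ := by
          rw [hgdef, armLoss]
          set p := (a : Fin d → ℝ) ⬝ᵥ (θ t - M.θs)
          set q := (a : Fin d → ℝ) ⬝ᵥ (M.est θ₁ x ε (t - 1) - M.θs)
          have h4 : -(p * q) ≤ D * μ := by
            refine (neg_le_abs _).trans ?_
            rw [abs_mul]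
            exact mul_le_mul (abs_le.2 h2) (abs_le.2 h3) (abs_nonneg _) (by linarith)
          have h6 : q ^ 2 ≤ D * μ := by
            have : q ^ 2 ≤ μ ^ 2 := sq_le_sq' h3.1 h3.2
            nlinarith
          nlinarith
        have h6 := one_sub_rate_mul_le_armLaw (η := η) (θ₁ := θ₁) (θ := θ) (x := x) (ε := ε) hG t a
        have h7 := hγ t htn'
        have h8 : M.hedge η g (t - 1) a ≤
            M.armLaw η lamG θ₁ θ x ε t a + γ * M.hedge η g (t - 1) a := by
          have := mul_le_mul_of_nonneg_right h7 hh0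
          linarith
        have h9 := hlossD t ht a
        have h10 := armLoss_nonneg (θ t) a
        calc M.hedge η g (t - 1) a * ((1 / 2) * g t a) ≤
              M.hedge η g (t - 1) a * M.armLoss (θ t) a + M.hedge η g (t - 1) a * (2 * D * μ) := by
              rw [← mul_add]; gcongr
          _ ≤ (M.armLaw η lamG θ₁ θ x ε t a + γ * M.hedge η g (t - 1) a) * M.armLoss (θ t) a
              + M.hedge η g (t - 1) a * (2 * D * μ) := by gcongr
          _ = M.armLaw η lamG θ₁ θ x ε t a * M.armLoss (θ t) a
              + M.hedge η g (t - 1) a * (2 * D * μ + γ * M.armLoss (θ t) a) := by ring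
          _ ≤ _ := by gcongr
      rw [Finset.mul_sum]
      calc _ = ∑ a : M.X, M.hedge η g (t - 1) a * ((1 / 2) * g t a) :=
            Finset.sum_congr rfl fun a _ => by ring
        _ ≤ _ := Finset.sum_le_sum fun a _ => h1 a
        _ = _ := by
            rw [Finset.sum_add_distrib, ← Finset.sum_mul, sum_hedge]; ring
  have hb := sum_ite_le T n₀
  have hsum1 := Finset.sum_le_sum hlow
  have hsum2 := Finset.sum_le_sum hupp
  simp only [Finset.sum_add_distrib, Finset.sum_const, Nat.card_Icc, Nat.add_sub_cancel, nsmul_eq_mul,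
    ← Finset.mul_sum, ← Finset.sum_mul] at hsum1 hsum2
  have hb1 := mul_le_mul_of_nonneg_right hb (sq_nonneg D)
  have hb2 := mul_le_mul_of_nonneg_right hb (by positivity : 0 ≤ 4 * E ^ 2)
  nlinarith

/-- The regularised loss is close to the noiseless one. -/
lemma abs_energy_sub_cumLoss_le (hD : M.IsBound θ₁ D) {n : ℕ} {k : ℝ}
    (hk : ∀ a, |M.armNoise x ε n a| ≤ k) {ϑ : Fin d → ℝ} (hϑ : ϑ ∈ M.Θ) :
    |M.energy x ε n ϑ - M.cumLoss x n ϑ| ≤ D * (M.X.card * k + 2) := by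
  have h1 := abs_le.1 (abs_dotProduct_noise_le (x := x) (ε := ε) (n := n) (v := ϑ - M.θs) hk
    (hD.abs_arm_le ϑ hϑ))
  have h2 := abs_le.1 (hD.abs_self_le ϑ hϑ)
  have h3 := abs_le.1 (hD.abs_cross_le ϑ hϑ)
  have hD1 := hD.one_le
  rw [energy, dotProduct_sub _ (M.noise x ε n)]
  rw [abs_le]
  constructor <;> nlinarith

lemma abs_noisyLoss_le (hD : M.IsBound θ₁ D) {e k : ℝ} (he : |e| ≤ k) {ϑ : Fin d → ℝ} (hϑ : ϑ ∈ M.Θ)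
    (a : M.X) : |M.noisyLoss a e ϑ| ≤ D ^ 2 + k * D := by
  have h1 := hD.abs_arm_le ϑ hϑ a
  have h2 := IsRun.armLoss_le h1
  unfold noisyLoss
  refine (abs_sub _ _).trans (add_le_add ?_ ?_)
  · rwa [abs_of_nonneg (armLoss_nonneg _ _)]
  · rw [abs_mul]
    exact mul_le_mul he h1 (abs_nonneg _) ((abs_nonneg _).trans he)

lemma abs_dotProduct_le_sum_mul_norm (a v : Fin d → ℝ) : |a ⬝ᵥ v| ≤ (∑ i, |a i|) * ‖v‖ := by
  rw [dotProduct, Finset.sum_mul]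
  refine (Finset.abs_sum_le_sum_abs _ _).trans (Finset.sum_le_sum fun i _ => ?_)
  rw [abs_mul]
  exact mul_le_mul_of_nonneg_left (norm_le_pi_norm v i) (abs_nonneg _)

/-- A Lipschitz bound: `p² - q² = (p - q)(p + q)` with factors at most `D r` and `2 D`, for each of
the `n` losses. -/
lemma cumLoss_le_of_mem_ball (hD : M.IsBound θ₁ D) {n : ℕ} {ϑ ϑ₀ : Fin d → ℝ} {r : ℝ} (hϑ : ϑ ∈ M.Θ)
    (hϑ₀ : ϑ₀ ∈ M.Θ) (hr : ϑ ∈ Metric.ball ϑ₀ r) :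
    M.cumLoss x n ϑ ≤ M.cumLoss x n ϑ₀ + n * (D ^ 2 * r) := by
  have hD1 := hD.one_le
  have h1 : ∀ a : M.X, M.armLoss ϑ a ≤ M.armLoss ϑ₀ a + D ^ 2 * r := by
    intro a
    have h2 := abs_le.1 (hD.abs_arm_le ϑ hϑ a)
    have h3 := abs_le.1 (hD.abs_arm_le ϑ₀ hϑ₀ a)
    have h4 : |(a : Fin d → ℝ) ⬝ᵥ (ϑ - ϑ₀)| ≤ D * r := by
      refine (abs_dotProduct_le_sum_mul_norm _ _).trans (mul_le_mul (hD.sum_abs_le a) ?_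
        (norm_nonneg _) (by linarith))
      rw [← dist_eq_norm]; exact (Metric.mem_ball.1 hr).le
    have h5 : (a : Fin d → ℝ) ⬝ᵥ (ϑ - ϑ₀) =
        (a : Fin d → ℝ) ⬝ᵥ (ϑ - M.θs) - (a : Fin d → ℝ) ⬝ᵥ (ϑ₀ - M.θs) := by
      rw [← dotProduct_sub]; congr 1; abel
    rw [h5] at h4
    unfold armLoss
    set p := (a : Fin d → ℝ) ⬝ᵥ (ϑ - M.θs)
    set q := (a : Fin d → ℝ) ⬝ᵥ (ϑ₀ - M.θs)
    have h6 : (p - q) * (p + q) ≤ (D * r) * (2 * D) := by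
      refine (le_abs_self _).trans ?_
      rw [abs_mul]
      exact mul_le_mul h4 (abs_le.2 ⟨by linarith, by linarith⟩) (abs_nonneg _)
        ((abs_nonneg _).trans h4)
    nlinarith
  unfold cumLoss
  refine (Finset.sum_le_sum fun s _ => h1 (x s)).trans (le_of_eq ?_)
  rw [Finset.sum_add_distrib, Finset.sum_const, Nat.card_Icc, Nat.add_sub_cancel, nsmul_eq_mul]

lemma cumLoss_nonneg (n : ℕ) (ϑ : Fin d → ℝ) : 0 ≤ M.cumLoss x n ϑ :=
  Finset.sum_nonneg fun _ _ => armLoss_nonneg _ _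

/-- Continuous exponential weights on the alternative. -/
lemma log_setIntegral_exp_energy_le (hM : M.IsRegular) (hD : M.IsBound θ₁ D)
    {f : (Fin d → ℝ) → Fin d → ℝ} {T n₀ : ℕ} {η k : ℝ} (hη : 0 ≤ η)
    (hn₀ : n₀ ≠ 0) (harg : ∀ t ∈ Finset.Icc 1 T, n₀ < t → f (M.est θ₁ x ε (t - 1)) = M.zs)
    (hε : ∀ t ∈ Finset.Icc 1 T, |ε t| ≤ k) (hηk : η * (D ^ 2 + k * D) ≤ 1) {n : ℕ} (hn : n₀ ≤ n)
    (hnT : n ≤ T) :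
    Real.log (∫ ϑ in M.alt M.zs, Real.exp (-(η * M.energy x ε n ϑ))) ≤
      Real.log (∫ ϑ in M.alt M.zs, Real.exp (-(η * M.energy x ε n₀ ϑ)))
      - η * ∑ t ∈ Finset.Ioc n₀ n,
          ∫ ϑ, M.noisyLoss (x t) (ε t) ϑ ∂(M.paramLaw η f θ₁ x ε t)
      + (n - n₀) * (η * (D ^ 2 + k * D)) ^ 2 := by
  induction n, hn using Nat.le_induction with
  | base => simp
  | succ n hn ih =>
    have ih' := ih (by omega)
    have ht : n + 1 ∈ Finset.Icc 1 T := Finset.mem_Icc.2 ⟨by omega, hnT⟩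
    -- After round `n₀` the answer is `zs`, so the sampling law is the Gibbs measure of the current
    -- energy on one fixed set. This is what makes the potential argument telescope.
    have hlaw : M.paramLaw η f θ₁ x ε (n + 1) = gibbs (M.alt M.zs) fun ϑ => η * M.energy x ε n ϑ := by
      rw [paramLaw_eq_gibbs η f θ₁ x ε (by omega), harg _ ht (by omega), Nat.add_sub_cancel]
    have hcont := continuous_energy x ε n
    have h1 := log_setIntegral_exp_add_le (S := M.alt M.zs) (hM.isBounded.subset (alt_subset _))
      (isClosed_alt hM.isClosed _).measurableSet (hM.volume_alt_ne_zero hM.best_mem)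
      (hcont.const_mul η)
      ((continuous_noisyLoss (x (n + 1)) (ε (n + 1))).const_mul η) (b := η * (D ^ 2 + k * D))
      (fun ϑ hϑ => by
        rw [abs_mul, abs_of_nonneg hη]
        exact mul_le_mul_of_nonneg_left (abs_noisyLoss_le hD (hε _ ht) hϑ.1 _) hη) hηk
    simp only [← mul_add, ← energy_succ] at h1
    rw [integral_const_mul, ← hlaw] at h1
    rw [Finset.sum_Ioc_succ_top hn]
    push_cast
    linarith

end Regret

section

variable {θ₁ : Fin d → ℝ} {θ : ℕ → Fin d → ℝ} {x : ℕ → M.X} {ε : ℕ → ℝ} {lamG : M.X → ℝ} {D : ℝ}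

/-- Used at two temperatures: `η = ηp` for the potential of the parameter player and `η = 1` for the
posterior. -/
lemma log_setIntegral_energy_le (hD : M.IsBound θ₁ D) {S : Set (Fin d → ℝ)} (hS : S ⊆ M.Θ)
    (hSb : Bornology.IsBounded S) (hSm : MeasurableSet S) (hvol : volume S ≠ 0) {n : ℕ} {k c η : ℝ}
    (hη : 0 ≤ η) (hk : ∀ a, |M.armNoise x ε n a| ≤ k) (hc : ∀ ϑ ∈ S, c ≤ M.cumLoss x n ϑ) :
    Real.log (∫ ϑ in S, Real.exp (-(η * M.energy x ε n ϑ))) ≤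
      Real.log (volume.real S) - η * (c - D * (M.X.card * k + 2)) := by
  have hcont := continuous_energy x ε n
  refine log_setIntegral_exp_le hSb hSm hvol (hcont.const_mul η) fun ϑ hϑ => ?_
  have h1 := abs_le.1 (abs_energy_sub_cumLoss_le hD hk (hS hϑ))
  have h2 := hc ϑ hϑ
  exact mul_le_mul_of_nonneg_left (by linarith) hη

lemma le_log_setIntegral_energy (hD : M.IsBound θ₁ D) {S : Set (Fin d → ℝ)} (hS : S ⊆ M.Θ)
    (hSb : Bornology.IsBounded S) (hSm : MeasurableSet S) {n : ℕ} {k η v r : ℝ} (hη : 0 ≤ η)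
    (hk : ∀ a, |M.armNoise x ε n a| ≤ k) {ϑ₀ : Fin d → ℝ} (hϑ₀ : ϑ₀ ∈ S) (hv : 0 < v)
    (hvS : v ≤ volume.real (S ∩ Metric.ball ϑ₀ r)) :
    Real.log v - η * (M.cumLoss x n ϑ₀ + n * (D ^ 2 * r) + D * (M.X.card * k + 2)) ≤
      Real.log (∫ ϑ in S, Real.exp (-(η * M.energy x ε n ϑ))) := by
  have hcont := continuous_energy x ε n
  refine le_log_setIntegral_exp hSb hSm (hcont.const_mul η) hv hvS fun ϑ hϑ => ?_
  have h1 := abs_le.1 (abs_energy_sub_cumLoss_le hD hk (hS hϑ.1))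
  have h2 := cumLoss_le_of_mem_ball (x := x) (n := n) hD (hS hϑ.1) (hS hϑ₀) hϑ.2
  exact mul_le_mul_of_nonneg_left (by linarith) hη

lemma abs_integral_noisyLoss_le (hM : M.IsRegular) (hD : M.IsBound θ₁ D)
    {f : (Fin d → ℝ) → Fin d → ℝ} (hf : M.IsArgmaxOracle f) (η : ℝ) {t : ℕ} {k : ℝ} (hε : |ε t| ≤ k) :
    |∫ ϑ, M.noisyLoss (x t) (ε t) ϑ ∂(M.paramLaw η f θ₁ x ε t)| ≤ D ^ 2 + k * D := by
  have := hM.isProbabilityMeasure_paramLaw hf η θ₁ x ε t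
  have h1 : ∀ᵐ ϑ ∂(M.paramLaw η f θ₁ x ε t), ‖M.noisyLoss (x t) (ε t) ϑ‖ ≤ D ^ 2 + k * D := by
    have h0 := paramLaw_alt_compl hM.isClosed η f θ₁ x ε t
    filter_upwards [measure_eq_zero_iff_ae_notMem.1 h0] with ϑ hϑ
    exact abs_noisyLoss_le hD hε (not_not.1 hϑ).1 _
  have h2 := norm_integral_le_of_norm_le_const h1
  rwa [probReal_univ, mul_one] at h2

/-- The sampling distribution suffers little more loss than any fixed alternative. -/
lemma sum_integral_noisyLoss_le (hM : M.IsRegular) (hD : M.IsBound θ₁ D)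
    {f : (Fin d → ℝ) → Fin d → ℝ} {T n₀ : ℕ} {η k k₀ k₁ v r : ℝ} (hη : 0 < η)
    (hn₀ : n₀ ≠ 0) (hn₀T : n₀ ≤ T)
    (harg : ∀ t ∈ Finset.Icc 1 T, n₀ < t → f (M.est θ₁ x ε (t - 1)) = M.zs)
    (hε : ∀ t ∈ Finset.Icc 1 T, |ε t| ≤ k) (hηk : η * (D ^ 2 + k * D) ≤ 1)
    (hk₀ : ∀ a, |M.armNoise x ε n₀ a| ≤ k₀) (hk₁ : ∀ a, |M.armNoise x ε T a| ≤ k₁)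
    {ϑ₀ : Fin d → ℝ} (hϑ₀ : ϑ₀ ∈ M.alt M.zs) (hv : 0 < v)
    (hvS : v ≤ volume.real (M.alt M.zs ∩ Metric.ball ϑ₀ r)) :
    ∑ t ∈ Finset.Ioc n₀ T, ∫ ϑ, M.noisyLoss (x t) (ε t) ϑ ∂(M.paramLaw η f θ₁ x ε t) ≤
      M.cumLoss x T ϑ₀ + T * (D ^ 2 * r) + D * (M.X.card * k₁ + 2) + D * (M.X.card * k₀ + 2)
      + (Real.log (volume.real (M.alt M.zs)) - Real.log v) / η + T * (η * (D ^ 2 + k * D) ^ 2) := by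
  have hb := hM.isBounded.subset (alt_subset (M := M) M.zs)
  have hm := (isClosed_alt hM.isClosed M.zs).measurableSet
  -- The potential falls from round `n₀` to `T` by at least `η` times the suffered loss, up to
  -- second-order terms. It is bounded above at `n₀` because losses are non-negative, and below at
  -- `T` by the mass near `ϑ₀`.
  have h1 := log_setIntegral_exp_energy_le hM hD hη.le hn₀ harg hε hηk hn₀T le_rfl
  have h2 := log_setIntegral_energy_le hD (alt_subset _) hb hm (hM.volume_alt_ne_zero hM.best_mem)
    hη.le hk₀ (fun ϑ _ => cumLoss_nonneg (x := x) n₀ ϑ)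
  have h3 := le_log_setIntegral_energy hD (alt_subset _) hb hm hη.le hk₁ hϑ₀ hv hvS
  set s := ∑ t ∈ Finset.Ioc n₀ T, ∫ ϑ, M.noisyLoss (x t) (ε t) ϑ ∂(M.paramLaw η f θ₁ x ε t)
  set V := Real.log (volume.real (M.alt M.zs)) - Real.log v with hV
  have h4 : V = η * (V / η) := by field_simp
  have h5 : ((T : ℝ) - n₀) * (η * (D ^ 2 + k * D)) ^ 2 ≤ η * (T * (η * (D ^ 2 + k * D) ^ 2)) := by
    have : 0 ≤ (n₀ : ℝ) * (η * (D ^ 2 + k * D)) ^ 2 := by positivity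
    nlinarith
  refine le_of_mul_le_mul_left ?_ hη
  nlinarith

end

/-! ### Combining the two regrets in a typical epoch. -/

/-- The total error of the regret analysis of an epoch. -/
def regretError (D N μ R ηlam ηp V : ℝ) (ℓ : ℕ) : ℝ :=
  (1 / 2) * (horizon ℓ * (ηlam * (4 * (D * (2 * N + 1) * ℓ ^ 5) ^ 2) ^ 2) + R)
  + horizon ℓ * (3 * D * μ + 1 / ℓ * D ^ 2)
  + (ℓ ^ 8 : ℕ) * (D ^ 2 + 4 * (D * (2 * N + 1) * ℓ ^ 5) ^ 2)
  + horizon ℓ / (ℓ + 1) + (ℓ ^ 8 : ℕ) * (D ^ 2 + 2 * ℓ * D)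
  + (D * (N * (2 * ℓ * √(horizon ℓ)) + 2) + D * (N * (2 * ℓ * ℓ ^ 4) + 2) + V / ηp
    + horizon ℓ * (ηp * (D ^ 2 + 2 * ℓ * D) ^ 2))

namespace IsTypical

variable {ℓ : ℕ} {ηlam ηp : ℝ} {lamG : M.X → ℝ} {f : (Fin d → ℝ) → Fin d → ℝ} {θ₁ : Fin d → ℝ}
  {θ : ℕ → Fin d → ℝ} {x : ℕ → M.X} {ε : ℕ → ℝ} {D : ℝ}

lemma abs_armNoise_le_of_le (h : M.IsTypical ℓ ηlam ηp lamG f θ₁ θ x ε) {n m : ℕ}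
    (hn : n ≤ horizon ℓ) (hnm : n ≤ m) (a : M.X) : |M.armNoise x ε n a| ≤ 2 * ℓ * √m := by
  rcases Nat.eq_zero_or_pos n with h0 | h0
  · subst h0
    simp only [armNoise, Finset.Icc_eq_empty_of_lt zero_lt_one, Finset.sum_empty, abs_zero]
    positivity
  · refine (h.abs_armNoise_le n (Finset.mem_Icc.2 ⟨h0, hn⟩) a).trans ?_
    gcongr

lemma sqrt_pow_eight (ℓ : ℕ) : √((ℓ ^ 8 : ℕ) : ℝ) = (ℓ : ℝ) ^ 4 := by
  rw [Nat.cast_pow, show (ℓ : ℝ) ^ 8 = ((ℓ : ℝ) ^ 4) ^ 2 by ring]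
  exact Real.sqrt_sq (by positivity)

/-- The burn-in bound: up to `n = ℓ ^ 8` the noise per arm is at most `2 ℓ √(ℓ ^ 8) = 2 ℓ ^ 5`. At
`n = 0` the arbitrary initial vector is covered by `D`. -/
lemma abs_est_le (h : M.IsTypical ℓ ηlam ηp lamG f θ₁ θ x ε) (hD : M.IsBound θ₁ D) (hℓ : 1 ≤ ℓ)
    {n : ℕ} (hn : n ≤ horizon ℓ) (hnℓ : n ≤ ℓ ^ 8) (a : M.X) :
    |(a : Fin d → ℝ) ⬝ᵥ (M.est θ₁ x ε n - M.θs)| ≤ D * (2 * M.X.card + 1) * ℓ ^ 5 := by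
  have hD0 : 0 ≤ D := zero_le_one.trans hD.one_le
  have hℓ' : (1 : ℝ) ≤ (ℓ : ℝ) ^ 5 := one_le_pow₀ (by exact_mod_cast hℓ)
  have hN : (0 : ℝ) ≤ M.X.card := Nat.cast_nonneg _
  rcases eq_or_ne n 0 with h0 | h0
  · rw [h0, est, if_pos rfl]
    refine (hD.abs_init_le a).trans ?_
    calc D = D * 1 * 1 := by ring
      _ ≤ _ := by gcongr; linarith
  · have hk : ∀ a, |M.armNoise x ε n a| ≤ 2 * ℓ ^ 5 := fun a => by
      refine (h.abs_armNoise_le_of_le hn hnℓ a).trans (le_of_eq ?_)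
      rw [sqrt_pow_eight]; ring
    refine (abs_dotProduct_est_le hD h0 (by positivity) hk (hD.arm_self_le a)).trans ?_
    rw [mul_assoc]
    refine mul_le_mul_of_nonneg_left ?_ hD0
    linarith

/-- Noise of size `2 ℓ √n` against counts of size `√n ℓ² / 4` leaves a ratio of order `1 / ℓ`, which
tends to zero. -/
lemma sq_est_le [Nonempty M.X] (h : M.IsTypical ℓ ηlam ηp lamG f θ₁ θ x ε) (hD : M.IsBound θ₁ D)
    (hℓ : 1 ≤ ℓ) {C : ℝ} (hC : 0 ≤ C) (hGC : ∀ (a : M.X) (v : Fin d → ℝ),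
      ((a : Fin d → ℝ) ⬝ᵥ v) ^ 2 ≤ C * ∑ b : M.X, lamG b * ((b : Fin d → ℝ) ⬝ᵥ v) ^ 2)
    (hρ : 4 * C * D * (2 * M.X.card + 1) / ℓ ≤ 1) {n : ℕ} (hn : n ≤ horizon ℓ) (hnℓ : ℓ ^ 8 ≤ n)
    (a : M.X) :
    ((a : Fin d → ℝ) ⬝ᵥ (M.est θ₁ x ε n - M.θs)) ^ 2 ≤
      3 * (4 * C * D * (2 * M.X.card + 1) / ℓ) := by
  have hD0 : 0 ≤ D := zero_le_one.trans hD.one_le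
  have hℓ0 : (1 : ℝ) ≤ (ℓ : ℝ) := by exact_mod_cast hℓ
  have hN : (0 : ℝ) ≤ M.X.card := Nat.cast_nonneg _
  have hn1 : 1 ≤ n := (Nat.one_le_pow _ _ hℓ).trans hnℓ
  have hs : (1 : ℝ) ≤ √n := Real.one_le_sqrt.2 (by exact_mod_cast hn1)
  have hmem : n ∈ Finset.Icc 1 (horizon ℓ) := Finset.mem_Icc.2 ⟨hn1, hn⟩
  refine sq_dotProduct_est_le (κ := √n * ℓ ^ 2 / 4) (k := 2 * ℓ * √n) hD hC hGC (by omega)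
    (by positivity) (h.abs_armNoise_le n hmem) (by positivity) (fun b => ?_) ?_ hρ a
  · refine le_trans (le_of_eq ?_) (h.le_armCount n hmem hnℓ b)
    ring
  · have h1 : (M.X.card : ℝ) * (2 * ℓ * √n) + 1 ≤ (2 * M.X.card + 1) * (ℓ * √n) := by
      have : 1 ≤ (ℓ : ℝ) * √n := one_le_mul_of_one_le_of_one_le hℓ0 hs
      linarith
    calc C * (D * (M.X.card * (2 * ℓ * √n) + 1)) ≤ C * (D * ((2 * M.X.card + 1) * (ℓ * √n))) := by
          gcongr
      _ = _ := by field_simp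

lemma rate_le (hℓ : 1 ≤ ℓ) {t : ℕ} (ht : ℓ ^ 8 < t) : (t : ℝ) ^ (-(1 / 4) : ℝ) ≤ 1 / ℓ := by
  have hℓ0 : (1 : ℝ) ≤ (ℓ : ℝ) := by exact_mod_cast hℓ
  have h1 : (t : ℝ) ^ (-(1 / 4) : ℝ) ≤ ((ℓ : ℝ) ^ 8) ^ (-(1 / 4) : ℝ) :=
    Real.rpow_le_rpow_of_nonpos (by positivity) (by exact_mod_cast ht.le) (by norm_num)
  refine h1.trans ?_
  have h2 : ((ℓ : ℝ) ^ 8) ^ (-(1 / 4) : ℝ) = 1 / (ℓ : ℝ) ^ 2 := by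
    rw [← Real.rpow_natCast, ← Real.rpow_mul (by positivity),
      show ((8 : ℕ) : ℝ) * (-(1 / 4)) = -((2 : ℕ) : ℝ) by norm_num, Real.rpow_neg (by positivity),
      Real.rpow_natCast, one_div]
  rw [h2]
  exact one_div_le_one_div_of_le (by positivity) (le_self_pow₀ hℓ0 (by norm_num))

/-- In a typical epoch, the loss of every alternative is nearly at least the value of any fixed
design. -/
lemma mul_le_cumLoss (h : M.IsTypical ℓ ηlam ηp lamG f θ₁ θ x ε) (hM : M.IsRegular)
    (hf : M.IsArgmaxOracle f) (hG : lamG ∈ stdSimplex ℝ M.X) (hD : M.IsBound θ₁ D) (hℓ : 1 ≤ ℓ)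
    {C : ℝ} (hC : 0 ≤ C) (hGC : ∀ (a : M.X) (v : Fin d → ℝ),
      ((a : Fin d → ℝ) ⬝ᵥ v) ^ 2 ≤ C * ∑ b : M.X, lamG b * ((b : Fin d → ℝ) ⬝ᵥ v) ^ 2)
    {m μ R : ℝ} (hm : ∀ y : Fin d → ℝ, (∀ a : M.X, |(a : Fin d → ℝ) ⬝ᵥ (y - M.θs)| ≤ m) → f y = M.zs)
    (hμ : μ = √(3 * (4 * C * D * (2 * M.X.card + 1) / ℓ)))
    (hρ : 4 * C * D * (2 * M.X.card + 1) / ℓ ≤ 1) (hμ1 : μ ≤ 1) (hμm : μ ≤ m)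
    (hTℓ : ℓ ^ 8 ≤ horizon ℓ) (hηp : 0 < ηp) (hηpU : ηp * (D ^ 2 + 2 * ℓ * D) ≤ 1)
    (hηlam : 0 < ηlam ∨ M.X.card = 1) (hηlam0 : 0 ≤ ηlam) (hR : Real.log M.X.card / ηlam ≤ R)
    (hR0 : 0 ≤ R) (hηE : ηlam * (4 * (D * (2 * M.X.card + 1) * ℓ ^ 5) ^ 2) ≤ 1)
    {w : M.X → ℝ} (hw : w ∈ stdSimplex ℝ M.X) {I : ℝ}
    (hI : ∀ ϑ ∈ M.alt M.zs, I ≤ ∑ a : M.X, w a * M.armLoss ϑ a)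
    {ϑ₀ : Fin d → ℝ} (hϑ₀ : ϑ₀ ∈ M.alt M.zs) {v r : ℝ} (hv : 0 < v)
    (hvS : v ≤ volume.real (M.alt M.zs ∩ Metric.ball ϑ₀ r)) :
    horizon ℓ * I ≤ M.cumLoss x (horizon ℓ) ϑ₀ + horizon ℓ * (D ^ 2 * r)
      + regretError D M.X.card μ R ηlam ηp
          (Real.log (volume.real (M.alt M.zs)) - Real.log v) ℓ := by
  have := hM.nonempty_arms
  have hD1 := hD.one_le
  have hN : (0 : ℝ) ≤ M.X.card := Nat.cast_nonneg _
  have hℓ0 : (1 : ℝ) ≤ (ℓ : ℝ) := by exact_mod_cast hℓ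
  set T := horizon ℓ with hT
  have hfine : ∀ t ∈ Finset.Icc 1 T, ℓ ^ 8 < t → ∀ a : M.X,
      |(a : Fin d → ℝ) ⬝ᵥ (M.est θ₁ x ε (t - 1) - M.θs)| ≤ μ := by
    intro t ht htℓ a
    have ht' := Finset.mem_Icc.1 ht
    rw [hμ]
    exact Real.abs_le_sqrt (h.sq_est_le hD hℓ hC hGC hρ (by omega) (by omega) a)
  have hE1 : (1 : ℝ) ≤ (2 * M.X.card + 1) * ℓ ^ 5 :=
    one_le_mul_of_one_le_of_one_le (by linarith) (one_le_pow₀ hℓ0)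
  have hE : D ≤ D * (2 * M.X.card + 1) * ℓ ^ 5 := by
    rw [mul_assoc]; exact le_mul_of_one_le_right (by linarith) hE1
  have hμ0 : 0 ≤ μ := hμ ▸ Real.sqrt_nonneg _
  have hcrude : ∀ t ∈ Finset.Icc 1 T, ∀ a : M.X,
      |(a : Fin d → ℝ) ⬝ᵥ (M.est θ₁ x ε (t - 1) - M.θs)| ≤ D * (2 * M.X.card + 1) * ℓ ^ 5 := by
    intro t ht a
    have ht' := Finset.mem_Icc.1 ht
    by_cases htℓ : ℓ ^ 8 < t
    · exact (hfine t ht htℓ a).trans (hμ1.trans (hD1.trans hE))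
    · exact h.abs_est_le hD hℓ (by omega) (by omega) a
  have harg : ∀ t ∈ Finset.Icc 1 T, ℓ ^ 8 < t → f (M.est θ₁ x ε (t - 1)) = M.zs :=
    fun t ht htℓ => hm _ fun a => (hfine t ht htℓ a).trans hμm
  -- The chain: `h1` bounds `T * I` by the loss averaged over arms, `h3` (the martingale) replaces
  -- it by the loss averaged over parameters, `h4` bounds the burn-in part of the latter trivially,
  -- and `h2` compares the rest with `ϑ₀`.
  have h1 := mul_le_sum_armLaw_mul_armLoss (η := ηlam) (n₀ := ℓ ^ 8) (T := T) (γ := 1 / ℓ) hD hG hE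
    hμ0 hμ1 hηlam hηlam0 hR hR0 hηE (fun t ht => (h.param_mem t ht).1)
    (fun t ht htℓ => harg t ht htℓ ▸ h.param_mem t ht) hM.alt_nonempty hcrude hfine
    (fun t ht => rate_le hℓ ht) hw hI
  have hn₀ : ℓ ^ 8 ≠ 0 := by positivity
  have h2 := sum_integral_noisyLoss_le (k := 2 * ℓ) (k₀ := 2 * ℓ * ℓ ^ 4) (k₁ := 2 * ℓ * √T)
    (x := x) (ε := ε) (f := f) hM hD hηp hn₀ hTℓ harg h.abs_noise_le hηpU
    (fun a => by simpa only [sqrt_pow_eight] using h.abs_armNoise_le_of_le hTℓ le_rfl a)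
    (fun a => h.abs_armNoise_le_of_le le_rfl le_rfl a) hϑ₀ hv hvS
  have h3 := (abs_le.1 h.abs_gap_le).1
  rw [Finset.sum_sub_distrib] at h3
  have hsplit : ∀ u : ℕ → ℝ, ∑ t ∈ Finset.Icc 1 T, u t =
      ∑ t ∈ Finset.Icc 1 (ℓ ^ 8), u t + ∑ t ∈ Finset.Ioc (ℓ ^ 8) T, u t := by
    intro u
    have e : ∀ k : ℕ, Finset.Icc 1 k = Finset.Ioc 0 k := fun k => by
      ext s; simp only [Finset.mem_Icc, Finset.mem_Ioc]; omega
    rw [e, e, Finset.sum_Ioc_consecutive _ (Nat.zero_le _) hTℓ]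
  rw [hsplit fun t => ∫ ϑ, M.noisyLoss (x t) (ε t) ϑ ∂(M.paramLaw ηp f θ₁ x ε t)] at h3
  have h4 : ∑ t ∈ Finset.Icc 1 (ℓ ^ 8),
      ∫ ϑ, M.noisyLoss (x t) (ε t) ϑ ∂(M.paramLaw ηp f θ₁ x ε t) ≤
      (ℓ ^ 8 : ℕ) * (D ^ 2 + 2 * ℓ * D) := by
    calc _ ≤ ∑ t ∈ Finset.Icc 1 (ℓ ^ 8), (D ^ 2 + 2 * ℓ * D) :=
          Finset.sum_le_sum fun t ht => (le_abs_self _).trans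
            (abs_integral_noisyLoss_le hM hD hf ηp
              (h.abs_noise_le t (Finset.Icc_subset_Icc_right hTℓ ht)))
      _ = _ := by rw [Finset.sum_const, Nat.card_Icc, Nat.add_sub_cancel, nsmul_eq_mul]
  unfold regretError
  linarith

end IsTypical

/-! ### Growth of the step sizes and of the regret error. -/

lemma cast_horizon (ℓ : ℕ) : (horizon ℓ : ℝ) = 2 ^ ℓ := by simp [horizon]

lemma tendsto_pow_div_sqrt_horizon (k : ℕ) :
    Tendsto (fun ℓ : ℕ => (ℓ : ℝ) ^ k / √(horizon ℓ)) atTop (𝓝 0) := by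
  have h := tendsto_pow_const_div_const_pow_of_one_lt k (r := √2)
    (by rw [Real.lt_sqrt] <;> norm_num)
  refine h.congr fun ℓ => ?_
  rw [cast_horizon]
  congr 1
  refine (Real.sqrt_eq_iff_mul_self_eq (by positivity) (by positivity)).2 ?_ |>.symm
  rw [← mul_pow, Real.mul_self_sqrt (by norm_num)]

/-- `M.rewardMax` may be negative, so `C3` has no sign a priori. The term `2 log (ℓ ^ 2)` makes `β`
diverge, which pushes `C3` above `1` in late epochs. -/
lemma eventually_le_beta {L B : ℝ} (hB : 0 ≤ B) (c : ℝ) :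
    ∀ᶠ ℓ : ℕ in atTop, c ≤ beta d L B (horizon ℓ) ((ℓ : ℝ) ^ 2) := by
  have h : Tendsto (fun ℓ : ℕ => Real.sqrt (2 * Real.log ((ℓ : ℝ) ^ 2))) atTop atTop :=
    Real.tendsto_sqrt_atTop.comp (Tendsto.const_mul_atTop two_pos (Real.tendsto_log_atTop.comp
      ((tendsto_pow_atTop two_ne_zero).comp tendsto_natCast_atTop_atTop)))
  filter_upwards [h.eventually_ge_atTop c] with ℓ hc
  refine hc.trans ?_
  have h0 : 0 ≤ (d : ℝ) * Real.log ((d + horizon ℓ * L ^ 2) / d) := by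
    rcases Nat.eq_zero_or_pos d with h0 | h0
    · simp [h0]
    · have hd : (0 : ℝ) < d := by exact_mod_cast h0
      refine mul_nonneg hd.le (Real.log_nonneg ?_)
      rw [le_div_iff₀ hd, one_mul]
      have : 0 ≤ (horizon ℓ : ℝ) * L ^ 2 := by positivity
      linarith
  have h1 : Real.sqrt (2 * Real.log ((ℓ : ℝ) ^ 2)) ≤
      Real.sqrt (2 * Real.log ((ℓ : ℝ) ^ 2) + d * Real.log ((d + horizon ℓ * L ^ 2) / d)) :=
    Real.sqrt_le_sqrt (by linarith)
  unfold beta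
  linarith

/-- `log T_ℓ` is linear in `ℓ`, and a linear bound on `β` is ample: every polynomial in `ℓ` is
negligible against `√T_ℓ`. -/
lemma beta_le (hd : d ≠ 0) {L B : ℝ} {ℓ : ℕ} (hℓ : 1 ≤ ℓ) :
    beta d L B (horizon ℓ) ((ℓ : ℝ) ^ 2) ≤ B + (2 + d + L ^ 2) * ℓ := by
  have hd' : (0 : ℝ) < d := by exact_mod_cast Nat.pos_of_ne_zero hd
  have hℓ' : (1 : ℝ) ≤ ℓ := by exact_mod_cast hℓ
  refine add_le_add le_rfl (Real.sqrt_le_iff.2 ⟨by positivity, ?_⟩)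
  have h1 : Real.log ((ℓ : ℝ) ^ 2) ≤ (ℓ : ℝ) ^ 2 - 1 := Real.log_le_sub_one_of_pos (by positivity)
  have h2 : Real.log ((d + horizon ℓ * L ^ 2) / d) ≤ ℓ + L ^ 2 / d := by
    have h3 : ((d : ℝ) + horizon ℓ * L ^ 2) / d ≤ 2 ^ ℓ * (1 + L ^ 2 / d) := by
      rw [cast_horizon, mul_add, mul_one, add_div, div_self hd'.ne', mul_div_assoc]
      have : (1 : ℝ) ≤ 2 ^ ℓ := one_le_pow₀ one_le_two
      linarith
    refine (Real.log_le_log (by positivity) h3).trans ?_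
    rw [Real.log_mul (by positivity) (by positivity), Real.log_pow]
    have h4 := Real.log_le_sub_one_of_pos (x := 1 + L ^ 2 / d) (by positivity)
    have h5 := Real.log_le_sub_one_of_pos (x := 2) (by norm_num)
    nlinarith
  have h6 : (d : ℝ) * Real.log ((d + horizon ℓ * L ^ 2) / d) ≤ d * ℓ + L ^ 2 := by
    calc _ ≤ (d : ℝ) * (ℓ + L ^ 2 / d) := mul_le_mul_of_nonneg_left h2 hd'.le
      _ = _ := by field_simp
  have h7 : (ℓ : ℝ) ≤ (ℓ : ℝ) ^ 2 := le_self_pow₀ hℓ' two_ne_zero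
  have hL := sq_nonneg L
  calc _ ≤ (2 + d + L ^ 2) * (ℓ : ℝ) ^ 2 := by nlinarith
    _ ≤ (2 + d + L ^ 2) ^ 2 * (ℓ : ℝ) ^ 2 := by
        refine mul_le_mul_of_nonneg_right ?_ (by positivity)
        exact le_self_pow₀ (by linarith) two_ne_zero
    _ = _ := by ring

lemma exists_C3_le (hd : d ≠ 0) {L B : ℝ} (hL : L ≠ 0) (hB : 0 ≤ B) :
    ∃ K : ℝ, 1 ≤ K ∧ ∀ᶠ ℓ in atTop, 1 ≤ M.C3 L B ℓ ∧ M.C3 L B ℓ ≤ K * ℓ := by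
  have hL2 : 0 < L ^ 2 := by positivity
  set b := M.rewardMax + M.deltaMax with hb
  refine ⟨1 + |b| + L ^ 2 * (B + (2 + d + L ^ 2)), ?_, ?_⟩
  · have := abs_nonneg b
    have : 0 ≤ L ^ 2 * (B + (2 + d + L ^ 2)) := by positivity
    linarith
  filter_upwards [eventually_le_beta (d := d) (L := L) hB ((1 - b) / L ^ 2), eventually_ge_atTop 1]
    with ℓ h1 hℓ
  have hℓ' : (1 : ℝ) ≤ ℓ := by exact_mod_cast hℓ
  have h2 := beta_le (d := d) (L := L) (B := B) hd hℓ
  unfold C3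
  rw [← hb]
  constructor
  · rw [div_le_iff₀ hL2] at h1
    linarith
  · have h3 := mul_le_mul_of_nonneg_left h2 hL2.le
    have h4 : b ≤ |b| * ℓ := (le_abs_self b).trans (le_mul_of_one_le_right (abs_nonneg b) hℓ')
    have h5 : L ^ 2 * B ≤ L ^ 2 * B * ℓ := le_mul_of_one_le_right (by positivity) hℓ'
    nlinarith

section StepSizes

variable {L B K : ℝ} {ℓ : ℕ}

lemma etaLam_eq (h : 1 ≤ M.C3 L B ℓ) :
    M.etaLam L B ℓ = √(Real.log M.X.card) / (M.C3 L B ℓ * √(horizon ℓ)) := by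
  rw [etaLam, Real.sqrt_div (Real.log_natCast_nonneg _), Real.sqrt_mul (sq_nonneg _),
    Real.sqrt_sq (zero_le_one.trans h)]

lemma horizon_pos (ℓ : ℕ) : (0 : ℝ) < horizon ℓ := by rw [cast_horizon]; positivity

lemma etaLam_le (h : 1 ≤ M.C3 L B ℓ) :
    M.etaLam L B ℓ ≤ √(Real.log M.X.card) / √(horizon ℓ) := by
  have hT := horizon_pos ℓ
  rw [etaLam_eq h]
  gcongr
  exact le_mul_of_one_le_left (by positivity) h

lemma etaLam_pos_or [Nonempty M.X] (h : 1 ≤ M.C3 L B ℓ) : 0 < M.etaLam L B ℓ ∨ M.X.card = 1 := by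
  have hT := horizon_pos ℓ
  have hcard : 0 < M.X.card := Finset.card_pos.2 (Finset.nonempty_coe_sort.1 ‹_›)
  rcases eq_or_ne M.X.card 1 with h1 | h1
  · exact Or.inr h1
  · left
    rw [etaLam_eq h]
    have : 0 < Real.log M.X.card := Real.log_pos (by exact_mod_cast by omega)
    positivity

lemma log_card_div_etaLam_le (h : 1 ≤ M.C3 L B ℓ) (hK : M.C3 L B ℓ ≤ K * ℓ) :
    Real.log M.X.card / M.etaLam L B ℓ ≤ √(Real.log M.X.card) * (K * ℓ * √(horizon ℓ)) := by
  have hT := horizon_pos ℓ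
  have h0 := Real.log_natCast_nonneg M.X.card
  rw [etaLam_eq h]
  have : Real.log M.X.card / (√(Real.log M.X.card) / (M.C3 L B ℓ * √(horizon ℓ))) =
      √(Real.log M.X.card) * (M.C3 L B ℓ * √(horizon ℓ)) := by
    rw [div_div_eq_mul_div, mul_div_right_comm, Real.div_sqrt]
  rw [this]
  gcongr

lemma etaP_eq (h : 1 ≤ M.C3 L B ℓ) :
    M.etaP L B ℓ = √(d * Real.log (horizon ℓ * M.C3 L B ℓ)) / (M.C3 L B ℓ * √(horizon ℓ)) := by
  have hT : (1 : ℝ) ≤ horizon ℓ := by rw [cast_horizon]; exact one_le_pow₀ one_le_two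
  rw [etaP, Real.sqrt_div, Real.sqrt_mul (sq_nonneg (M.C3 L B ℓ)),
    Real.sqrt_sq (zero_le_one.trans h)]
  exact mul_nonneg (Nat.cast_nonneg _)
    (Real.log_nonneg (one_le_mul_of_one_le_of_one_le hT h))

lemma etaP_le (h : 1 ≤ M.C3 L B ℓ) (hK : M.C3 L B ℓ ≤ K * ℓ) (hℓ : 1 ≤ ℓ) (hd : d ≠ 0) (hK1 : 1 ≤ K) :
    M.etaP L B ℓ ≤ d * (1 + K) * (ℓ / √(horizon ℓ)) := by
  have hT := horizon_pos ℓ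
  have hd' : (1 : ℝ) ≤ d := by exact_mod_cast Nat.pos_of_ne_zero hd
  have hℓ' : (1 : ℝ) ≤ ℓ := by exact_mod_cast hℓ
  have h1 : √(d * Real.log (horizon ℓ * M.C3 L B ℓ)) ≤ d * (1 + K) * ℓ := by
    rw [Real.sqrt_le_iff]
    refine ⟨by positivity, ?_⟩
    rw [Real.log_mul hT.ne' (by linarith), cast_horizon, Real.log_pow]
    have h4 := Real.log_le_sub_one_of_pos (x := M.C3 L B ℓ) (by linarith)
    have h5 := Real.log_le_sub_one_of_pos (x := 2) (by norm_num)
    have h6 : (ℓ : ℝ) * Real.log 2 + Real.log (M.C3 L B ℓ) ≤ (1 + K) * ℓ := by nlinarith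
    calc _ ≤ (d : ℝ) * ((1 + K) * ℓ) := by gcongr
      _ = d * (1 + K) * ℓ := by ring
      _ ≤ _ := by
        refine le_self_pow₀ ?_ two_ne_zero
        refine one_le_mul_of_one_le_of_one_le (one_le_mul_of_one_le_of_one_le hd' ?_) hℓ'
        linarith
  rw [etaP_eq h]
  calc _ ≤ (d * (1 + K) * ℓ) / √(horizon ℓ) := by
        gcongr
        exact le_mul_of_one_le_left (by positivity) h
    _ = _ := by ring

/-- For `ℓ ≥ 2`, `log T_ℓ ≥ 2 log 2 > 1`, so the numerator under the root in `etaP` is at least `1`.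
The bound controls the term `V / ηp` of the regret. -/
lemma one_div_le_etaP (h : 1 ≤ M.C3 L B ℓ) (hK : M.C3 L B ℓ ≤ K * ℓ) (hℓ : 2 ≤ ℓ) (hd : d ≠ 0) :
    1 / (K * ℓ * √(horizon ℓ)) ≤ M.etaP L B ℓ := by
  have hT := horizon_pos ℓ
  have hd' : (1 : ℝ) ≤ d := by exact_mod_cast Nat.pos_of_ne_zero hd
  have hℓ' : (2 : ℝ) ≤ ℓ := by exact_mod_cast hℓ
  rw [etaP_eq h]
  gcongr
  rw [Real.one_le_sqrt]
  have h1 : 1 ≤ Real.log (horizon ℓ * M.C3 L B ℓ) := by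
    rw [Real.log_mul hT.ne' (by linarith), cast_horizon, Real.log_pow]
    have h2 := Real.log_nonneg h
    have h3 := Real.log_two_gt_d9
    nlinarith
  exact one_le_mul_of_one_le_of_one_le hd' h1

end StepSizes

/-- The errors of the regret analysis are negligible. -/
lemma eventually_regretError_le {D N c₁ c₂ K : ℝ} {μ ηlam ηp : ℕ → ℝ}
    (hμ : Tendsto μ atTop (𝓝 0))
    (hlam : ∀ᶠ ℓ : ℕ in atTop, ηlam ℓ ≤ c₁ / √(horizon ℓ))
    (hp : ∀ᶠ ℓ : ℕ in atTop, ηp ℓ ≤ c₂ * (ℓ / √(horizon ℓ)))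
    (hp' : ∀ᶠ ℓ : ℕ in atTop, 1 / ηp ℓ ≤ K * ℓ * √(horizon ℓ)) (hp0 : ∀ᶠ ℓ in atTop, 0 < ηp ℓ)
    (V : ℝ) {δ : ℝ} (hδ : 0 < δ) :
    ∀ᶠ ℓ : ℕ in atTop, regretError D N (μ ℓ) (c₁ * (K * ℓ * √(horizon ℓ))) (ηlam ℓ) (ηp ℓ) V ℓ ≤
      horizon ℓ * δ := by
  have e := tendsto_pow_div_sqrt_horizon
  have hinv : Tendsto (fun ℓ : ℕ => 1 / (ℓ : ℝ)) atTop (𝓝 0) := tendsto_one_div_atTop_nhds_zero_nat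
  have hinv' : Tendsto (fun ℓ : ℕ => 1 / ((ℓ : ℝ) + 1)) atTop (𝓝 0) :=
    tendsto_one_div_add_atTop_nhds_zero_nat
  -- The substituted upper bound on the error, divided by `T` term by term; `e k` stands for `ℓ ^ k
  -- / √T`. The highest power, `ℓ ^ 20`, comes from the squared gains `(ℓ ^ 10) ^ 2` of the burn-in
  -- scale.
  have hlim := (((((((e 20).const_mul ((1 / 2) * (c₁ * (4 * (D * (2 * N + 1)) ^ 2) ^ 2))).add
    ((e 1).const_mul ((1 / 2) * c₁ * K))).add (hμ.const_mul (3 * D))).add (hinv.const_mul (D ^ 2))).add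
    ((e 8).mul (((e 0).const_mul (D ^ 2)).add ((e 10).const_mul (4 * (D * (2 * N + 1)) ^ 2))))).add
    hinv').add
    (((e 8).mul (((e 0).const_mul (D ^ 2)).add ((e 1).const_mul (2 * D)))).add
    (((e 1).const_mul (2 * D * N)).add (((e 0).mul (e 0)).const_mul (4 * D) |>.add
    (((e 5).mul (e 0)).const_mul (2 * D * N) |>.add (((e 1).const_mul (|V| * K)).add
    (((e 1).const_mul (D ^ 4)).add (((e 2).const_mul (4 * D ^ 3)).add
      ((e 3).const_mul (4 * D ^ 2))) |>.const_mul c₂))))))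
  simp only [mul_zero, add_zero] at hlim
  filter_upwards [hlim.eventually_le_const hδ, hlam, hp, hp', hp0] with ℓ h1 h2 h3 h4 h5
  set s := √(horizon ℓ : ℝ) with hs
  have hs0 : 0 < s := Real.sqrt_pos.2 (horizon_pos ℓ)
  have hss : (horizon ℓ : ℝ) = s * s := (Real.mul_self_sqrt (horizon_pos ℓ).le).symm
  have h6 : V / ηp ℓ ≤ |V| * (K * ℓ * s) := by
    rw [div_eq_mul_one_div]
    exact mul_le_mul (le_abs_self V) h4 (by positivity) (abs_nonneg V)
  refine le_trans ?_ (mul_le_mul_of_nonneg_left h1 (horizon_pos ℓ).le)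
  unfold regretError
  have h7 : (horizon ℓ : ℝ) * (ηlam ℓ * (4 * (D * (2 * N + 1) * ℓ ^ 5) ^ 2) ^ 2) ≤
      horizon ℓ * ((c₁ / s) * (4 * (D * (2 * N + 1) * ℓ ^ 5) ^ 2) ^ 2) := by gcongr
  have h8 : (horizon ℓ : ℝ) * (ηp ℓ * (D ^ 2 + 2 * ℓ * D) ^ 2) ≤
      horizon ℓ * (c₂ * (ℓ / s) * (D ^ 2 + 2 * ℓ * D) ^ 2) := by gcongr
  calc _ ≤ (1 / 2) * (horizon ℓ * ((c₁ / s) * (4 * (D * (2 * N + 1) * ℓ ^ 5) ^ 2) ^ 2)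
            + c₁ * (K * ℓ * s))
          + horizon ℓ * (3 * D * μ ℓ + 1 / ℓ * D ^ 2)
          + (ℓ ^ 8 : ℕ) * (D ^ 2 + 4 * (D * (2 * N + 1) * ℓ ^ 5) ^ 2)
          + horizon ℓ / (ℓ + 1) + (ℓ ^ 8 : ℕ) * (D ^ 2 + 2 * ℓ * D)
          + (D * (N * (2 * ℓ * s) + 2) + D * (N * (2 * ℓ * ℓ ^ 4) + 2) + |V| * (K * ℓ * s)
            + horizon ℓ * (c₂ * (ℓ / s) * (D ^ 2 + 2 * ℓ * D) ^ 2)) := by linarith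
    _ = _ := by
      rw [hss]
      push_cast
      field_simp
      ring

namespace IsRegular

lemma exists_best_ne (hM : M.IsRegular) : ∃ z ∈ M.Z, z ≠ M.zs :=
  let ⟨_, _, z, hz, hne, _⟩ := hM.alt_nonempty
  ⟨z, hz, hne⟩

lemma dim_ne_zero (hM : M.IsRegular) : d ≠ 0 := by
  rintro rfl
  obtain ⟨z, _, hne⟩ := hM.exists_best_ne
  exact hne (Subsingleton.elim _ _)

/-- If `L = 0`, all arms and hence all answers vanish, leaving no alternative. A non-zero `L` is
what lets `L ^ 2 * β` drive `C3` upwards. -/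
lemma arm_bound_ne_zero (hM : M.IsRegular) {L : ℝ} (hL : ∀ a ∈ M.X, norm2 a ≤ L) : L ≠ 0 := by
  rintro rfl
  have h0 : ∀ a ∈ M.X, a = 0 := fun a ha =>
    dotProduct_self_eq_zero.1 (le_antisymm (Real.sqrt_eq_zero'.1
      (le_antisymm (hL a ha) (Real.sqrt_nonneg _))) (dotProduct_self_nonneg a))
  have hspan : Submodule.span ℝ (M.X : Set (Fin d → ℝ)) = ⊥ := Submodule.span_eq_bot.2 h0
  have hz0 : ∀ z ∈ M.Z, z = 0 := fun z hz => by
    have := hM.span_le (Submodule.subset_span (Finset.mem_coe.2 hz))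
    rwa [hspan, Submodule.mem_bot] at this
  obtain ⟨z, hz, hne⟩ := hM.exists_best_ne
  exact hne ((hz0 z hz).trans (hz0 _ hM.best_mem).symm)

lemma isCompact_alt (hM : M.IsRegular) : IsCompact (M.alt M.zs) :=
  Metric.isCompact_of_isClosed_isBounded (isClosed_alt hM.isClosed _)
    (hM.isBounded.subset (alt_subset _))

lemma volume_ne_zero (hM : M.IsRegular) : volume M.Θ ≠ 0 := fun h =>
  hM.volume_alt_ne_zero hM.best_mem (measure_mono_null (alt_subset _) h)

end IsRegular

/-! ### The value of the game and the decay rate of the posterior. -/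

/-- The value of the best response to the design `w`. -/
def designValue (M : Bandit d) (w : M.X → ℝ) : ℝ :=
  ⨅ θ : M.alt M.zs, (1 / 2) * sqNorm (M.design w) ((θ : Fin d → ℝ) - M.θs)

lemma designValue_le {w : M.X → ℝ} (hw : w ∈ stdSimplex ℝ M.X) {ϑ : Fin d → ℝ}
    (hϑ : ϑ ∈ M.alt M.zs) : M.designValue w ≤ ∑ a : M.X, w a * M.armLoss ϑ a := by
  rw [← half_sqNorm_design]
  refine ciInf_le (f := fun θ : M.alt M.zs => (1 / 2) * sqNorm (M.design w) ((θ : Fin d → ℝ) - M.θs))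
    ⟨0, ?_⟩ ⟨ϑ, hϑ⟩
  rintro _ ⟨θ, rfl⟩
  simp only [half_sqNorm_design]
  exact Finset.sum_nonneg fun a _ => mul_nonneg (hw.1 a) (armLoss_nonneg _ _)

lemma designValue_le_tauStar (hM : M.IsRegular) {w : M.X → ℝ} (hw : w ∈ stdSimplex ℝ M.X) :
    M.designValue w ≤ M.tauStar := by
  obtain ⟨D, hD⟩ := exists_isBound hM 0
  obtain ⟨ϑ, hϑ⟩ := hM.alt_nonempty
  refine le_ciSup (f := fun w : stdSimplex ℝ M.X => M.designValue (w : M.X → ℝ))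
    ⟨D ^ 2, ?_⟩ ⟨w, hw⟩
  rintro _ ⟨⟨w, hw⟩, rfl⟩
  refine (designValue_le hw hϑ).trans ?_
  calc _ ≤ ∑ a : M.X, w a * D ^ 2 := Finset.sum_le_sum fun a _ =>
        mul_le_mul_of_nonneg_left (IsRun.armLoss_le (hD.abs_arm_le _ hϑ.1 a)) (hw.1 a)
    _ = _ := by rw [← Finset.sum_mul, hw.2, one_mul]

/-- The empirical frequencies of the arms form a design, whose value is at most `τ*`. This half
holds for every way of choosing the arms. -/
lemma exists_cumLoss_le (hM : M.IsRegular) (x : ℕ → M.X) {n : ℕ} (hn : n ≠ 0) {δ : ℝ} (hδ : 0 < δ) :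
    ∃ ϑ ∈ M.alt M.zs, M.cumLoss x n ϑ ≤ n * (M.tauStar + δ) := by
  have hn' : (0 : ℝ) < n := by exact_mod_cast Nat.pos_of_ne_zero hn
  set w : M.X → ℝ := fun a => M.armCount x n a / n
  have hw : w ∈ stdSimplex ℝ M.X := by
    refine ⟨fun a => div_nonneg (armCount_nonneg x n a) hn'.le, ?_⟩
    rw [← Finset.sum_div, sum_armCount, div_self hn'.ne']
  have := hM.alt_nonempty.to_subtype
  obtain ⟨⟨ϑ, hϑ⟩, h⟩ := exists_lt_of_ciInf_lt
    ((designValue_le_tauStar hM hw).trans_lt (lt_add_of_pos_right _ hδ))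
  refine ⟨ϑ, hϑ, ?_⟩
  simp only [half_sqNorm_design] at h
  have h1 : ∑ a : M.X, w a * M.armLoss ϑ a = M.cumLoss x n ϑ / n := by
    simp only [w, div_mul_eq_mul_div]
    rw [← Finset.sum_div, sum_armCount_mul, cumLoss]
  rw [h1, div_lt_iff₀ hn'] at h
  linarith

/-- The error bound depends neither on the design `w` nor on the run nor on `ϑ`, so one threshold in
`ℓ` serves all of them. The regret inequality with `I = designValue w` can then be maximised over
`w`. -/
lemma eventually_le_cumLoss (hM : M.IsRegular) {f : (Fin d → ℝ) → Fin d → ℝ}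
    (hf : M.IsArgmaxOracle f) {lamG : M.X → ℝ} (hG : M.IsGOptimal lamG) {L B : ℝ}
    (hL : ∀ a ∈ M.X, norm2 a ≤ L) (hB : 0 ≤ B) (θ₁ : Fin d → ℝ) {δ : ℝ} (hδ : 0 < δ) :
    ∀ᶠ ℓ : ℕ in atTop, ∀ (θ : ℕ → Fin d → ℝ) (x : ℕ → M.X) (ε : ℕ → ℝ),
      M.IsTypical ℓ (M.etaLam L B ℓ) (M.etaP L B ℓ) lamG f θ₁ θ x ε →
      ∀ ϑ ∈ M.alt M.zs, horizon ℓ * (M.tauStar - δ) ≤ M.cumLoss x (horizon ℓ) ϑ := by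
  have := hM.nonempty_arms
  obtain ⟨D, hD⟩ := exists_isBound hM θ₁
  obtain ⟨C, hC, hGC⟩ := hG.exists_sq_le
  obtain ⟨m, hm0, hm⟩ := exists_argmax_eq hM hf
  obtain ⟨K, hK1, hK⟩ := exists_C3_le (M := M) hM.dim_ne_zero (hM.arm_bound_ne_zero hL) hB
  have hD1 := hD.one_le
  -- At this radius the oscillation of the average loss on a ball costs `δ / 2`; the other half of
  -- `δ` is left for `regretError`.
  have hr : 0 < δ / 2 / D ^ 2 := by positivity
  obtain ⟨v, hv0, hv⟩ := exists_le_volume_inter_ball (hM.isBounded.subset (alt_subset M.zs))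
    hM.isCompact_alt hM.alt_subset_closure hr
  have e := tendsto_pow_div_sqrt_horizon
  set c := 4 * C * D * (2 * M.X.card + 1) with hc
  have hρ : Tendsto (fun ℓ : ℕ => c / (ℓ : ℝ)) atTop (𝓝 0) := tendsto_const_div_atTop_nhds_zero_nat c
  have hμ : Tendsto (fun ℓ : ℕ => √(3 * (c / (ℓ : ℝ)))) atTop (𝓝 0) := by
    have := (hρ.const_mul 3).sqrt
    rwa [mul_zero, Real.sqrt_zero] at this
  set c₁ := √(Real.log M.X.card) with hc₁
  set c₂ := (d : ℝ) * (1 + K) with hc₂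
  have hlam : ∀ᶠ ℓ : ℕ in atTop, M.etaLam L B ℓ ≤ c₁ / √(horizon ℓ) := by
    filter_upwards [hK] with ℓ h using etaLam_le h.1
  have hp : ∀ᶠ ℓ : ℕ in atTop, M.etaP L B ℓ ≤ c₂ * (ℓ / √(horizon ℓ)) := by
    filter_upwards [hK, eventually_ge_atTop 1] with ℓ h hℓ using etaP_le h.1 h.2 hℓ hM.dim_ne_zero hK1
  have hp1 : ∀ᶠ ℓ : ℕ in atTop, 1 / (K * ℓ * √(horizon ℓ)) ≤ M.etaP L B ℓ := by
    filter_upwards [hK, eventually_ge_atTop 2] with ℓ h hℓ using one_div_le_etaP h.1 h.2 hℓ hM.dim_ne_zero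
  have hpos : ∀ᶠ ℓ : ℕ in atTop, 0 < K * ℓ * √(horizon ℓ) := by
    filter_upwards [eventually_ge_atTop 1] with ℓ hℓ
    have := horizon_pos ℓ
    have : (1 : ℝ) ≤ ℓ := by exact_mod_cast hℓ
    positivity
  have hp0 : ∀ᶠ ℓ : ℕ in atTop, 0 < M.etaP L B ℓ := by
    filter_upwards [hp1, hpos] with ℓ h h' using (one_div_pos.2 h').trans_le h
  have hp' : ∀ᶠ ℓ : ℕ in atTop, 1 / M.etaP L B ℓ ≤ K * ℓ * √(horizon ℓ) := by
    filter_upwards [hp1, hp0, hpos] with ℓ h h' h''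
    rwa [div_le_iff₀ h', ← div_le_iff₀' h'']
  have herr := eventually_regretError_le (D := D) (N := M.X.card) (c₁ := c₁) hμ hlam hp hp' hp0
    (Real.log (volume.real (M.alt M.zs)) - Real.log v) (half_pos hδ)
  have hpow : ∀ᶠ ℓ : ℕ in atTop, ℓ ^ 8 ≤ horizon ℓ := by
    filter_upwards [(e 8).eventually_le_const one_pos] with ℓ h
    have hT := horizon_pos ℓ
    rw [div_le_one (by positivity)] at h
    have h1 : (1 : ℝ) ≤ horizon ℓ := by rw [cast_horizon]; exact one_le_pow₀ one_le_two
    have h2 : √(horizon ℓ : ℝ) ≤ horizon ℓ := Real.sqrt_le_iff.2 ⟨hT.le, le_self_pow₀ h1 two_ne_zero⟩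
    exact_mod_cast h.trans h2
  have hU : ∀ᶠ ℓ : ℕ in atTop, M.etaP L B ℓ * (D ^ 2 + 2 * ℓ * D) ≤ 1 := by
    have hlim := ((e 1).const_mul (c₂ * D ^ 2)).add ((e 2).const_mul (c₂ * (2 * D)))
    simp only [mul_zero, add_zero] at hlim
    filter_upwards [hlim.eventually_le_const one_pos, hp] with ℓ h1 h2
    refine le_trans ?_ h1
    calc _ ≤ c₂ * (ℓ / √(horizon ℓ)) * (D ^ 2 + 2 * ℓ * D) := by gcongr
      _ = _ := by ring
  have hE : ∀ᶠ ℓ : ℕ in atTop,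
      M.etaLam L B ℓ * (4 * (D * (2 * M.X.card + 1) * ℓ ^ 5) ^ 2) ≤ 1 := by
    have hlim := (e 10).const_mul (c₁ * (4 * (D * (2 * M.X.card + 1)) ^ 2))
    rw [mul_zero] at hlim
    filter_upwards [hlim.eventually_le_const one_pos, hlam] with ℓ h1 h2
    refine le_trans ?_ h1
    calc _ ≤ c₁ / √(horizon ℓ) * (4 * (D * (2 * M.X.card + 1) * ℓ ^ 5) ^ 2) := by gcongr
      _ = _ := by ring
  filter_upwards [herr, hpow, hU, hE, hp0, hK, hμ.eventually_le_const one_pos,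
    hμ.eventually_le_const hm0, hρ.eventually_le_const one_pos, eventually_ge_atTop 1, hpos]
    with ℓ g1 g2 g3 g4 g5 g6 g7 g8 g9 g10 g11 θ x ε h ϑ hϑ
  have hT := horizon_pos ℓ
  have key : ∀ w : stdSimplex ℝ M.X,
      M.designValue (w : M.X → ℝ) ≤ M.cumLoss x (horizon ℓ) ϑ / horizon ℓ + δ := by
    rintro ⟨w, hw⟩
    change M.designValue w ≤ _
    have h1 := h.mul_le_cumLoss hM hf hG.1 hD g10 hC hGC hm rfl g9 g7 g8 g2 g5 g3
      (etaLam_pos_or g6.1) (Real.sqrt_nonneg _) (log_card_div_etaLam_le g6.1 g6.2) (by positivity) g4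
      hw (fun ϑ hϑ => designValue_le hw hϑ) hϑ hv0 (hv ϑ hϑ)
    have h2 : D ^ 2 * (δ / 2 / D ^ 2) = δ / 2 := by field_simp
    rw [h2, ← hc, ← hc₁] at h1
    rw [← sub_le_iff_le_add, le_div_iff₀ hT]
    linarith
  have : Nonempty (stdSimplex ℝ M.X) := ⟨⟨lamG, hG.1⟩⟩
  have h3 : M.tauStar ≤ M.cumLoss x (horizon ℓ) ϑ / horizon ℓ + δ := ciSup_le key
  rw [← sub_le_iff_le_add, le_div_iff₀ hT] at h3
  linarith

/-- Dropping the last observation changes the loss by at most `D ^ 2`, so both versions of the final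
law are handled at once through `r ≤ 1`. -/
lemma cumLoss_sub_le {θ₁ : Fin d → ℝ} {D : ℝ} (hD : M.IsBound θ₁ D) (x : ℕ → M.X)
    {n r : ℕ} (hr : r ≤ 1) {ϑ : Fin d → ℝ} (hϑ : ϑ ∈ M.Θ) :
    M.cumLoss x (n - r) ϑ ≤ M.cumLoss x n ϑ ∧ M.cumLoss x n ϑ ≤ M.cumLoss x (n - r) ϑ + D ^ 2 := by
  have hD1 := hD.one_le
  obtain rfl | rfl : r = 0 ∨ r = 1 := by omega
  · simp only [Nat.sub_zero, le_refl, true_and]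
    nlinarith
  · rcases n with _ | n
    · simp only [Nat.zero_sub, le_refl, true_and]
      nlinarith
    · rw [Nat.add_sub_cancel, cumLoss, cumLoss, Finset.sum_Icc_succ_top (by omega)]
      have h1 := armLoss_nonneg (M := M) ϑ (x (n + 1))
      have h2 := IsRun.armLoss_le (hD.abs_arm_le _ hϑ (x (n + 1)))
      constructor <;> linarith

/-- In typical epochs the posterior mass of the alternative decays at the rate `τ*`. -/
lemma eventually_abs_log_posterior_le (hM : M.IsRegular) {f : (Fin d → ℝ) → Fin d → ℝ}
    (hf : M.IsArgmaxOracle f) {lamG : M.X → ℝ} (hG : M.IsGOptimal lamG) {L B : ℝ}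
    (hL : ∀ a ∈ M.X, norm2 a ≤ L) (hB : 0 ≤ B) (θ₁ : Fin d → ℝ) {r : ℕ} (hr : r ≤ 1) {δ : ℝ}
    (hδ : 0 < δ) :
    ∀ᶠ ℓ : ℕ in atTop, ∀ (θ : ℕ → Fin d → ℝ) (x : ℕ → M.X) (ε : ℕ → ℝ),
      M.IsTypical ℓ (M.etaLam L B ℓ) (M.etaP L B ℓ) lamG f θ₁ θ x ε →
      |-(1 / (horizon ℓ : ℝ)) *
        Real.log ((M.posterior θ₁ x ε (horizon ℓ - r)).real (M.alt M.zs)) - M.tauStar| ≤ δ := by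
  obtain ⟨D, hD⟩ := exists_isBound hM θ₁
  have hD1 := hD.one_le
  set ρ := δ / 4 / D ^ 2 with hρdef
  have hρ : 0 < ρ := by positivity
  have hDρ : D ^ 2 * ρ = δ / 4 := by rw [hρdef]; field_simp
  have hAb := hM.isBounded.subset (alt_subset M.zs)
  have hAm := (isClosed_alt hM.isClosed M.zs).measurableSet
  have hAv := hM.volume_alt_ne_zero hM.best_mem
  have hΘm := hM.isClosed.measurableSet
  obtain ⟨v, hv0, hv⟩ := exists_le_volume_inter_ball hAb hM.isCompact_alt hM.alt_subset_closure hρ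
  obtain ⟨u, hu0, hu⟩ := exists_le_volume_inter_ball hM.isBounded (isCompact_singleton (x := M.θs))
    (Set.singleton_subset_iff.2 hM.param_mem_closure) hρ
  have hu' := hu M.θs rfl
  -- All contributions that do not grow with `ℓ`: volumes, the one possibly missing observation, and
  -- the regulariser.
  set W := |Real.log (volume.real (M.alt M.zs))| + |Real.log v| + |Real.log (volume.real M.Θ)|
    + |Real.log u| + D ^ 2 + 4 * D with hW
  have e := tendsto_pow_div_sqrt_horizon
  have hsmall : ∀ᶠ ℓ : ℕ in atTop,
      W + 2 * (D * (M.X.card * (2 * ℓ * √(horizon ℓ)))) ≤ horizon ℓ * (δ / 2) := by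
    have hlim := (((e 0).mul (e 0)).const_mul W).add ((e 1).const_mul (4 * D * M.X.card))
    simp only [mul_zero, add_zero] at hlim
    filter_upwards [hlim.eventually_le_const (half_pos hδ)] with ℓ h
    have hT := horizon_pos ℓ
    refine le_trans (le_of_eq ?_) (mul_le_mul_of_nonneg_left h hT.le)
    set s := √(horizon ℓ : ℝ) with hs
    have hs0 : 0 < s := Real.sqrt_pos.2 hT
    rw [show (horizon ℓ : ℝ) = s * s from (Real.mul_self_sqrt hT.le).symm]
    field_simp
    ring
  filter_upwards [hsmall, eventually_le_cumLoss hM hf hG hL hB θ₁ (show 0 < δ / 4 by positivity),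
    eventually_ge_atTop 1] with ℓ h1 h2 hℓ θ x ε h
  have hT := horizon_pos ℓ
  have hT2 : 2 ≤ horizon ℓ := by
    calc 2 = 2 ^ 1 := rfl
      _ ≤ 2 ^ ℓ := Nat.pow_le_pow_right two_pos hℓ
  set n := horizon ℓ - r with hn
  have hn0 : n ≠ 0 := by omega
  have hnT : n ≤ horizon ℓ := Nat.sub_le _ _
  have hnT' : (n : ℝ) ≤ horizon ℓ := by exact_mod_cast hnT
  obtain ⟨ϑ₀, hϑ₀, h3⟩ := exists_cumLoss_le hM x (n := horizon ℓ) (by omega) (show 0 < δ / 4 by positivity)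
  have hk := h.abs_armNoise_le_of_le hnT hnT
  set k := 2 * (ℓ : ℝ) * √(horizon ℓ) with hkdef
  have hsub := fun ϑ (hϑ : ϑ ∈ M.Θ) => cumLoss_sub_le hD x (n := horizon ℓ) hr hϑ
  rw [← hn] at hsub
  -- Laplace bounds for numerator and normaliser. `a1` uses the regret bound on the whole
  -- alternative and `a2` a near-minimiser of the loss; `a3` and `a4` make the normaliser
  -- subexponential, since the loss is non-negative and vanishes at `θs`.
  have a1 := log_setIntegral_energy_le (η := 1) (c := horizon ℓ * (M.tauStar - δ / 4) - D ^ 2) hD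
    (alt_subset M.zs) hAb hAm hAv zero_le_one hk fun ϑ hϑ => by
      linarith [h2 θ x ε h ϑ hϑ, (hsub ϑ hϑ.1).2]
  have a2 := le_log_setIntegral_energy (η := 1) hD (alt_subset M.zs) hAb hAm zero_le_one hk hϑ₀ hv0
    (hv ϑ₀ hϑ₀)
  have a3 := log_setIntegral_energy_le (η := 1) hD subset_rfl hM.isBounded hΘm hM.volume_ne_zero
    zero_le_one hk fun ϑ _ => cumLoss_nonneg n ϑ
  have a4 := le_log_setIntegral_energy (η := 1) hD subset_rfl hM.isBounded hΘm zero_le_one hk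
    hM.param_mem hu0 hu'
  have hzero : M.cumLoss x n M.θs = 0 := by simp [cumLoss, armLoss]
  have hcont := continuous_energy x ε n
  rw [posterior_eq_gibbs θ₁ x ε hn0,
    gibbs_real_apply hM.isBounded hM.volume_ne_zero hcont hAm (alt_subset _),
    Real.log_div (setIntegral_exp_pos hAb hAv hcont).ne'
      (setIntegral_exp_pos hM.isBounded hM.volume_ne_zero hcont).ne']
  simp only [one_mul] at a1 a2 a3 a4
  rw [hzero] at a4
  rw [hDρ] at a2 a4
  have hnδ : (n : ℝ) * (δ / 4) ≤ horizon ℓ * (δ / 4) := by gcongr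
  have h4 := (hsub ϑ₀ hϑ₀.1).1
  set p := Real.log (∫ ϑ in M.alt M.zs, Real.exp (-M.energy x ε n ϑ))
  set q := Real.log (∫ ϑ in M.Θ, Real.exp (-M.energy x ε n ϑ))
  have b1 := abs_le.1 (le_refl |Real.log (volume.real (M.alt M.zs))|)
  have b2 := abs_le.1 (le_refl |Real.log v|)
  have b3 := abs_le.1 (le_refl |Real.log (volume.real M.Θ)|)
  have b4 := abs_le.1 (le_refl |Real.log u|)
  have n1 := abs_nonneg (Real.log (volume.real (M.alt M.zs)))
  have n2 := abs_nonneg (Real.log v)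
  have n3 := abs_nonneg (Real.log (volume.real M.Θ))
  have n4 := abs_nonneg (Real.log u)
  have hD2 := sq_nonneg D
  have c1 : -(1 / (horizon ℓ : ℝ)) * (p - q) - M.tauStar =
      (-(p - q) - horizon ℓ * M.tauStar) / horizon ℓ := by field_simp
  rw [c1, abs_div, abs_of_pos hT, div_le_iff₀ hT, abs_le]
  constructor <;> linarith

end Bandit

end PEPS

end

theorem theorem2 {d : ℕ} (M : PEPS.Bandit d)
    -- the parameter space is closed and bounded with non-empty interior
    (hclosed : IsClosed M.Θ) (hbdd : Bornology.IsBounded M.Θ) (hint : (interior M.Θ).Nonempty)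
    -- the true parameter, the unique best answer, the span condition
    (hθs : M.θs ∈ M.Θ) (hzs : M.zs ∈ M.Z)
    (hunique : ∀ z ∈ M.Z, z ≠ M.zs → z ⬝ᵥ M.θs < M.zs ⬝ᵥ M.θs)
    (hspan : Submodule.span ℝ (M.Z : Set (Fin d → ℝ)) ≤ Submodule.span ℝ (M.X : Set (Fin d → ℝ)))
    -- non-degeneracy of `Θ` at `θ*` and of the alternative set
    (hθs_reg : M.θs ∈ closure (interior M.Θ))
    (halt : (M.alt M.zs).Nonempty)
    (halt_reg : M.alt M.zs ⊆ closure (interior (M.alt M.zs)))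
    -- inputs of the algorithm
    (L B : ℝ) (hL : ∀ a ∈ M.X, PEPS.norm2 a ≤ L) (hB : PEPS.norm2 M.θs ≤ B)
    (lamG : M.X → ℝ) (hG : M.IsGOptimal lamG)
    (argmax : (Fin d → ℝ) → Fin d → ℝ) (hargmax : M.IsArgmaxOracle argmax)
    (θ₁ : Fin d → ℝ)
    -- the run of the algorithm
    {Ω : Type*} [MeasurableSpace Ω] (P : Measure Ω) [IsProbabilityMeasure P]
    (θ : ℕ → ℕ → Ω → Fin d → ℝ) (x : ℕ → ℕ → Ω → M.X) (ε : ℕ → ℕ → Ω → ℝ)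
    (hrun : M.IsDoublingRun P L B lamG argmax θ₁ θ x ε) :
    -- `r = 1` is the law `N(θ̂_T, V_{T-1}⁻¹)` and `r = 0` the law `N(θ̂_{T+1}, V_T⁻¹)` of the
    -- final sample of the epoch, both restricted to `Θ`
    ∀ᵐ ω ∂P, ∀ r : ℕ, r ≤ 1 →
      Tendsto (fun ℓ : ℕ => -(1 / (PEPS.Bandit.horizon ℓ : ℝ)) * Real.log
        ((M.posterior θ₁ (fun t => x ℓ t ω) (fun t => ε ℓ t ω)
          (PEPS.Bandit.horizon ℓ - r)).real (M.alt M.zs))) atTop (𝓝 M.tauStar) ∧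
      Tendsto (fun ℓ : ℕ => -(1 / (PEPS.Bandit.horizon ℓ : ℝ)) * Real.log
        ((M.posterior θ₁ (fun t => x ℓ t ω) (fun t => ε ℓ t ω)
          (PEPS.Bandit.horizon ℓ - r)).real {ϑ | argmax ϑ ≠ M.zs})) atTop (𝓝 M.tauStar) := by
  have hM : M.IsRegular := ⟨hclosed, hbdd, hθs, hzs, hunique, hspan, hθs_reg, halt, halt_reg⟩
  have hB0 : 0 ≤ B := (Real.sqrt_nonneg _).trans hB
  filter_upwards [hrun.ae_eventually_isTypical hM hargmax hG.1] with ω hω r hr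
  -- Ties have posterior mass zero, so the two limits concern the same sequence.
  simp only [PEPS.Bandit.posterior_argmax_ne hclosed hargmax hzs, and_self]
  refine Metric.tendsto_nhds.2 fun δ hδ => ?_
  filter_upwards [hω, PEPS.Bandit.eventually_abs_log_posterior_le hM hargmax hG hL hB0 θ₁ hr
    (half_pos hδ)] with ℓ h1 h2
  rw [Real.dist_eq]
  exact (h2 _ _ _ h1).trans_lt (half_lt_self hδ)
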